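/- Let $n,m\ge 0$ be integers, let $[n]$ be a set of agents and $M$ a set of $m$ indivisible goods, and let every agent $i$ have a binary additive valuation: a value $v_i(g)\in\{0,1\}$ for each good $g$, and $v_i(T)=\sum_{g\in T}v_i(g)$ for $T\subseteq M$. A deterministic allocation is a tuple $D=(D_1,\dots,D_n)$ of pairwise disjoint subsets of $M$ (not all goods need be allocated). It is a maximum Nash welfare (MNW) allocation if, among all deterministic allocations, it maximizes the number of agents with $v_i(D_i)>0$ and, subject to that, maximizes the product of the positive utilities $\prod_{i:\,v_i(D_i)>0}v_i(D_i)$. A fractional allocation is a matrix $A=(A_i(g))$ with $A_i(g)\in[0,1]$ and $\sum_i A_i(g)\le 1$ for every good $g$; agent $i$'s utility is $v_i(A_i)=\sum_{g}A_i(g)v_i(g)$. It is a fractional MNW allocation if, among all fractional allocations, it maximizes the product of $v_i(A_i)$ over those agents $i$ who have positive value for at least one good. A randomized allocation is a probability distribution over deterministic allocations; it implements $A$ if, for all $i$ and $g$, agent $i$ receives good $g$ with probability $A_i(g)$. Theorem. For every binary additive instance and every (real) fractional MNW allocation $A$ there is a randomized allocation that implements $A$ and has only deterministic MNW allocations in its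 support. Moreover, there is an algorithm that, given a binary additive instance and a fractional MNW allocation $A$ with rational entries, computes such a randomized allocation, as an explicit list of deterministic allocations with positive rational weights, in time polynomial in $n$, $m$ and the total binary length of the entries of $A$ (in number of steps on a random access machine on integers whose unit-cost arithmetic operations are addition, subtraction and halving). -/

import Mathlib

namespace MNW

/-! ### Allocations and Nash welfare

Agents are `Fin n`, goods are `Fin m`.  An additive valuation profile is given by the values
`v i g` of single goods. -/

/-- Binary additive valuations: every agent values every good at `0` or `1`. -/
def IsBinary {n m : ℕ} (v : Fin n → Fin m → ℕ) : Prop :=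
  ∀ i g, v i g = 0 ∨ v i g = 1

/-- A deterministic allocation, i.e. a tuple of pairwise disjoint bundles that need not cover all
goods: each good goes to one agent (`some i`) or stays unallocated (`none`). -/
abbrev Allocation (n m : ℕ) : Type := Fin m → Option (Fin n)

/-- The bundle of agent `i`. -/
def bundle {n m : ℕ} (D : Allocation n m) (i : Fin n) : Finset (Fin m) :=
  {g | D g = some i}

/-- The utility of agent `i` for her own bundle. -/
def utility {n m : ℕ} (v : Fin n → Fin m → ℕ) (D : Allocation n m) (i : Fin n) : ℕ :=
  ∑ g ∈ bundle D i, v i g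

/-- The set of agents with positive utility. -/
def winners {n m : ℕ} (v : Fin n → Fin m → ℕ) (D : Allocation n m) : Finset (Fin n) :=
  {i | 0 < utility v D i}

/-- `D` maximizes the number of agents with positive utility among all allocations. -/
def MaxWinners {n m : ℕ} (v : Fin n → Fin m → ℕ) (D : Allocation n m) : Prop :=
  ∀ E : Allocation n m, (winners v E).card ≤ (winners v D).card

/-- Deterministic maximum Nash welfare allocation: it maximizes the number of agents with positive
utility and, subject to that, the product of the positive utilities. -/
def IsMNW {n m : ℕ} (v : Fin n → Fin m → ℕ) (D : Allocation n m) : Prop :=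
  MaxWinners v D ∧ ∀ E : Allocation n m, MaxWinners v E →
    ∏ i ∈ winners v E, utility v E i ≤ ∏ i ∈ winners v D, utility v D i

/-- `A i g` is the fraction of good `g` that agent `i` gets. -/
def IsFractional {n m : ℕ} (A : Fin n → Fin m → ℝ) : Prop :=
  (∀ i g, 0 ≤ A i g ∧ A i g ≤ 1) ∧ ∀ g, ∑ i, A i g ≤ 1

/-- The utility of agent `i` under a fractional allocation. -/
def fracUtility {n m : ℕ} (v : Fin n → Fin m → ℕ) (A : Fin n → Fin m → ℝ) (i : Fin n) : ℝ :=
  ∑ g, A i g * (v i g : ℝ)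

/-- The product of the utilities of the agents who do not have zero value for every good. -/
noncomputable def nashWelfare {n m : ℕ} (v : Fin n → Fin m → ℕ) (A : Fin n → Fin m → ℝ) : ℝ :=
  ∏ i with ∃ g, v i g ≠ 0, fracUtility v A i

/-- Fractional maximum Nash welfare allocation. -/
def IsFractionalMNW {n m : ℕ} (v : Fin n → Fin m → ℕ) (A : Fin n → Fin m → ℝ) : Prop :=
  IsFractional A ∧ ∀ B : Fin n → Fin m → ℝ, IsFractional B → nashWelfare v B ≤ nashWelfare v A

/-- A randomized allocation: a probability distribution on the finite set of deterministic
allocations. -/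
def IsRandomized {n m : ℕ} (p : Allocation n m → ℝ) : Prop :=
  p ∈ stdSimplex ℝ (Allocation n m)

/-- `p` implements `A`: under `p`, agent `i` gets good `g` with probability `A i g`. -/
def Implements {n m : ℕ} (p : Allocation n m → ℝ) (A : Fin n → Fin m → ℝ) : Prop :=
  ∀ i g, ∑ D with g ∈ bundle D i, p D = A i g

/-- The randomized allocation `p` implements the fractional allocation `A` and has only
deterministic maximum Nash welfare allocations in its support. -/
def IsMNWLottery {n m : ℕ} (v : Fin n → Fin m → ℕ) (A : Fin n → Fin m → ℝ)
    (p : Allocation n m → ℝ) : Prop :=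
  IsRandomized p ∧ Implements p A ∧ ∀ D, p D ≠ 0 → IsMNW v D

/-! ### The machine model

A random access machine on integers, programmed with structured control, with unit-cost
instructions.  Addition, subtraction and halving are the only arithmetic operations (there is no
multiplication), so `t` steps lengthen the integers in memory by at most `t` bits, up to the
constants of the program; hence polynomially many steps are polynomially many steps of a Turing
machine. -/

/-- Memory: integer registers, and integer arrays with two indices. -/
structure State where
  reg : ℕ → ℤ
  arr : ℕ → ℕ → ℕ → ℤ

/-- Write `z` to register `x`. -/
def State.setReg (s : State) (x : ℕ) (z : ℤ) : State :=
  { s with reg := Function.update s.reg x z }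

/-- Write `z` to entry `(i, j)` of array `a`. -/
def State.setArr (s : State) (a i j : ℕ) (z : ℤ) : State :=
  ⟨s.reg, Function.update s.arr a
    (Function.update (s.arr a) i (Function.update (s.arr a i) j z))⟩

/-- Programs.  The numbers `x y z i j` name registers and `a` names an array; array entries are
addressed by the contents of registers. -/
inductive Cmd where
  | const (x : ℕ) (c : ℤ)
  | add (x y z : ℕ)
  | sub (x y z : ℕ)
  | half (x y : ℕ)
  | load (x a i j : ℕ)
  | store (a i j x : ℕ)
  | seq (c d : Cmd)
  | ifPos (x : ℕ) (c d : Cmd)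
  | whilePos (x : ℕ) (c : Cmd)

/-- `Run c s s' t`: the program `c`, started in memory `s`, halts in memory `s'` after exactly `t`
steps.  Every assignment and every test is one step; a negative array index is read as `0`. -/
inductive Run : Cmd → State → State → ℕ → Prop
  | const (x : ℕ) (c : ℤ) (s : State) : Run (.const x c) s (s.setReg x c) 1
  | add (x y z : ℕ) (s : State) : Run (.add x y z) s (s.setReg x (s.reg y + s.reg z)) 1
  | sub (x y z : ℕ) (s : State) : Run (.sub x y z) s (s.setReg x (s.reg y - s.reg z)) 1
  | half (x y : ℕ) (s : State) : Run (.half x y) s (s.setReg x (s.reg y / 2)) 1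
  | load (x a i j : ℕ) (s : State) :
      Run (.load x a i j) s (s.setReg x (s.arr a (s.reg i).toNat (s.reg j).toNat)) 1
  | store (a i j x : ℕ) (s : State) :
      Run (.store a i j x) s (s.setArr a (s.reg i).toNat (s.reg j).toNat (s.reg x)) 1
  | seq {c d : Cmd} {s s' s'' : State} {t t' : ℕ} :
      Run c s s' t → Run d s' s'' t' → Run (.seq c d) s s'' (t + t')
  | ifTrue {x : ℕ} {c d : Cmd} {s s' : State} {t : ℕ} :
      0 < s.reg x → Run c s s' t → Run (.ifPos x c d) s s' (t + 1)
  | ifFalse {x : ℕ} {c d : Cmd} {s s' : State} {t : ℕ} :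
      ¬ 0 < s.reg x → Run d s s' t → Run (.ifPos x c d) s s' (t + 1)
  | whileTrue {x : ℕ} {c : Cmd} {s s' s'' : State} {t t' : ℕ} :
      0 < s.reg x → Run c s s' t → Run (.whilePos x c) s' s'' t' →
      Run (.whilePos x c) s s'' (t + t' + 1)
  | whileFalse {x : ℕ} {c : Cmd} {s : State} :
      ¬ 0 < s.reg x → Run (.whilePos x c) s s 1

/-! ### Input and output -/

/-- An `n × m` matrix as the content of an array; all other entries are `0`. -/
def matrixArr {n m : ℕ} (f : Fin n → Fin m → ℤ) : ℕ → ℕ → ℤ := fun i j =>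
  if h : i < n ∧ j < m then f ⟨i, h.1⟩ ⟨j, h.2⟩ else 0

/-- The memory that holds the instance and the rational fractional allocation `A` as input:
registers `0` and `1` hold `n` and `m`, array `0` the valuations, arrays `1` and `2` the numerators
and denominators of `A` in lowest terms.  The rest is `0`. -/
def inputState {n m : ℕ} (v : Fin n → Fin m → ℕ) (A : Fin n → Fin m → ℚ) : State where
  reg := fun x => if x = 0 then n else if x = 1 then m else 0
  arr := fun a =>
    if a = 0 then matrixArr fun i g => (v i g : ℤ)
    else if a = 1 then matrixArr fun i g => (A i g).num
    else if a = 2 then matrixArr fun i g => ((A i g).den : ℤ)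
    else fun _ _ => 0

/-- The size of the input: the number of agents, the number of goods, one bit for each value
`v i g`, and the binary lengths of the numerators and denominators. -/
def inputSize {n m : ℕ} (A : Fin n → Fin m → ℚ) : ℕ :=
  n + m + ∑ i, ∑ g, (1 + (A i g).num.natAbs.size + (A i g).den.size)

/-- The integer that stands for the owner of a good: `0` for nobody, `i + 1` for agent `i`
(agents are numbered from `0`). -/
def ownerCode {n : ℕ} : Option (Fin n) → ℤ
  | none => 0
  | some i => (i : ℤ) + 1

/-- The memory `s` holds the explicit list `L` of deterministic allocations with positive rational
weights: register `0` holds the length of the list, entry `(k, 0)` of arrays `0` and `1` the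
numerator and the denominator of the `k`-th weight, and row `k` of array `2` the owners of the
goods in the `k`-th allocation. -/
def HoldsOutput {n m : ℕ} (s : State) (L : List (ℚ × Allocation n m)) : Prop :=
  s.reg 0 = L.length ∧ ∀ (k : ℕ) (hk : k < L.length),
    0 < s.arr 0 k 0 ∧ 0 < s.arr 1 k 0 ∧ L[k].1 = (s.arr 0 k 0 : ℚ) / (s.arr 1 k 0 : ℚ) ∧
    ∀ g : Fin m, s.arr 2 k g = ownerCode (L[k].2 g)

/-- The distribution given by a weighted list: the mass of `D` is the total weight of its
occurrences. -/
noncomputable def listLottery {n m : ℕ} (L : List (ℚ × Allocation n m)) (D : Allocation n m) : ℝ :=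
  ((L.map fun x => if x.2 = D then x.1 else 0).sum : ℚ)

/-- The program `P`, given a binary additive instance and a rational fractional maximum Nash
welfare allocation `A`, halts within a number of steps that is polynomial in the size of the input,
and outputs a randomized allocation that implements `A` and has only deterministic maximum Nash
welfare allocations in its support. -/
def ComputesMNWLotteryInPolyTime (P : Cmd) : Prop :=
  ∃ q : Polynomial ℕ, ∀ (n m : ℕ) (v : Fin n → Fin m → ℕ) (A : Fin n → Fin m → ℚ),
    IsBinary v → IsFractionalMNW v (fun i g => (A i g : ℝ)) →
    ∃ (s : State) (t : ℕ) (L : List (ℚ × Allocation n m)),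
      Run P (inputState v A) s t ∧ t ≤ q.eval (inputSize A) ∧ HoldsOutput s L ∧
      IsMNWLottery v (fun i g => (A i g : ℝ)) (listLottery L)

end MNW

namespace MNW

/-! ### Optimality conditions for fractional maximum Nash welfare -/

/-! Write `u i` for the utility of agent `i` under the fractional optimum `A`.

Optimality. The welfare cannot increase to first order from `A` towards any fractional allocation
(`IsFractionalMNW.sum_div_le`). Hence every good that somebody values is allocated completely, and
whoever holds a share of it values it and has the least `u` among the agents who value it
(`IsFractionalMNW.sum_eq_one`, `IsFractionalMNW.ne_zero_and_le`).

Rounding. Let `D` give goods only to agents with a share in them, allocate every fully allocated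
good, and round each `u i` to a neighbouring integer. Such a `D` maximizes the sum of `φ (utility v
D i)` for every nondecreasing concave `φ` on the naturals (`IsRounding.sum_le`): replace `φ`, for
each agent, by its secant over the unit interval around `u i`. The secant is exact at `D` and an
upper bound elsewhere, and the resulting linear objective is maximized good by good, since smaller
`u` means a larger slope. The indicator of positivity and a logarithm extended to `0` show that `D`
is an MNW allocation (`IsRounding.isMNW`).

Slots. To write `A` as a mixture of roundings, lay the shares that an agent values end to end and
cut them into unit slots; shares that she does not value get slots of their own. The slot-by-good
matrix has row and column sums at most `N` (the size of a good) and is padded to a square matrix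
with all sums `N`. A perfect matching in its support must use all full slots and cannot use empty
ones, so it yields a rounding (`IsDivision.isRounding`). A decomposition of the matrix into weighted
perfect matchings implements `A` (`IsDivision.sum_slotAllocation`). For real `A` it comes from
Birkhoff's theorem (`exists_isMNWLottery`).

Algorithm. For rational `A`, scale to integers by the product of all denominators, build the padded
matrix, and repeatedly subtract a perfect matching with the largest possible weight; every round
kills an entry or finishes. Matchings are found by an auction with unit price increments: as long as
a row is unassigned, its support contains a column of price below the order `K`
(`AuctionInv.exists_price_lt`), so the sum of `K - price` bounds the number of bids. Correctness and
step counts are proved together in the calculus `Wp`. -/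

theorem exists_abs_prod_one_add_sub_le {ι : Type*} (s : Finset ι) (x : ι → ℝ) :
    ∃ C : ℝ, 0 ≤ C ∧ ∀ t : ℝ, 0 ≤ t → t ≤ 1 →
      |∏ i ∈ s, (1 + t * x i) - 1 - t * ∑ i ∈ s, x i| ≤ C * t ^ 2 := by
  classical
  induction s using Finset.induction_on with
  | empty => exact ⟨0, le_rfl, fun t _ _ => by simp⟩
  | insert a s ha ih =>
    obtain ⟨C, hC, h⟩ := ih
    refine ⟨C * (1 + |x a|) + |x a| * |∑ i ∈ s, x i|, by positivity, fun t ht ht1 => ?_⟩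
    rw [Finset.prod_insert ha, Finset.sum_insert ha]
    have e : (1 + t * x a) * ∏ i ∈ s, (1 + t * x i) - 1 - t * (x a + ∑ i ∈ s, x i) =
        (∏ i ∈ s, (1 + t * x i) - 1 - t * ∑ i ∈ s, x i) * (1 + t * x a) +
          t ^ 2 * (x a * ∑ i ∈ s, x i) := by ring
    rw [e]
    refine (abs_add_le _ _).trans ?_
    rw [abs_mul, abs_mul, abs_mul, abs_of_nonneg (by positivity : 0 ≤ t ^ 2)]
    have h1 : |1 + t * x a| ≤ 1 + |x a| := by
      refine (abs_add_le _ _).trans ?_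
      rw [abs_one, abs_mul, abs_of_nonneg ht]
      nlinarith [abs_nonneg (x a)]
    have := mul_le_mul (h t ht ht1) h1 (abs_nonneg _) (by positivity)
    nlinarith

/-- The sum is the derivative of the product at `t = 0`; the quadratic error bound replaces
differentiation. -/
theorem sum_nonpos_of_prod_one_add_le {ι : Type*} (s : Finset ι) (x : ι → ℝ)
    (h : ∀ t : ℝ, 0 ≤ t → t ≤ 1 → ∏ i ∈ s, (1 + t * x i) ≤ 1) : ∑ i ∈ s, x i ≤ 0 := by
  obtain ⟨C, hC, hb⟩ := exists_abs_prod_one_add_sub_le s x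
  by_contra! hS
  set S := ∑ i ∈ s, x i
  have hpos : 0 < S + C + 1 := by positivity
  -- This `t` is at most `1` and satisfies `C * t < S`, so the linear gain `t * S` beats the error
  -- `C * t ^ 2`.
  have ht0 : 0 < S / (S + C + 1) := by positivity
  have ht1 : S / (S + C + 1) ≤ 1 := by rw [div_le_one hpos]; linarith
  have h1 := h _ ht0.le ht1
  have h2 := (abs_le.mp (hb _ ht0.le ht1)).1
  set t := S / (S + C + 1) with ht
  have h3 : t * S ≤ C * t ^ 2 := by linarith
  have h4 : S ≤ C * t := by nlinarith
  have h5 : t * (S + C + 1) = S := by rw [ht]; field_simp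
  nlinarith

section Fractional

variable {n m : ℕ} {v : Fin n → Fin m → ℕ} {A : Fin n → Fin m → ℝ}

theorem fracUtility_nonneg (hA : IsFractional A) (i : Fin n) : 0 ≤ fracUtility v A i :=
  Finset.sum_nonneg fun g _ => mul_nonneg (hA.1 i g).1 (Nat.cast_nonneg _)

/-- Equal division gives positive utility to every agent who values some good, and `A` does at least
as well. -/
theorem IsFractionalMNW.nashWelfare_pos (hA : IsFractionalMNW v A) : 0 < nashWelfare v A := by
  refine lt_of_lt_of_le ?_ (hA.2 (fun _ _ => 1 / (n : ℝ)) ⟨fun i g => ⟨by positivity, ?_⟩, ?_⟩)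
  · refine Finset.prod_pos fun i hi => ?_
    obtain ⟨g, hg⟩ := (Finset.mem_filter.mp hi).2
    have hn : (0 : ℝ) < n := by exact_mod_cast i.pos
    refine Finset.sum_pos' (fun g _ => by positivity) ⟨g, Finset.mem_univ _, ?_⟩
    have : (0 : ℝ) < v i g := by exact_mod_cast Nat.pos_of_ne_zero hg
    positivity
  · have hn : (1 : ℝ) ≤ n := by exact_mod_cast i.pos
    rw [div_le_one (by linarith)]; exact hn
  · intro g
    rw [Finset.sum_const, Finset.card_univ, Fintype.card_fin, nsmul_eq_mul, mul_one_div]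
    exact div_self_le_one _

theorem IsFractionalMNW.fracUtility_pos (hA : IsFractionalMNW v A) {i : Fin n}
    (hi : ∃ g, v i g ≠ 0) : 0 < fracUtility v A i := by
  refine lt_of_le_of_ne (fracUtility_nonneg hA.1 i) fun h => ?_
  have := hA.nashWelfare_pos
  rw [nashWelfare, Finset.prod_eq_zero (i := i) (by simpa using hi) h.symm] at this
  exact lt_irrefl _ this

/-- First order optimality condition. -/
theorem IsFractionalMNW.sum_div_le (hA : IsFractionalMNW v A) {B : Fin n → Fin m → ℝ}
    (hB : IsFractional B) :
    ∑ i with ∃ g, v i g ≠ 0, (fracUtility v B i - fracUtility v A i) / fracUtility v A i ≤ 0 := by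
  -- Utilities are linear, so at `(1 - t) A + t B` the welfare is that of `A` times the product of
  -- the factors `1 + t * x i`; optimality of `A` bounds this product by `1`.
  refine sum_nonpos_of_prod_one_add_le _ _ fun t ht ht1 => ?_
  have hC : IsFractional fun i g => (1 - t) * A i g + t * B i g := by
    refine ⟨fun i g => ⟨?_, ?_⟩, fun g => ?_⟩
    · have := (hA.1.1 i g).1; have := (hB.1 i g).1
      have : 0 ≤ 1 - t := by linarith
      positivity
    · nlinarith [(hA.1.1 i g).2, (hB.1 i g).2]
    · rw [Finset.sum_add_distrib, ← Finset.mul_sum, ← Finset.mul_sum]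
      nlinarith [hA.1.2 g, hB.2 g]
  have h := hA.2 _ hC
  have e : nashWelfare v (fun i g => (1 - t) * A i g + t * B i g) =
      nashWelfare v A * ∏ i with ∃ g, v i g ≠ 0,
        (1 + t * ((fracUtility v B i - fracUtility v A i) / fracUtility v A i)) := by
    rw [nashWelfare, nashWelfare, ← Finset.prod_mul_distrib]
    refine Finset.prod_congr rfl fun i hi => ?_
    have hpos := hA.fracUtility_pos (by simpa using hi)
    have : fracUtility v (fun i g => (1 - t) * A i g + t * B i g) i =
        (1 - t) * fracUtility v A i + t * fracUtility v B i := by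
      simp only [fracUtility, Finset.mul_sum, ← Finset.sum_add_distrib]
      exact Finset.sum_congr rfl fun g _ => by ring
    rw [this]
    field_simp
    ring
  rw [e] at h
  exact (mul_le_iff_le_one_right hA.nashWelfare_pos).mp h

theorem fracUtility_update (A : Fin n → Fin m → ℝ) (j : Fin n) (g : Fin m) (z : ℝ) (i : Fin n) :
    fracUtility v (Function.update A j (Function.update (A j) g z)) i =
      fracUtility v A i + if i = j then (z - A j g) * v j g else 0 := by
  by_cases h : i = j
  · subst h
    simp only [fracUtility, Function.update_self, if_true]
    rw [← Finset.add_sum_erase _ _ (Finset.mem_univ g),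
      ← Finset.add_sum_erase _ _ (Finset.mem_univ g)]
    rw [Function.update_self, Finset.sum_congr rfl fun x hx => by
      rw [Function.update_of_ne (Finset.ne_of_mem_erase hx)]]
    ring
  · simp [fracUtility, h]

/-- Handing the unallocated rest of `g` to `j` would raise one utility and change no other, against
the first order condition. -/
theorem IsFractionalMNW.sum_eq_one (hA : IsFractionalMNW v A) {j : Fin n} {g : Fin m}
    (hj : v j g ≠ 0) : ∑ i, A i g = 1 := by
  refine le_antisymm (hA.1.2 g) ?_
  by_contra! hlt
  have hsum : ∑ i, A i g = A j g + ∑ i ∈ Finset.univ.erase j, A i g :=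
    (Finset.add_sum_erase _ _ (Finset.mem_univ j)).symm
  have hrest : 0 ≤ ∑ i ∈ Finset.univ.erase j, A i g :=
    Finset.sum_nonneg fun i _ => (hA.1.1 i g).1
  set z := A j g + (1 - ∑ i, A i g) with hz
  have hB : IsFractional (Function.update A j (Function.update (A j) g z)) := by
    refine ⟨fun i h => ?_, fun h => ?_⟩
    · by_cases hi : i = j
      · subst hi
        by_cases hh : h = g
        · subst hh
          simp only [Function.update_self]
          constructor
          · linarith [(hA.1.1 i h).1]
          · linarith
        · simpa [hh] using hA.1.1 i h
      · simpa [hi] using hA.1.1 i h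
    · by_cases hh : h = g
      · subst hh
        rw [← Finset.add_sum_erase _ _ (Finset.mem_univ j), Finset.sum_congr rfl fun x hx => by
          rw [Function.update_of_ne (Finset.ne_of_mem_erase hx)]]
        simp only [Function.update_self]
        linarith
      · refine le_of_eq_of_le (Finset.sum_congr rfl fun i _ => ?_) (hA.1.2 h)
        by_cases hi : i = j
        · subst hi; simp [hh]
        · simp [hi]
  have h := hA.sum_div_le hB
  have hpos := hA.fracUtility_pos ⟨g, hj⟩
  have hv : (0 : ℝ) < v j g := by exact_mod_cast Nat.pos_of_ne_zero hj
  rw [Finset.sum_eq_single j] at h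
  · rw [fracUtility_update, if_pos rfl] at h
    have : 0 < (z - A j g) * v j g := mul_pos (by linarith) hv
    have : 0 < (fracUtility v A j + (z - A j g) * v j g - fracUtility v A j) / fracUtility v A j :=
      div_pos (by linarith) hpos
    linarith
  · intro i _ hi
    rw [fracUtility_update, if_neg hi]; simp
  · intro hnot
    exact absurd (Finset.mem_filter.mpr ⟨Finset.mem_univ _, g, hj⟩) hnot

/-- Moving the whole share of `i` in `g` to `j`. -/
theorem IsFractional.move (hA : IsFractional A) {i j : Fin n} (hij : i ≠ j) (g : Fin m) :
    IsFractional (Function.update (Function.update A i (Function.update (A i) g 0)) j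
      (Function.update (A j) g (A j g + A i g))) := by
  have hsum : ∑ k, A k g = A j g + (A i g + ∑ k ∈ (Finset.univ.erase j).erase i, A k g) := by
    rw [Finset.add_sum_erase _ (fun k => A k g) (Finset.mem_erase.mpr ⟨hij, Finset.mem_univ i⟩),
      Finset.add_sum_erase _ (fun k => A k g) (Finset.mem_univ j)]
  have hrest : 0 ≤ ∑ k ∈ (Finset.univ.erase j).erase i, A k g :=
    Finset.sum_nonneg fun k _ => (hA.1 k g).1
  refine ⟨fun k h => ?_, fun h => ?_⟩
  · by_cases hh : h = g
    · subst hh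
      by_cases hk : k = j
      · subst hk
        simp only [Function.update_self]
        exact ⟨add_nonneg (hA.1 k h).1 (hA.1 i h).1, by linarith [hA.2 h]⟩
      · by_cases hk' : k = i
        · subst hk'; simp [hk]
        · simpa [hk, hk'] using hA.1 k h
    · by_cases hk : k = j
      · subst hk; simpa [hh] using hA.1 k h
      · by_cases hk' : k = i
        · subst hk'; simpa [hk, hh] using hA.1 k h
        · simpa [hk, hk'] using hA.1 k h
  · by_cases hh : h = g
    · subst hh
      rw [← Finset.add_sum_erase _ _ (Finset.mem_univ j),
        ← Finset.add_sum_erase _ _ (Finset.mem_erase.mpr ⟨hij, Finset.mem_univ i⟩),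
        Finset.sum_congr rfl fun x hx => by
          rw [Function.update_of_ne (Finset.ne_of_mem_erase (Finset.mem_of_mem_erase hx)),
            Function.update_of_ne (Finset.ne_of_mem_erase hx)]]
      simp only [Function.update_self, Function.update_of_ne hij]
      linarith [hA.2 h]
    · refine le_of_eq_of_le (Finset.sum_congr rfl fun k _ => ?_) (hA.2 h)
      by_cases hk : k = j
      · subst hk; simp [hh]
      · by_cases hk' : k = i
        · subst hk'; simp [hk, hh]
        · simp [hk, hk']

/-- Moving the share of `i` in `g` to `j` changes the first order sum by `A i g * (1 / u j - v i g /
u i)`, with `u` the utilities under `A`. This must not be positive, which excludes `v i g = 0` and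
`u j < u i`. -/
theorem IsFractionalMNW.ne_zero_and_le (hv : IsBinary v) (hA : IsFractionalMNW v A) {i j : Fin n}
    {g : Fin m} (hi : 0 < A i g) (hj : v j g ≠ 0) :
    v i g ≠ 0 ∧ fracUtility v A i ≤ fracUtility v A j := by
  by_cases hij : i = j
  · subst hij; exact ⟨hj, le_rfl⟩
  have hj1 : v j g = 1 := (hv j g).resolve_left hj
  have hposj := hA.fracUtility_pos ⟨g, hj⟩
  have h := hA.sum_div_le (hA.1.move hij g)
  have hBj : fracUtility v (Function.update (Function.update A i (Function.update (A i) g 0)) j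
      (Function.update (A j) g (A j g + A i g))) = fun k => fracUtility v A k +
        (if k = i then - A i g * v i g else 0) + if k = j then A i g else 0 := by
    funext k
    have := fracUtility_update (v := v) (Function.update A i (Function.update (A i) g 0)) j g
      (A j g + A i g) k
    rw [Function.update_of_ne (Ne.symm hij)] at this
    rw [this, fracUtility_update]
    simp [hj1]
  rw [hBj] at h
  have h' : ∑ k with ∃ g, v k g ≠ 0, ((if k = i then - A i g * v i g / fracUtility v A i else 0) +
      if k = j then A i g / fracUtility v A j else 0) ≤ 0 := by
    refine le_of_eq_of_le (Finset.sum_congr rfl fun k _ => ?_) h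
    by_cases hk : k = i
    · subst hk; simp [hij]
    · by_cases hk' : k = j
      · subst hk'; simp [hk]
      · simp [hk, hk']
  rw [Finset.sum_add_distrib, Finset.sum_ite_eq', Finset.sum_ite_eq'] at h'
  have hjmem : j ∈ Finset.univ.filter fun k => ∃ g, v k g ≠ 0 := by simpa using ⟨g, hj⟩
  rw [if_pos hjmem] at h'
  have hq : 0 < A i g / fracUtility v A j := div_pos hi hposj
  by_cases hvi : v i g = 0
  · simp only [hvi] at h'
    norm_num at h'
    linarith
  · refine ⟨hvi, ?_⟩
    have hvi1 : v i g = 1 := (hv i g).resolve_left hvi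
    have hposi := hA.fracUtility_pos ⟨g, hvi⟩
    have himem : i ∈ Finset.univ.filter fun k => ∃ g, v k g ≠ 0 := by simpa using ⟨g, hvi⟩
    rw [if_pos himem, hvi1, Nat.cast_one, mul_one, neg_div] at h'
    have h2 : A i g / fracUtility v A j ≤ A i g / fracUtility v A i := by linarith
    by_contra! hlt
    have := div_lt_div_of_pos_left hi hposj hlt
    linarith

/-! ### Rounded allocations are maximum Nash welfare allocations -/

/-- A discretely concave function lies below its secant through `c` and `c + 1`: to the right of `c`
the increments are at most that slope, to the left at least. -/
theorem le_add_slope_mul {φ : ℕ → ℝ} (hφ : Antitone fun k => φ (k + 1) - φ k) (c e : ℕ) :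
    φ e ≤ φ c + (φ (c + 1) - φ c) * ((e : ℝ) - c) := by
  rcases le_total c e with h | h
  · induction e, h using Nat.le_induction with
    | base => simp
    | succ e he ih =>
      have := hφ he
      simp only at this
      push_cast
      nlinarith
  · induction h using Nat.decreasingInduction with
    | of_succ e he ih =>
      have := hφ (Nat.le_of_lt_succ (Nat.lt_succ_of_lt he))
      simp only at this
      push_cast at ih
      nlinarith
    | self => simp

theorem utility_eq_sum (D : Allocation n m) (i : Fin n) :
    utility v D i = ∑ g, if D g = some i then v i g else 0 := by
  rw [utility, bundle, Finset.sum_filter]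

/-- `D` rounds the utilities of `A` to neighbouring integers, gives goods only to agents with a
share in them, and allocates all valued goods. -/
structure IsRounding (v : Fin n → Fin m → ℕ) (A : Fin n → Fin m → ℝ) (D : Allocation n m) :
    Prop where
  pos : ∀ i g, D g = some i → 0 < A i g
  isSome : ∀ g, ∑ i, A i g = 1 → ∃ i, D g = some i
  lt_add_one : ∀ i, (utility v D i : ℝ) < fracUtility v A i + 1
  add_one_gt : ∀ i, fracUtility v A i < (utility v D i : ℝ) + 1

/-- With `c = ⌈u⌉ - 1`, where `u` is the utility under `A`, the utility under `D` is `c` or `c + 1`,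
so the secant of `φ` over `[c, c + 1]` is exact at `D` and an upper bound at `E`. What remains is
linear and compared for each good: `D` gives it to an agent with a share, whose `u` is least, and
whose slope is therefore greatest, among the agents who value it. -/
theorem IsRounding.sum_le (hv : IsBinary v) (hA : IsFractionalMNW v A) {D : Allocation n m}
    (hD : IsRounding v A D) {φ : ℕ → ℝ} (hmono : Monotone φ)
    (hφ : Antitone fun k => φ (k + 1) - φ k) (E : Allocation n m) :
    ∑ i, φ (utility v E i) ≤ ∑ i, φ (utility v D i) := by
  have key : ∀ i, ∃ s : ℝ, s = φ (⌈fracUtility v A i⌉₊ - 1 + 1) - φ (⌈fracUtility v A i⌉₊ - 1) ∧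
      φ (utility v E i) ≤ φ (utility v D i) + s * ((utility v E i : ℝ) - utility v D i) := by
    intro i
    refine ⟨_, rfl, ?_⟩
    by_cases hi : ∃ g, v i g ≠ 0
    · have hpos := hA.fracUtility_pos hi
      obtain ⟨c, hc⟩ : ∃ c, ⌈fracUtility v A i⌉₊ = c + 1 :=
        Nat.exists_eq_succ_of_ne_zero (Nat.ceil_pos.mpr hpos).ne'
      rw [hc, Nat.add_sub_cancel]
      have h1 : fracUtility v A i ≤ c + 1 := by
        have := Nat.le_ceil (fracUtility v A i); rw [hc] at this; exact_mod_cast this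
      have h2 : (c : ℝ) < fracUtility v A i := Nat.lt_ceil.mp (by omega)
      have h3 := hD.lt_add_one i
      have h4 := hD.add_one_gt i
      have h5 : utility v D i < c + 2 := by
        have : (utility v D i : ℝ) < (c + 2 : ℕ) := by push_cast; linarith
        exact_mod_cast this
      have h6 : c < utility v D i + 1 := by
        have : (c : ℝ) < (utility v D i + 1 : ℕ) := by push_cast; linarith
        exact_mod_cast this
      have h7 := le_add_slope_mul hφ c (utility v E i)
      obtain h | h : utility v D i = c ∨ utility v D i = c + 1 := by omega
      · rw [h]; exact h7
      · rw [h]; push_cast; linarith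
    -- An agent who values nothing has utility `0` under both allocations, so her slope plays no
    -- role.
    · push Not at hi
      have : ∀ D : Allocation n m, utility v D i = 0 := fun D =>
        Finset.sum_eq_zero fun g _ => hi g
      simp [this]
  choose s hs hle using key
  have hs0 : ∀ i, 0 ≤ s i := fun i => by
    rw [hs]; exact sub_nonneg.mpr (hmono (Nat.le_succ _))
  have hsum : ∀ D : Allocation n m, ∑ i, s i * (utility v D i : ℝ) =
      ∑ g, ∑ i, if D g = some i then s i * v i g else 0 := by
    intro D
    rw [Finset.sum_comm]
    refine Finset.sum_congr rfl fun i _ => ?_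
    rw [utility_eq_sum, Nat.cast_sum, Finset.mul_sum]
    exact Finset.sum_congr rfl fun g _ => by split_ifs <;> simp
  have hlin : ∑ i, s i * (utility v E i : ℝ) ≤ ∑ i, s i * (utility v D i : ℝ) := by
    rw [hsum, hsum]
    refine Finset.sum_le_sum fun g _ => ?_
    have hnn : 0 ≤ ∑ i, if D g = some i then s i * (v i g : ℝ) else 0 :=
      Finset.sum_nonneg fun i _ => by
        split_ifs
        · exact mul_nonneg (hs0 i) (Nat.cast_nonneg _)
        · exact le_rfl
    cases hE : E g with
    | none => simpa using hnn
    | some i =>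
      simp only [Option.some.injEq, Finset.sum_ite_eq, Finset.mem_univ, if_true]
      by_cases hvi : v i g = 0
      · simpa [hvi] using hnn
      · obtain ⟨j, hj⟩ := hD.isSome g (hA.sum_eq_one hvi)
        obtain ⟨hvj, hu⟩ := hA.ne_zero_and_le hv (hD.pos j g hj) hvi
        simp only [hj, Option.some.injEq, Finset.sum_ite_eq, Finset.mem_univ, if_true]
        rw [(hv i g).resolve_left hvi, (hv j g).resolve_left hvj, hs, hs, Nat.cast_one, mul_one,
          mul_one]
        exact hφ (Nat.sub_le_sub_right (Nat.ceil_mono hu) 1)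
  calc ∑ i, φ (utility v E i)
      ≤ ∑ i, (φ (utility v D i) + s i * ((utility v E i : ℝ) - utility v D i)) :=
        Finset.sum_le_sum fun i _ => hle i
    _ = ∑ i, φ (utility v D i) +
        (∑ i, s i * (utility v E i : ℝ) - ∑ i, s i * (utility v D i : ℝ)) := by
        rw [Finset.sum_add_distrib, ← Finset.sum_sub_distrib]
        simp only [mul_sub]
    _ ≤ _ := by linarith

theorem antitone_slope_of_succ {φ : ℕ → ℝ} (h : ∀ k, φ (k + 2) + φ k ≤ 2 * φ (k + 1)) :
    Antitone fun k => φ (k + 1) - φ k :=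
  antitone_nat_of_succ_le fun k => by
    have := h k
    change φ (k + 1 + 1) - φ (k + 1) ≤ φ (k + 1) - φ k
    linarith

/-- Two choices of `φ` suffice. The indicator of positivity counts the winners. The logarithm with
the value `-1` at `0` gives the logarithm of the product minus the number of losers, and this number
is the same for all allocations with the maximal number of winners. -/
theorem IsRounding.isMNW (hv : IsBinary v) (hA : IsFractionalMNW v A) {D : Allocation n m}
    (hD : IsRounding v A D) : IsMNW v D := by
  have hmax : MaxWinners v D := by
    intro E
    have hcard : ∀ D : Allocation n m, ((winners v D).card : ℝ) =
        ∑ i, (fun k : ℕ => if 0 < k then (1 : ℝ) else 0) (utility v D i) := by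
      intro D
      rw [winners, Finset.card_filter]
      push_cast
      rfl
    have h := hD.sum_le hv hA (φ := fun k : ℕ => if 0 < k then (1 : ℝ) else 0) ?_ ?_ E
    · rw [← hcard, ← hcard] at h
      exact_mod_cast h
    · refine monotone_nat_of_le_succ fun k => ?_
      rcases k with _ | k <;> simp
    · refine antitone_slope_of_succ (φ := fun k : ℕ => if 0 < k then (1 : ℝ) else 0) fun k => ?_
      rcases k with _ | k <;> norm_num
  refine ⟨hmax, fun E hE => ?_⟩
  have hcard : (winners v E).card = (winners v D).card := le_antisymm (hmax E) (hE D)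
  have hlog : ∀ D : Allocation n m,
      ∑ i, (fun k : ℕ => if 0 < k then Real.log k else -1) (utility v D i) =
      Real.log (∏ i ∈ winners v D, utility v D i : ℕ) - (n - (winners v D).card : ℝ) := by
    intro D
    rw [Nat.cast_prod, Real.log_prod (fun i hi => by
      have := (Finset.mem_filter.mp hi).2
      exact_mod_cast this.ne')]
    rw [Finset.sum_ite, Finset.sum_const]
    have h1 : (winners v D).card + (Finset.univ.filter fun i => ¬ 0 < utility v D i).card = n := by
      have := Finset.card_filter_add_card_filter_not (s := (Finset.univ : Finset (Fin n)))
        (fun i => 0 < utility v D i)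
      simpa [winners] using this
    have h2 : (n : ℝ) = ((winners v D).card : ℝ) +
        ((Finset.univ.filter fun i => ¬ 0 < utility v D i).card : ℝ) := by exact_mod_cast h1.symm
    rw [nsmul_eq_mul, h2, winners]
    ring
  have h := hD.sum_le hv hA (φ := fun k : ℕ => if 0 < k then Real.log k else -1) ?_ ?_ E
  · rw [hlog, hlog, hcard] at h
    have hpos : ∀ D : Allocation n m, 0 < ∏ i ∈ winners v D, utility v D i := fun D =>
      Finset.prod_pos fun i hi => (Finset.mem_filter.mp hi).2
    have h' : Real.log (∏ i ∈ winners v E, utility v E i : ℕ) ≤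
        Real.log (∏ i ∈ winners v D, utility v D i : ℕ) := by linarith
    rw [Real.log_le_log_iff (by exact_mod_cast hpos E) (by exact_mod_cast hpos D)] at h'
    exact_mod_cast h'
  · refine monotone_nat_of_le_succ fun k => ?_
    rcases k with _ | k
    · simp
    · simp only [Nat.succ_pos, if_true]
      exact Real.log_le_log (by positivity) (by push_cast; linarith)
  · refine antitone_slope_of_succ (φ := fun k : ℕ => if 0 < k then Real.log k else -1) fun k => ?_
    rcases k with _ | k
    -- Here the value `-1` at `0` matters: concavity at `0, 1, 2` reads `log 2 - 1 ≤ 0`.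
    · have : Real.log 2 ≤ 1 := by
        have := Real.log_le_sub_one_of_pos (show (0 : ℝ) < 2 by norm_num)
        linarith
      norm_num
      linarith
    · rw [if_pos (by omega), if_pos (by omega), if_pos (by omega)]
      push_cast
      rw [← Real.log_mul (by positivity) (by positivity)]
      have : 2 * Real.log ((k : ℝ) + 1 + 1) = Real.log (((k : ℝ) + 1 + 1) ^ 2) := by
        rw [Real.log_pow]; norm_num
      rw [this]
      exact Real.log_le_log (by positivity) (by nlinarith)

end Fractional

/-! ### Perfect matchings in the support of a matrix -/

/-- `σ`, restricted to indices below `K`, is a perfect matching from columns to rows in the support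
of `Z`. -/
structure IsMatching {α : Type*} [Zero α] [LT α] (K : ℕ) (Z : ℕ → ℕ → α) (σ : ℕ → ℕ) : Prop where
  lt : ∀ c < K, σ c < K
  inj : ∀ c < K, ∀ c' < K, σ c = σ c' → c = c'
  pos : ∀ c < K, 0 < Z (σ c) c

theorem IsMatching.surj {α : Type*} [Zero α] [LT α] {K : ℕ} {Z : ℕ → ℕ → α} {σ : ℕ → ℕ}
    (h : IsMatching K Z σ) {r : ℕ}
    (hr : r < K) : ∃ c < K, σ c = r := by
  have := Finset.surj_on_of_inj_on_of_card_le (s := Finset.range K) (t := Finset.range K)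
    (fun c _ => σ c) (fun c hc => Finset.mem_range.mpr (h.lt c (Finset.mem_range.mp hc)))
    (fun c c' hc hc' => h.inj c (Finset.mem_range.mp hc) c' (Finset.mem_range.mp hc')) le_rfl r
    (Finset.mem_range.mpr hr)
  obtain ⟨c, hc, e⟩ := this
  exact ⟨c, Finset.mem_range.mp hc, e.symm⟩

/-! ### Splitting agents into slots -/

/-- The value of the first `g` goods for agent `i`. -/
def cum {α : Type*} [CommRing α] (X : ℕ → ℕ → α) (v : ℕ → ℕ → ℕ) (i g : ℕ) : α :=
  ∑ h ∈ Finset.range g, X i h * v i h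

theorem cum_succ {α : Type*} [CommRing α] (X : ℕ → ℕ → α) (v : ℕ → ℕ → ℕ) (i g : ℕ) :
    cum X v i (g + 1) = cum X v i g + X i g * v i g := Finset.sum_range_succ _ _

theorem sum_range_mul_eq {α : Type*} [AddCommMonoid α] (n b : ℕ) (f : ℕ → α) :
    ∑ r ∈ Finset.range (n * b), f r =
      ∑ i ∈ Finset.range n, ∑ k ∈ Finset.range b, f (i * b + k) := by
  induction n with
  | zero => simp
  | succ n ih => rw [Nat.succ_mul, Finset.sum_range_add, ih, Finset.sum_range_succ]

section Slots

variable {α : Type*} [CommRing α] [LinearOrder α]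

/-- The length of `[0, t] ∩ [k * N, (k + 1) * N]`. -/
def level (N : α) (k : ℕ) (t : α) : α := max 0 (min N (t - k * N))

theorem level_nonneg (N : α) (k : ℕ) (t : α) : 0 ≤ level N k t := le_max_left _ _

theorem level_le {N : α} (hN : 0 ≤ N) (k : ℕ) (t : α) : level N k t ≤ N :=
  max_le hN (min_le_left _ _)

variable [IsStrictOrderedRing α]

theorem level_mono (N : α) (k : ℕ) : Monotone (level N k) := fun _ _ h =>
  max_le_max le_rfl (min_le_min le_rfl (sub_le_sub_right h _))

theorem level_zero {N : α} (hN : 0 ≤ N) (k : ℕ) : level N k 0 = 0 := by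
  have : 0 ≤ (k : α) * N := by positivity
  exact max_eq_left ((min_le_right _ _).trans (by linarith))

theorem level_eq_of_le {N : α} (hN : 0 ≤ N) {k : ℕ} {t : α} (h : ((k + 1 : ℕ) : α) * N ≤ t) :
    level N k t = N := by
  push_cast at h
  rw [level, min_eq_left (by linarith), max_eq_right hN]

theorem lt_of_level_pos {N : α} {k : ℕ} {t : α} (h : 0 < level N k t) : k * N < t := by
  rw [level, lt_max_iff] at h
  have := (lt_min_iff.mp (h.resolve_left (lt_irrefl _))).2
  linarith

/-- The intervals `[k * N, (k + 1) * N]` with `k < m` tile `[0, m * N]`. -/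
theorem sum_level {N t : α} (hN : 0 ≤ N) (ht : 0 ≤ t) (m : ℕ) :
    ∑ k ∈ Finset.range m, level N k t = min t (m * N) := by
  induction m with
  | zero => simp [ht]
  | succ m ih =>
    rw [Finset.sum_range_succ, ih, level]
    push_cast
    rcases le_total t (m * N) with h | h
    · rw [min_eq_left h, min_eq_left (by linarith : t ≤ (m + 1) * N), min_eq_right (by linarith),
        max_eq_left (by linarith), add_zero]
    · rw [min_eq_right h]
      rcases le_total t ((m + 1) * N) with h' | h'
      · rw [min_eq_left h', min_eq_right (by linarith), max_eq_right (by linarith)]; ring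
      · rw [min_eq_right h', min_eq_left (by linarith), max_eq_right hN]; ring

/-- Agent `i` has the `2 * m` slots `i * (2 * m) + k`.  The `k`-th slot, for `k < m`, takes the
`k`-th unit of value, and the slot `m + g` the share in `g` if the agent does not value `g`. -/
def slots (m : ℕ) (N : α) (X : ℕ → ℕ → α) (v : ℕ → ℕ → ℕ) (r g : ℕ) : α :=
  if r % (2 * m) < m then
    -- With the valued shares laid end to end, the share in `g` occupies the interval from `cum g`
    -- to `cum (g + 1)`; this is the length of its part inside the unit interval of the slot.
    level N (r % (2 * m)) (cum X v (r / (2 * m)) (g + 1)) -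
      level N (r % (2 * m)) (cum X v (r / (2 * m)) g)
  else if r % (2 * m) = m + g then X (r / (2 * m)) g * (1 - v (r / (2 * m)) g) else 0

/-- `X` divides goods of size `N` among `n` agents with binary valuations `v`. -/
structure IsDivision (n m : ℕ) (N : α) (X : ℕ → ℕ → α) (v : ℕ → ℕ → ℕ) : Prop where
  pos : 0 < N
  nonneg : ∀ i < n, ∀ g < m, 0 ≤ X i g
  sum_le : ∀ g < m, ∑ i ∈ Finset.range n, X i g ≤ N
  binary : ∀ i g, v i g = 0 ∨ v i g = 1

namespace IsDivision

variable {n m : ℕ} {N : α} {X : ℕ → ℕ → α} {v : ℕ → ℕ → ℕ}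

theorem le (h : IsDivision n m N X v) {i g : ℕ} (hi : i < n) (hg : g < m) : X i g ≤ N :=
  (Finset.single_le_sum (f := fun i => X i g)
    (fun j hj => h.nonneg j (Finset.mem_range.mp hj) g hg) (Finset.mem_range.mpr hi)).trans
    (h.sum_le g hg)

theorem mul_nonneg (h : IsDivision n m N X v) {i g : ℕ} (hi : i < n) (hg : g < m) :
    0 ≤ X i g * v i g :=
  _root_.mul_nonneg (h.nonneg i hi g hg) (Nat.cast_nonneg _)

theorem mul_le (h : IsDivision n m N X v) {i g : ℕ} (hi : i < n) (hg : g < m) :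
    X i g * v i g ≤ N := by
  rcases h.binary i g with hv | hv
  · simp [hv, h.pos.le]
  · simpa [hv] using h.le hi hg

theorem cum_nonneg (h : IsDivision n m N X v) {i g : ℕ} (hi : i < n) (hg : g ≤ m) :
    0 ≤ cum X v i g :=
  Finset.sum_nonneg fun _ hh => h.mul_nonneg hi ((Finset.mem_range.mp hh).trans_le hg)

theorem cum_le (h : IsDivision n m N X v) {i g : ℕ} (hi : i < n) (hg : g ≤ m) :
    cum X v i g ≤ m * N := by
  have : cum X v i g ≤ g * N := by
    have := Finset.sum_le_card_nsmul (Finset.range g) (fun a => X i a * v i a) N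
      fun a ha => h.mul_le hi ((Finset.mem_range.mp ha).trans_le hg)
    simpa [cum] using this
  refine this.trans (mul_le_mul_of_nonneg_right (by exact_mod_cast hg) h.pos.le)

theorem cum_mono (h : IsDivision n m N X v) {i g g' : ℕ} (hi : i < n) (hgg : g ≤ g') (hg : g' ≤ m) :
    cum X v i g ≤ cum X v i g' :=
  Finset.sum_le_sum_of_subset_of_nonneg (Finset.range_mono hgg) fun _ ha _ =>
    h.mul_nonneg hi ((Finset.mem_range.mp ha).trans_le hg)

theorem slots_nonneg (h : IsDivision n m N X v) {r g : ℕ} (hr : r < n * (2 * m)) (hg : g < m) :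
    0 ≤ slots m N X v r g := by
  have hi : r / (2 * m) < n := Nat.div_lt_of_lt_mul (by rwa [mul_comm])
  unfold slots
  split_ifs
  · exact sub_nonneg.mpr (level_mono _ _ (h.cum_mono hi (Nat.le_succ g) hg))
  · refine _root_.mul_nonneg (h.nonneg _ hi _ hg) ?_
    rcases h.binary (r / (2 * m)) g with hv | hv <;> simp [hv]
  · exact le_rfl

theorem sum_slots_row (h : IsDivision n m N X v) (r : ℕ) (hk : r % (2 * m) < m) :
    ∑ g ∈ Finset.range m, slots m N X v r g =
      level N (r % (2 * m)) (cum X v (r / (2 * m)) m) := by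
  simp only [slots, if_pos hk]
  rw [Finset.sum_range_sub (fun g => level N (r % (2 * m)) (cum X v (r / (2 * m)) g))]
  simp [cum, level_zero h.pos.le]

theorem sum_slots_row_le (h : IsDivision n m N X v) {r : ℕ} (hr : r < n * (2 * m)) :
    ∑ g ∈ Finset.range m, slots m N X v r g ≤ N := by
  have hi : r / (2 * m) < n := Nat.div_lt_of_lt_mul (by rwa [mul_comm])
  by_cases hk : r % (2 * m) < m
  · rw [h.sum_slots_row r hk]; exact level_le h.pos.le _ _
  · have hm : 0 < 2 * m := Nat.pos_of_ne_zero fun h0 => by simp [h0] at hr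
    have hlt := Nat.mod_lt r hm
    rw [Finset.sum_eq_single (r % (2 * m) - m)]
    · rw [slots, if_neg hk, if_pos (by omega)]
      have h1 := h.le hi (show r % (2 * m) - m < m by omega)
      rcases h.binary (r / (2 * m)) (r % (2 * m) - m) with hv | hv
      · simpa [hv] using h1
      · simpa [hv] using h.pos.le
    · intro g _ hg
      rw [slots, if_neg hk, if_neg (by omega)]
    · intro hg
      exact absurd (Finset.mem_range.mpr (by omega)) hg

/-- The total value is at most `m * N`, so the `m` value slots hold all of it: their levels add up
to `cum`, whose increment is the valued share. The slot `m + g` supplies the share if it is not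
valued. -/
theorem sum_slots_agent (h : IsDivision n m N X v) {i g : ℕ} (hi : i < n) (hg : g < m) :
    ∑ k ∈ Finset.range (2 * m), slots m N X v (i * (2 * m) + k) g = X i g := by
  have hdiv : ∀ k < 2 * m, (i * (2 * m) + k) / (2 * m) = i ∧ (i * (2 * m) + k) % (2 * m) = k :=
    fun k hk => ⟨by rw [mul_comm, Nat.mul_add_div (by omega), Nat.div_eq_of_lt hk, add_zero],
      by rw [mul_comm, Nat.mul_add_mod, Nat.mod_eq_of_lt hk]⟩
  rw [two_mul, Finset.sum_range_add, ← two_mul]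
  have h1 : ∑ k ∈ Finset.range m, slots m N X v (i * (2 * m) + k) g = X i g * v i g := by
    rw [Finset.sum_congr rfl fun k hk => by
      have hk' := Finset.mem_range.mp hk
      rw [slots, (hdiv k (by omega)).1, (hdiv k (by omega)).2, if_pos hk'],
      Finset.sum_sub_distrib, sum_level h.pos.le (h.cum_nonneg hi hg),
      sum_level h.pos.le (h.cum_nonneg hi hg.le), min_eq_left (h.cum_le hi hg),
      min_eq_left (h.cum_le hi hg.le), cum_succ]
    ring
  have h2 : ∑ k ∈ Finset.range m, slots m N X v (i * (2 * m) + (m + k)) g =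
      X i g * (1 - v i g) := by
    rw [Finset.sum_eq_single g]
    · rw [slots, (hdiv _ (by omega)).1, (hdiv _ (by omega)).2, if_neg (by omega), if_pos rfl]
    · intro k hk hkg
      have hk' := Finset.mem_range.mp hk
      rw [slots, (hdiv _ (by omega)).2, if_neg (by omega), if_neg (by omega)]
    · intro h'; exact absurd (Finset.mem_range.mpr hg) h'
  rw [h1, h2]
  ring

end IsDivision

theorem IsDivision.sum_slots_col {n m : ℕ} {N : α} {X : ℕ → ℕ → α} {v : ℕ → ℕ → ℕ}
    (h : IsDivision n m N X v) {g : ℕ} (hg : g < m) :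
    ∑ r ∈ Finset.range (n * (2 * m)), slots m N X v r g = ∑ i ∈ Finset.range n, X i g := by
  rw [sum_range_mul_eq]
  exact Finset.sum_congr rfl fun i hi => h.sum_slots_agent (Finset.mem_range.mp hi) hg

/-! ### Padding to a square matrix with constant sums -/

/-- A nonnegative matrix of order `K` with all row and column sums equal to `N`. -/
structure HasSums (K : ℕ) (N : α) (Z : ℕ → ℕ → α) : Prop where
  nonneg : ∀ r < K, ∀ c < K, 0 ≤ Z r c
  row : ∀ r < K, ∑ c ∈ Finset.range K, Z r c = N
  col : ∀ c < K, ∑ r ∈ Finset.range K, Z r c = N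

/-- The square matrix of order `R + m` with the blocks `Y` and its transpose on the diagonal, and
diagonal blocks that complete the row and column sums to `N`. -/
def pad (R m : ℕ) (N : α) (Y : ℕ → ℕ → α) (r c : ℕ) : α :=
  if r < R then
    if c < m then Y r c
    else if c - m = r then N - ∑ g ∈ Finset.range m, Y r g else 0
  else
    if c < m then if r - R = c then N - ∑ q ∈ Finset.range R, Y q c else 0
    else Y (c - m) (r - R)

/-- The lower right block is the transpose of `Y`, so row `R + g` consists of the completion of
column `g` and of that column itself, and dually for column `m + r`. Nonnegativity of the
completions is what the bounds on the sums of `Y` are for. -/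
theorem hasSums_pad {R m : ℕ} {N : α} {Y : ℕ → ℕ → α} (h0 : ∀ r < R, ∀ g < m, 0 ≤ Y r g)
    (hrow : ∀ r < R, ∑ g ∈ Finset.range m, Y r g ≤ N)
    (hcol : ∀ g < m, ∑ r ∈ Finset.range R, Y r g ≤ N) : HasSums (R + m) N (pad R m N Y) := by
  refine ⟨fun r hr c hc => ?_, fun r hr => ?_, fun c hc => ?_⟩
  · unfold pad
    split_ifs with h1 h2 h3 h4 h5
    · exact h0 r h1 c h2
    · exact sub_nonneg.mpr (hrow r h1)
    · exact le_rfl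
    · exact sub_nonneg.mpr (hcol c h4)
    · exact le_rfl
    · exact h0 _ (by omega) _ (by omega)
  · rw [add_comm, Finset.sum_range_add]
    by_cases h : r < R
    · have e1 : ∑ c ∈ Finset.range m, pad R m N Y r c = ∑ g ∈ Finset.range m, Y r g :=
        Finset.sum_congr rfl fun c hc => by
          rw [pad, if_pos h, if_pos (Finset.mem_range.mp hc)]
      have e2 : ∑ c ∈ Finset.range R, pad R m N Y r (m + c) =
          N - ∑ g ∈ Finset.range m, Y r g := by
        rw [Finset.sum_eq_single r]
        · simp [pad, h]
        · intro c _ hc; simp [pad, h, hc]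
        · intro h'; exact absurd (Finset.mem_range.mpr h) h'
      rw [e1, e2]; ring
    · have e1 : ∑ c ∈ Finset.range m, pad R m N Y r c =
          N - ∑ q ∈ Finset.range R, Y q (r - R) := by
        have hm : r - R < m := by omega
        rw [Finset.sum_eq_single (r - R)]
        · simp [pad, h, hm]
        · intro c hc hne
          rw [pad, if_neg h, if_pos (Finset.mem_range.mp hc), if_neg (Ne.symm hne)]
        · intro h'; exact absurd (Finset.mem_range.mpr hm) h'
      have e2 : ∑ c ∈ Finset.range R, pad R m N Y r (m + c) =
          ∑ q ∈ Finset.range R, Y q (r - R) :=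
        Finset.sum_congr rfl fun c hc => by simp [pad, h]
      rw [e1, e2]; ring
  · rw [Finset.sum_range_add]
    by_cases h : c < m
    · have e1 : ∑ r ∈ Finset.range R, pad R m N Y r c = ∑ r ∈ Finset.range R, Y r c :=
        Finset.sum_congr rfl fun r hr => by
          rw [pad, if_pos (Finset.mem_range.mp hr), if_pos h]
      have e2 : ∑ r ∈ Finset.range m, pad R m N Y (R + r) c =
          N - ∑ r ∈ Finset.range R, Y r c := by
        rw [Finset.sum_eq_single c]
        · simp [pad, h]
        · intro r _ hr; simp [pad, h, hr]
        · intro h'; exact absurd (Finset.mem_range.mpr h) h'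
      rw [e1, e2]; ring
    · have hm : c - m < R := by omega
      have e1 : ∑ r ∈ Finset.range R, pad R m N Y r c =
          N - ∑ g ∈ Finset.range m, Y (c - m) g := by
        rw [Finset.sum_eq_single (c - m)]
        · simp [pad, h, hm]
        · intro r hr hne
          rw [pad, if_pos (Finset.mem_range.mp hr), if_neg h, if_neg (Ne.symm hne)]
        · intro h'; exact absurd (Finset.mem_range.mpr hm) h'
      have e2 : ∑ r ∈ Finset.range m, pad R m N Y (R + r) c =
          ∑ g ∈ Finset.range m, Y (c - m) g :=
        Finset.sum_congr rfl fun r hr => by simp [pad, h]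
      rw [e1, e2]; ring

/-- The padded slot matrix. -/
def slotMatrix (n m : ℕ) (N : α) (X : ℕ → ℕ → α) (v : ℕ → ℕ → ℕ) : ℕ → ℕ → α :=
  pad (n * (2 * m)) m N (slots m N X v)

theorem IsDivision.hasSums {n m : ℕ} {N : α} {X : ℕ → ℕ → α} {v : ℕ → ℕ → ℕ}
    (h : IsDivision n m N X v) : HasSums (n * (2 * m) + m) N (slotMatrix n m N X v) :=
  hasSums_pad (fun _ hr _ hg => h.slots_nonneg hr hg) (fun _ hr => h.sum_slots_row_le hr)
    fun g hg => (h.sum_slots_col hg).trans_le (h.sum_le g hg)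

/-! ### Matchings in the support of the padded matrix -/

/-- Good `g` goes to the agent that owns the slot `σ g`, if there is one. -/
def slotAllocation (n m : ℕ) (σ : ℕ → ℕ) : Allocation n m := fun g =>
  if h : σ g < n * (2 * m) then
    some ⟨σ g / (2 * m), Nat.div_lt_of_lt_mul (by rwa [mul_comm] at h)⟩
  else none

theorem slotAllocation_eq_some {n m : ℕ} {σ : ℕ → ℕ} {g : Fin m} {i : Fin n} :
    slotAllocation n m σ g = some i ↔ σ g < n * (2 * m) ∧ σ g / (2 * m) = i := by
  unfold slotAllocation
  split_ifs with h
  · simp [h, Fin.ext_iff]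
  · simp [h]

theorem slotAllocation_eq_some' {n m : ℕ} {σ : ℕ → ℕ} {g : Fin m} {i : Fin n} :
    slotAllocation n m σ g = some i ↔
      i * (2 * m) ≤ σ g ∧ σ g < i * (2 * m) + 2 * m := by
  rw [slotAllocation_eq_some]
  have hm : 0 < 2 * m := by have := g.pos; omega
  constructor
  · rintro ⟨-, h⟩
    have h1 := Nat.div_add_mod (σ g) (2 * m)
    have h2 := Nat.mod_lt (σ g) hm
    rw [h, mul_comm] at h1
    omega
  · rintro ⟨h1, h2⟩
    have : ((i : ℕ) + 1) * (2 * m) ≤ n * (2 * m) := Nat.mul_le_mul_right _ i.2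
    rw [Nat.add_mul, one_mul] at this
    refine ⟨by omega, ?_⟩
    exact Nat.div_eq_of_lt_le h1 (by rw [Nat.succ_mul]; exact h2)

theorem IsMatching.slots_pos {β : Type*} [CommRing β] [LinearOrder β] {n m : ℕ} {N : β}
    {X : ℕ → ℕ → β} {v : ℕ → ℕ → ℕ} {σ : ℕ → ℕ}
    (hσ : IsMatching (n * (2 * m) + m) (slotMatrix n m N X v) σ) {g : ℕ} (hg : g < m)
    (hr : σ g < n * (2 * m)) :
    0 < slots m N X v (σ g) g := by
  have := hσ.pos g (by omega)
  rwa [slotMatrix, pad, if_pos hr, if_pos hg] at this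

namespace IsDivision

variable {n m : ℕ} {N : α} {X : ℕ → ℕ → α} {v : ℕ → ℕ → ℕ} {σ : ℕ → ℕ}

theorem slotAllocation_pos (h : IsDivision n m N X v)
    (hσ : IsMatching (n * (2 * m) + m) (slotMatrix n m N X v) σ) {g : Fin m} {i : Fin n}
    (hi : slotAllocation n m σ g = some i) :
    0 < X i g := by
  obtain ⟨hr, hd⟩ := slotAllocation_eq_some.mp hi
  rw [slotAllocation_eq_some'] at hi
  rw [← h.sum_slots_agent i.2 g.2]
  have hlt : (i + 1 : ℕ) * (2 * m) ≤ n * (2 * m) := Nat.mul_le_mul_right _ i.2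
  rw [Nat.add_mul, one_mul] at hlt
  refine Finset.sum_pos' (fun k hk => h.slots_nonneg ?_ g.2)
    ⟨σ g - i * (2 * m), Finset.mem_range.mpr (by omega), ?_⟩
  · have := Finset.mem_range.mp hk; omega
  · rw [Nat.add_sub_cancel' hi.1]
    exact hσ.slots_pos g.2 hr

/-- The padding entry in the column of a fully allocated good is zero, so the matching has to use a
slot there. -/
theorem exists_slotAllocation_eq_some (h : IsDivision n m N X v)
    (hσ : IsMatching (n * (2 * m) + m) (slotMatrix n m N X v) σ) {g : Fin m}
    (hg : ∑ i ∈ Finset.range n, X i g = N) :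
    ∃ i, slotAllocation n m σ g = some i := by
  by_cases hr : σ g < n * (2 * m)
  · exact ⟨_, by rw [slotAllocation, dif_pos hr]⟩
  · have := hσ.pos g (by have := g.2; omega)
    rw [slotMatrix, pad, if_neg hr, if_pos g.2, h.sum_slots_col g.2, hg] at this
    simp at this

/-- The first `q` slots of `i` are full, so their padding entries vanish and they are matched to
goods, necessarily different ones; a positive entry in a value slot means that the good is valued.
-/
theorem le_card_of_mul_le (h : IsDivision n m N X v)
    (hσ : IsMatching (n * (2 * m) + m) (slotMatrix n m N X v) σ) {i : ℕ} (hi : i < n) {q : ℕ}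
    (hq : q * N ≤ cum X v i m) :
    q ≤ ((Finset.range m).filter fun g =>
      (σ g < n * (2 * m) ∧ σ g / (2 * m) = i) ∧ v i g = 1).card := by
  have hqm : q ≤ m := by
    by_contra! hlt
    have h1 : ((m : α) + 1) * N ≤ q * N :=
      mul_le_mul_of_nonneg_right (by exact_mod_cast hlt) h.pos.le
    have h2 := h.cum_le hi le_rfl
    have := h.pos
    nlinarith
  have hlt : (i + 1 : ℕ) * (2 * m) ≤ n * (2 * m) := Nat.mul_le_mul_right _ hi
  rw [Nat.add_mul, one_mul] at hlt
  have hex : ∀ k < q, ∃ g < m, σ g = i * (2 * m) + k := by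
    intro k hk
    obtain ⟨c, hc, e⟩ := hσ.surj (show i * (2 * m) + k < n * (2 * m) + m by omega)
    refine ⟨c, ?_, e⟩
    by_contra hcm
    have hp := hσ.pos c hc
    have hdiv : (i * (2 * m) + k) / (2 * m) = i ∧ (i * (2 * m) + k) % (2 * m) = k :=
      ⟨by rw [mul_comm, Nat.mul_add_div (by omega), Nat.div_eq_of_lt (by omega), add_zero],
        by rw [mul_comm, Nat.mul_add_mod, Nat.mod_eq_of_lt (by omega)]⟩
    rw [e, slotMatrix, pad, if_pos (by omega), if_neg hcm,
      h.sum_slots_row _ (by rw [hdiv.2]; omega), hdiv.1, hdiv.2,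
      level_eq_of_le h.pos.le ((mul_le_mul_of_nonneg_right (by exact_mod_cast hk) h.pos.le).trans
        hq)] at hp
    simp at hp
  choose! f hf using hex
  conv_lhs => rw [← Finset.card_range q]
  refine Finset.card_le_card_of_injOn f (fun k hk => ?_) fun k hk k' hk' e => ?_
  · have hk' := Finset.mem_range.mp hk
    obtain ⟨h1, h2⟩ := hf k hk'
    have hr : σ (f k) < n * (2 * m) := by omega
    have hdiv : σ (f k) / (2 * m) = i ∧ σ (f k) % (2 * m) = k := by
      rw [h2]
      exact ⟨by rw [mul_comm, Nat.mul_add_div (by omega), Nat.div_eq_of_lt (by omega), add_zero],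
        by rw [mul_comm, Nat.mul_add_mod, Nat.mod_eq_of_lt (by omega)]⟩
    refine Finset.mem_filter.mpr ⟨Finset.mem_range.mpr h1, ⟨hr, hdiv.1⟩, ?_⟩
    have hp := hσ.slots_pos h1 hr
    rw [slots, hdiv.1, hdiv.2, if_pos (by omega), cum_succ] at hp
    refine (h.binary i (f k)).resolve_left fun h0 => ?_
    simp [h0] at hp
  · have h1 := (hf k (Finset.mem_range.mp hk)).2
    have h2 := (hf k' (Finset.mem_range.mp hk')).2
    rw [e] at h1
    omega

/-- A good that `i` values can only be matched to one of her value slots `k`, and a positive entry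
there needs `k * N < cum X v i m`, hence `k < q`. Different goods use different slots. -/
theorem card_le_of_le_mul (h : IsDivision n m N X v)
    (hσ : IsMatching (n * (2 * m) + m) (slotMatrix n m N X v) σ) {i : ℕ} (hi : i < n) {q : ℕ}
    (hq : cum X v i m ≤ q * N) :
    ((Finset.range m).filter fun g =>
      (σ g < n * (2 * m) ∧ σ g / (2 * m) = i) ∧ v i g = 1).card ≤ q := by
  rw [← Finset.card_range q]
  refine Finset.card_le_card_of_injOn (fun g => σ g % (2 * m)) (fun g hg => ?_)
    fun g hg g' hg' e => ?_
  · obtain ⟨hgm, ⟨hr, hd⟩, hv⟩ := Finset.mem_filter.mp hg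
    have hgm := Finset.mem_range.mp hgm
    have hp := hσ.slots_pos hgm hr
    rw [slots, hd] at hp
    refine Finset.mem_coe.mpr (Finset.mem_range.mpr ?_)
    split_ifs at hp with h1 h2
    · have hp' : 0 < level N (σ g % (2 * m)) (cum X v i (g + 1)) := by
        linarith [level_nonneg N (σ g % (2 * m)) (cum X v i g)]
      have h3 := (lt_of_level_pos hp').trans_le ((h.cum_mono hi hgm le_rfl).trans hq)
      exact_mod_cast lt_of_mul_lt_mul_right h3 h.pos.le
    · simp [hv] at hp
    · simp at hp
  · obtain ⟨hgm, ⟨_, hd⟩, _⟩ := Finset.mem_filter.mp hg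
    obtain ⟨hgm', ⟨_, hd'⟩, _⟩ := Finset.mem_filter.mp hg'
    have e' : σ g = σ g' := by
      rw [← Nat.div_add_mod (σ g) (2 * m), ← Nat.div_add_mod (σ g') (2 * m), hd, hd']
      simp only at e
      rw [e]
    have := Finset.mem_range.mp hgm
    have := Finset.mem_range.mp hgm'
    exact hσ.inj g (by omega) g' (by omega) e'

/-- The utility counts the valued goods matched to slots of `i`. If it were off by a whole unit, one
of the two counting bounds would fail, with `q` one below or one above the utility. -/
theorem utility_bounds (h : IsDivision n m N X v)
    (hσ : IsMatching (n * (2 * m) + m) (slotMatrix n m N X v) σ) {w : Fin n → Fin m → ℕ}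
    (hw : ∀ (i : Fin n) (g : Fin m), v i g = w i g)
    (i : Fin n) : (utility w (slotAllocation n m σ) i : α) * N < cum X v i m + N ∧
      cum X v i m < (utility w (slotAllocation n m σ) i : α) * N + N := by
  have hu : utility w (slotAllocation n m σ) i = ((Finset.range m).filter fun g =>
      (σ g < n * (2 * m) ∧ σ g / (2 * m) = i) ∧ v i g = 1).card := by
    rw [utility_eq_sum, Finset.card_filter, Finset.sum_range]
    refine Finset.sum_congr rfl fun g _ => ?_
    simp only [slotAllocation_eq_some]
    by_cases hc : σ g < n * (2 * m) ∧ σ g / (2 * m) = i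
    · rcases h.binary i g with hv | hv
      · simp [hc, hv, ← hw]
      · simp [hc, hv, ← hw]
    · simp [hc]
  rw [hu]
  set d := ((Finset.range m).filter fun g =>
      (σ g < n * (2 * m) ∧ σ g / (2 * m) = i) ∧ v i g = 1).card with hd
  have hN := h.pos
  constructor
  · by_contra! hlt
    rcases Nat.eq_zero_or_pos d with h0 | h0
    · rw [h0] at hlt
      have := h.cum_nonneg i.2 le_rfl
      simp at hlt
      linarith
    · obtain ⟨e, he⟩ := Nat.exists_eq_succ_of_ne_zero h0.ne'
      have := h.card_le_of_le_mul hσ i.2 (q := e) (by rw [he] at hlt; push_cast at hlt; linarith)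
      omega
  · by_contra! hlt
    have := h.le_card_of_mul_le hσ i.2 (q := d + 1) (by push_cast; linarith)
    omega

end IsDivision

end Slots

/-! ### From decompositions of the padded matrix to lotteries -/

/-- Different indices may give the same allocation, so the weights are collected for each
allocation. -/
theorem isMNWLottery_of_family {n m : ℕ} {v : Fin n → Fin m → ℕ} {A : Fin n → Fin m → ℝ}
    {ι : Type*} [Fintype ι] {w : ι → ℝ} {D : ι → Allocation n m} (hw : ∀ j, 0 ≤ w j)
    (hsum : ∑ j, w j = 1) (hD : ∀ j, w j ≠ 0 → IsMNW v (D j))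
    (hA : ∀ i g, (∑ j, if D j g = some i then w j else 0) = A i g) :
    IsMNWLottery v A fun E => ∑ j, if D j = E then w j else 0 := by
  refine ⟨⟨fun E => Finset.sum_nonneg fun j _ => ?_, ?_⟩, fun i g => ?_, fun E hE => ?_⟩
  · split_ifs
    · exact hw j
    · exact le_rfl
  · rw [Finset.sum_comm, ← hsum]
    simp
  · rw [Finset.sum_comm, ← hA]
    refine Finset.sum_congr rfl fun j _ => ?_
    rw [Finset.sum_ite_eq]
    simp [bundle]
  · obtain ⟨j, -, hj⟩ := Finset.exists_ne_zero_of_sum_ne_zero hE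
    split_ifs at hj with h
    · exact h ▸ hD j hj
    · exact absurd rfl hj

section Lottery

variable {α : Type*} [CommRing α] [LinearOrder α] [IsStrictOrderedRing α] {n m : ℕ}
  {v : Fin n → Fin m → ℕ} {A : Fin n → Fin m → ℝ} {N : α} {X : ℕ → ℕ → α} {v' : ℕ → ℕ → ℕ}

/-- The embedding `f` lets one argument serve both the real matrix with `N = 1` and the integer
matrix obtained by scaling. -/
theorem IsDivision.isRounding (h : IsDivision n m N X v') (f : α →+* ℝ) (hf : StrictMono f)
    (hX : ∀ (i : Fin n) (g : Fin m), f (X i g) = A i g * f N)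
    (hv' : ∀ (i : Fin n) (g : Fin m), v' i g = v i g) {σ : ℕ → ℕ}
    (hσ : IsMatching (n * (2 * m) + m) (slotMatrix n m N X v') σ) :
    IsRounding v A (slotAllocation n m σ) := by
  have hN : 0 < f N := by simpa using hf h.pos
  have hU : ∀ i : Fin n, f (cum X v' i m) = fracUtility v A i * f N := by
    intro i
    rw [cum, map_sum, Finset.sum_range, fracUtility, Finset.sum_mul]
    refine Finset.sum_congr rfl fun g _ => ?_
    rw [map_mul, hX, hv', map_natCast]
    ring
  refine ⟨fun i g hi => ?_, fun g hg => ?_, fun i => ?_, fun i => ?_⟩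
  · have := hf (h.slotAllocation_pos hσ hi)
    rw [map_zero, hX] at this
    exact pos_of_mul_pos_left this hN.le
  · refine h.exists_slotAllocation_eq_some hσ (hf.injective ?_)
    rw [map_sum, Finset.sum_range]
    simp only [hX]
    rw [← Finset.sum_mul, hg, one_mul]
  · have := hf (h.utility_bounds hσ hv' i).1
    rw [map_mul, map_add, hU, map_natCast] at this
    refine lt_of_mul_lt_mul_right (a := f N) ?_ hN.le
    linarith
  · have := hf (h.utility_bounds hσ hv' i).2
    rw [map_add, map_mul, hU, map_natCast] at this
    refine lt_of_mul_lt_mul_right (a := f N) ?_ hN.le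
    linarith

/-- A decomposition of the padded matrix implements `A`. -/
theorem IsDivision.sum_slotAllocation (h : IsDivision n m N X v') {ι : Type*} [Fintype ι]
    (w : ι → α) (σ : ι → ℕ → ℕ)
    (hdec : ∀ r < n * (2 * m) + m, ∀ c < n * (2 * m) + m,
      (∑ j, if σ j c = r then w j else 0) = slotMatrix n m N X v' r c) (i : Fin n) (g : Fin m) :
    (∑ j, if slotAllocation n m (σ j) g = some i then w j else 0) = X i g := by
  have hlt : (i + 1 : ℕ) * (2 * m) ≤ n * (2 * m) := Nat.mul_le_mul_right _ i.2
  rw [Nat.add_mul, one_mul] at hlt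
  rw [← h.sum_slots_agent i.2 g.2]
  have e : ∀ k ∈ Finset.range (2 * m), slots m N X v' (i * (2 * m) + k) g =
      ∑ j, if σ j g = i * (2 * m) + k then w j else 0 := by
    intro k hk
    have hk' := Finset.mem_range.mp hk
    have hg := g.2
    rw [hdec _ (by omega) _ (by omega), slotMatrix, pad, if_pos (by omega), if_pos hg]
  rw [Finset.sum_congr rfl e, Finset.sum_comm]
  refine Finset.sum_congr rfl fun j _ => ?_
  simp only [slotAllocation_eq_some']
  split_ifs with hc
  · rw [Finset.sum_eq_single (σ j g - i * (2 * m)), if_pos (by omega)]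
    · intro k _ hk; rw [if_neg (by omega)]
    · intro h'; exact absurd (Finset.mem_range.mpr (by omega)) h'
  · refine (Finset.sum_eq_zero fun k hk => ?_).symm
    have hk' := Finset.mem_range.mp hk
    rw [if_neg (by omega)]

end Lottery

/-! ### Existence of the lottery for real allocations -/

/-- Extension of a finite matrix by zero. -/
def extend {α : Type*} [Zero α] {n m : ℕ} (f : Fin n → Fin m → α) (i j : ℕ) : α :=
  if h : i < n ∧ j < m then f ⟨i, h.1⟩ ⟨j, h.2⟩ else 0

theorem extend_apply {α : Type*} [Zero α] {n m : ℕ} (f : Fin n → Fin m → α) (i : Fin n)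
    (j : Fin m) : extend f i j = f i j := by
  simp [extend]

theorem IsBinary.extend {n m : ℕ} {v : Fin n → Fin m → ℕ} (hv : IsBinary v) (i g : ℕ) :
    extend v i g = 0 ∨ extend v i g = 1 := by
  unfold MNW.extend
  split_ifs
  · exact hv _ _
  · exact Or.inl rfl

/-- With `N = 1` the padded matrix is doubly stochastic, and Birkhoff's theorem decomposes it. A
permutation of nonzero weight lies in the support, since the other weights are nonnegative. -/
theorem exists_isMNWLottery {n m : ℕ} {v : Fin n → Fin m → ℕ} {A : Fin n → Fin m → ℝ}
    (hv : IsBinary v) (hA : IsFractionalMNW v A) : ∃ p, IsMNWLottery v A p := by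
  have h : IsDivision n m (1 : ℝ) (extend A) (extend v) := by
    refine ⟨one_pos, fun i hi g hg => ?_, fun g hg => ?_, hv.extend⟩
    · rw [extend, dif_pos ⟨hi, hg⟩]; exact (hA.1.1 _ _).1
    · rw [Finset.sum_range]
      refine le_of_eq_of_le (Finset.sum_congr rfl fun i _ => ?_) (hA.1.2 ⟨g, hg⟩)
      exact extend_apply A i ⟨g, hg⟩
  set K := n * (2 * m) + m with hK
  set Z := slotMatrix n m (1 : ℝ) (extend A) (extend v) with hZ
  have hs := h.hasSums
  let M : Matrix (Fin K) (Fin K) ℝ := Matrix.of fun r c => Z r c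
  have hM : M ∈ doublyStochastic ℝ (Fin K) := by
    rw [mem_doublyStochastic_iff_sum]
    refine ⟨fun r c => hs.nonneg r r.2 c c.2, fun r => ?_, fun c => ?_⟩
    · rw [← hs.row r r.2, Finset.sum_range]; rfl
    · rw [← hs.col c c.2, Finset.sum_range]; rfl
  obtain ⟨w, hw0, hw1, hwM⟩ := exists_eq_sum_perm_of_mem_doublyStochastic hM
  -- A permutation matrix has its ones at `(r, π r)`, whereas matchings go from columns to rows;
  -- hence the inverse.
  let s : Equiv.Perm (Fin K) → ℕ → ℕ := fun π c =>
    if hc : c < K then (π.symm ⟨c, hc⟩ : ℕ) else 0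
  have hsc : ∀ π c (hc : c < K), s π c = π.symm ⟨c, hc⟩ := fun π c hc => dif_pos hc
  have hdec : ∀ r < K, ∀ c < K, (∑ π, if s π c = r then w π else 0) = Z r c := by
    intro r hr c hc
    have := congrFun (congrFun hwM ⟨r, hr⟩) ⟨c, hc⟩
    rw [Matrix.sum_apply] at this
    refine Eq.trans (Finset.sum_congr rfl fun π _ => ?_) this
    have e : s π c = r ↔ π ⟨r, hr⟩ = ⟨c, hc⟩ := by
      rw [hsc π c hc, ← Equiv.eq_symm_apply, Fin.ext_iff, eq_comm]
    simp [Matrix.smul_apply, Equiv.Perm.permMatrix, PEquiv.toMatrix_apply, e]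
  refine ⟨_, isMNWLottery_of_family (D := fun π => slotAllocation n m (s π)) hw0 hw1
    (fun π hπ => ?_) fun i g => ?_⟩
  · refine (h.isRounding (A := A) (RingHom.id ℝ) strictMono_id (fun i g => ?_)
      (extend_apply v) (σ := s π) ⟨fun c hc => ?_, fun c hc c' hc' e => ?_, fun c hc => ?_⟩).isMNW
        hv hA
    · simp [extend_apply]
    · rw [hsc π c hc]; exact Fin.is_lt _
    · rw [hsc π c hc, hsc π c' hc'] at e
      simpa using π.symm.injective (Fin.ext e)
    · have hr : s π c < K := by rw [hsc π c hc]; exact Fin.is_lt _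
      rw [← hZ, ← hdec _ hr c hc]
      refine Finset.sum_pos' (fun ρ _ => ?_) ⟨π, Finset.mem_univ _, ?_⟩
      · split_ifs
        · exact hw0 ρ
        · exact le_rfl
      · rw [if_pos rfl]
        exact lt_of_le_of_ne (hw0 π) (Ne.symm hπ)
  · rw [h.sum_slotAllocation w s hdec, extend_apply]

/-! ### The auction algorithm for perfect matchings -/

/-- The invariant of the auction.  `own c` is `q + 1` if row `q` holds column `c`, and `0` if nobody
does; `cur` is, in the same code, the row that is about to bid; the rows below `done` take part. -/
structure AuctionInv (K : ℕ) (Z : ℕ → ℕ → ℤ) (own price : ℕ → ℕ) (cur done : ℕ) : Prop where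
  zero : ∀ c < K, own c = 0 → price c = 0
  le : ∀ c < K, own c ≤ done
  pos : ∀ c < K, ∀ q, own c = q + 1 → 0 < Z q c
  slack : ∀ c < K, ∀ q, own c = q + 1 → ∀ c' < K, 0 < Z q c' → price c ≤ price c' + 1
  inj : ∀ c < K, ∀ c' < K, own c = own c' → own c ≠ 0 → c = c'
  cur_le : cur ≤ done
  cur_free : ∀ c < K, own c = cur → cur = 0
  cover : ∀ q < done, q + 1 = cur ∨ ∃ c < K, own c = q + 1
  price_le : ∀ c < K, price c ≤ K

variable {K : ℕ} {Z : ℕ → ℕ → ℤ} {own price : ℕ → ℕ} {cur done : ℕ}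

theorem AuctionInv.of_eq_zero (hown : ∀ c < K, own c = 0) (hprice : ∀ c < K, price c = 0) :
    AuctionInv K Z own price 0 0 where
  zero c hc _ := hprice c hc
  le c hc := (hown c hc).le
  pos c hc q h := by rw [hown c hc] at h; omega
  slack c hc q h := by rw [hown c hc] at h; omega
  inj c hc c' _ _ h := absurd (hown c hc) h
  cur_le := le_rfl
  cur_free _ _ _ := rfl
  cover q hq := absurd hq (Nat.not_lt_zero q)
  price_le c hc := by rw [hprice c hc]; exact Nat.zero_le _

theorem AuctionInv.start (h : AuctionInv K Z own price 0 done) :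
    AuctionInv K Z own price (done + 1) (done + 1) where
  zero := h.zero
  le c hc := (h.le c hc).trans (Nat.le_succ _)
  pos := h.pos
  slack := h.slack
  inj := h.inj
  cur_le := le_rfl
  cur_free c hc e := by have := h.le c hc; omega
  cover q hq := by
    rcases Nat.lt_succ_iff_lt_or_eq.mp hq with hlt | rfl
    · rcases h.cover q hlt with h1 | h1
      · omega
      · exact Or.inr h1
    · exact Or.inl rfl
  price_le := h.price_le

/-- A Hall type argument at a gap in the prices. Otherwise all columns in the support of the bidder
`q` cost at least `K`. At a level `j` that no price attains, the owners of the columns above `j`,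
together with `q`, have their whole support in these columns: one row too many for constant row and
column sums. -/
theorem AuctionInv.exists_price_lt {N : ℤ} (h : AuctionInv K Z own price cur done)
    (hs : HasSums K N Z) (hN : 0 < N) (hd : done ≤ K) {q : ℕ} (hq : cur = q + 1) :
    ∃ c < K, 0 < Z q c ∧ price c < K := by
  classical
  by_contra! hno
  have hqK : q < K := by have := h.cur_le; omega
  have hbound : ∀ c < K, own c ≠ 0 → own c - 1 ∈ (Finset.range K).erase q := by
    intro c hc h0
    have h1 := h.le c hc
    have h2 : own c ≠ q + 1 := fun e => by have := h.cur_free c hc (by omega); omega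
    exact Finset.mem_erase.mpr ⟨by omega, Finset.mem_range.mpr (by omega)⟩
  have hinj : ∀ c < K, own c ≠ 0 → ∀ c' < K, own c' ≠ 0 → own c - 1 = own c' - 1 → c = c' :=
    fun c hc h0 c' hc' h0' e => h.inj c hc c' hc' (by omega) h0
  -- Columns without owner cost `0`, and at most `K - 1` columns have an owner since `q` holds none;
  -- so some price among `1, …, K` does not occur.
  obtain ⟨j, hj1, hj2⟩ : ∃ j, (1 ≤ j ∧ j ≤ K) ∧ ∀ c < K, price c ≠ j := by
    by_contra! hall
    have hsub : Finset.Icc 1 K ⊆ ((Finset.range K).filter fun c => own c ≠ 0).image price := by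
      intro j hj
      have hj' := Finset.mem_Icc.mp hj
      obtain ⟨c, hc, e⟩ := hall j hj'
      refine Finset.mem_image.mpr ⟨c, Finset.mem_filter.mpr ⟨Finset.mem_range.mpr hc, ?_⟩, e⟩
      intro h0
      have := h.zero c hc h0
      omega
    have h1 := (Finset.card_le_card hsub).trans Finset.card_image_le
    have h2 : ((Finset.range K).filter fun c => own c ≠ 0).card ≤
        ((Finset.range K).erase q).card := by
      refine Finset.card_le_card_of_injOn (fun c => own c - 1) (fun c hc => ?_)
        fun c hc c' hc' e => ?_
      · have := Finset.mem_filter.mp hc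
        exact hbound c (Finset.mem_range.mp this.1) this.2
      · have h3 := Finset.mem_filter.mp hc
        have h4 := Finset.mem_filter.mp hc'
        exact hinj c (Finset.mem_range.mp h3.1) h3.2 c' (Finset.mem_range.mp h4.1) h4.2 e
    rw [Finset.card_erase_of_mem (Finset.mem_range.mpr hqK), Finset.card_range] at h2
    rw [Nat.card_Icc] at h1
    omega
  set C := (Finset.range K).filter fun c => j ≤ price c with hC
  have hCown : ∀ c ∈ C, c < K ∧ own c ≠ 0 ∧ j < price c := by
    intro c hc
    obtain ⟨h1, h2⟩ := Finset.mem_filter.mp hc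
    have h1 := Finset.mem_range.mp h1
    have h3 := hj2 c h1
    exact ⟨h1, fun h0 => by have := h.zero c h1 h0; omega, by omega⟩
  set S := insert q (C.image fun c => own c - 1) with hS
  have hqS : q ∉ C.image fun c => own c - 1 := by
    intro hmem
    obtain ⟨c, hc, e⟩ := Finset.mem_image.mp hmem
    obtain ⟨h1, h2, -⟩ := hCown c hc
    exact (Finset.mem_erase.mp (hbound c h1 h2)).1 e
  have hcard : S.card = C.card + 1 := by
    rw [hS, Finset.card_insert_of_notMem hqS, Finset.card_image_of_injOn]
    intro c hc c' hc' e
    obtain ⟨h1, h2, -⟩ := hCown c hc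
    obtain ⟨h3, h4, -⟩ := hCown c' hc'
    exact hinj c h1 h2 c' h3 h4 e
  have hSK : S ⊆ Finset.range K := by
    intro r hr
    rcases Finset.mem_insert.mp hr with rfl | hr
    · exact Finset.mem_range.mpr hqK
    · obtain ⟨c, hc, rfl⟩ := Finset.mem_image.mp hr
      obtain ⟨h1, h2, -⟩ := hCown c hc
      exact Finset.mem_of_mem_erase (hbound c h1 h2)
  have hsupp : ∀ r ∈ S, ∀ c < K, 0 < Z r c → c ∈ C := by
    intro r hr c hc hz
    refine Finset.mem_filter.mpr ⟨Finset.mem_range.mpr hc, ?_⟩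
    rcases Finset.mem_insert.mp hr with rfl | hr
    · exact hj1.2.trans (hno c hc hz)
    · obtain ⟨c', hc', rfl⟩ := Finset.mem_image.mp hr
      obtain ⟨h1, h2, h3⟩ := hCown c' hc'
      -- The column `c'` costs more than `j`, so by slack every column in the support of its owner
      -- costs at least `j`.
      have := h.slack c' h1 (own c' - 1) (by omega) c hc hz
      omega
  have hrow : ∀ r ∈ S, ∑ c ∈ C, Z r c = N := by
    intro r hr
    rw [← hs.row r (Finset.mem_range.mp (hSK hr))]
    refine Finset.sum_subset (Finset.filter_subset _ _) fun c hc hcC => ?_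
    have hc := Finset.mem_range.mp hc
    refine le_antisymm ?_ (hs.nonneg r (Finset.mem_range.mp (hSK hr)) c hc)
    by_contra! hlt
    exact hcC (hsupp r hr c hc hlt)
  -- Double counting: the rows in `S` put the mass `(C.card + 1) * N` into columns of total mass
  -- `C.card * N`.
  have h1 : ∑ r ∈ S, ∑ c ∈ C, Z r c = S.card * N := by
    rw [Finset.sum_congr rfl hrow, Finset.sum_const, nsmul_eq_mul]
  have h2 : ∑ r ∈ S, ∑ c ∈ C, Z r c ≤ C.card * N := by
    rw [Finset.sum_comm]
    refine le_of_le_of_eq (Finset.sum_le_sum (g := fun _ => N) fun c hc => ?_) (by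
      rw [Finset.sum_const, nsmul_eq_mul])
    obtain ⟨hcK, -⟩ := hCown c hc
    rw [← hs.col c hcK]
    exact Finset.sum_le_sum_of_subset_of_nonneg hSK fun r hr _ =>
      hs.nonneg r (Finset.mem_range.mp hr) c hcK
  rw [h1, hcard] at h2
  push_cast at h2
  linarith

/-- The bidder takes a cheapest column of its support and raises the price by one, which keeps its
slack within one; the slack of other owners survives because prices only rise. The displaced owner
bids next, and the code `0` ends the chain if there is none. -/
theorem AuctionInv.step (h : AuctionInv K Z own price cur done) {q : ℕ} (hq : cur = q + 1) {c : ℕ}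
    (hc : c < K) (hz : 0 < Z q c) (hmin : ∀ c' < K, 0 < Z q c' → price c ≤ price c')
    (hlt : price c < K) :
    AuctionInv K Z (Function.update own c cur) (Function.update price c (price c + 1)) (own c)
      done := by
  have hcases : ∀ d < K, (d = c ∧ Function.update own c cur d = cur ∧
      Function.update price c (price c + 1) d = price c + 1) ∨
      (d ≠ c ∧ Function.update own c cur d = own d ∧
      Function.update price c (price c + 1) d = price d) := by
    intro d _
    by_cases hd : d = c
    · subst hd; simp
    · simp [hd]
  have hprice : ∀ d, price d ≤ Function.update price c (price c + 1) d := by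
    intro d
    by_cases hd : d = c
    · subst hd; simp
    · simp [hd]
  refine ⟨fun d hd => ?_, fun d hd => ?_, fun d hd r => ?_, fun d hd r hr c' hc' hz' => ?_,
    fun d hd d' hd' => ?_, h.le c hc, fun d hd => ?_, fun r hr => ?_, fun d hd => ?_⟩
  · rcases hcases d hd with ⟨-, h1, h2⟩ | ⟨-, h1, h2⟩
    · rw [h1]; omega
    · rw [h1, h2]; exact h.zero d hd
  · rcases hcases d hd with ⟨-, h1, -⟩ | ⟨-, h1, -⟩
    · rw [h1]; exact h.cur_le
    · rw [h1]; exact h.le d hd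
  · rcases hcases d hd with ⟨rfl, h1, -⟩ | ⟨-, h1, -⟩
    · rw [h1]
      intro e
      obtain rfl : q = r := by omega
      exact hz
    · rw [h1]; exact h.pos d hd r
  · have hp := hprice c'
    rcases hcases d hd with ⟨rfl, h1, h2⟩ | ⟨-, h1, h2⟩
    · rw [h1] at hr
      obtain rfl : q = r := by omega
      rw [h2]
      have := hmin c' hc' hz'
      omega
    · rw [h1] at hr
      rw [h2]
      have := h.slack d hd r hr c' hc' hz'
      omega
  · rcases hcases d hd with ⟨rfl, h1, -⟩ | ⟨hne, h1, -⟩ <;>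
      rcases hcases d' hd' with ⟨rfl, h1', -⟩ | ⟨hne', h1', -⟩
    · intro _ _; rfl
    · rw [h1, h1']
      intro e h0
      exact absurd (h.cur_free d' hd' e.symm) h0
    · rw [h1, h1']
      intro e h0
      rw [e] at h0
      exact absurd (h.cur_free d hd e) h0
    · rw [h1, h1']
      exact h.inj d hd d' hd'
  · rcases hcases d hd with ⟨rfl, h1, -⟩ | ⟨hne, h1, -⟩ <;> rw [h1]
    · intro e
      have := h.cur_free d hd e.symm
      omega
    · intro e
      by_contra h0
      exact hne (h.inj d hd c hc e (by rwa [e]))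
  · rcases h.cover r hr with h1 | ⟨d, hd, h1⟩
    · exact Or.inr ⟨c, hc, by simp [h1]⟩
    · by_cases hdc : d = c
      · exact Or.inl (by rw [← hdc, h1])
      · exact Or.inr ⟨d, hd, by simp [hdc, h1]⟩
  · rcases hcases d hd with ⟨rfl, -, h2⟩ | ⟨-, -, h2⟩ <;> rw [h2]
    · exact hlt
    · exact h.price_le d hd

/-- All `K` rows hold a column, and different rows hold different ones, so every column is held. -/
theorem AuctionInv.own_ne_zero (h : AuctionInv K Z own price 0 K) {c : ℕ} (hc : c < K) :
    own c ≠ 0 := by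
  have hex : ∀ q < K, ∃ c < K, own c = q + 1 := fun q hq =>
    (h.cover q hq).resolve_left (Nat.succ_ne_zero q)
  choose! f hf using hex
  obtain ⟨q, hq, e⟩ := Finset.surj_on_of_inj_on_of_card_le (s := Finset.range K)
    (t := Finset.range K) (fun q _ => f q)
    (fun q hq => Finset.mem_range.mpr (hf q (Finset.mem_range.mp hq)).1)
    (fun q q' hq hq' e => by
      have h1 := (hf q (Finset.mem_range.mp hq)).2
      have h2 := (hf q' (Finset.mem_range.mp hq')).2
      rw [e] at h1
      omega) le_rfl c (Finset.mem_range.mpr hc)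
  rw [e, (hf q (Finset.mem_range.mp hq)).2]
  exact Nat.succ_ne_zero q

theorem AuctionInv.isMatching (h : AuctionInv K Z own price 0 K) :
    IsMatching K Z fun c => own c - 1 where
  lt c hc := by have := h.le c hc; have := h.own_ne_zero hc; omega
  inj c hc c' hc' e := by
    have h1 := h.own_ne_zero hc
    have h2 := h.own_ne_zero hc'
    exact h.inj c hc c' hc' (by omega) h1
  pos c hc := h.pos c hc _ (by have := h.own_ne_zero hc; omega)

/-- A bound for the number of remaining bids. -/
def slackSum (K : ℕ) (price : ℕ → ℕ) : ℕ := ∑ c ∈ Finset.range K, (K - price c)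

theorem slackSum_le (K : ℕ) (price : ℕ → ℕ) : slackSum K price ≤ K * K := by
  have := Finset.sum_le_card_nsmul (Finset.range K) (fun c => K - price c) K fun c _ =>
    Nat.sub_le _ _
  simpa [slackSum] using this

theorem slackSum_update_lt {c : ℕ} (hc : c < K) (hlt : price c < K) :
    slackSum K (Function.update price c (price c + 1)) < slackSum K price := by
  refine Finset.sum_lt_sum (fun d _ => ?_) ⟨c, Finset.mem_range.mpr hc, ?_⟩
  · by_cases hd : d = c
    · subst hd; simp only [Function.update_self]; omega
    · simp [hd]
  · simp only [Function.update_self]; omega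

/-! ### Subtracting a matching -/

/-- `Z` minus `w` times the permutation matrix of `σ`. -/
def subMatching (Z : ℕ → ℕ → ℤ) (σ : ℕ → ℕ) (w : ℤ) (r c : ℕ) : ℤ :=
  Z r c - if σ c = r then w else 0

theorem HasSums.subMatching {N w : ℤ} {σ : ℕ → ℕ} (hs : HasSums K N Z) (hσ : IsMatching K Z σ)
    (hw : ∀ c < K, w ≤ Z (σ c) c) : HasSums K (N - w) (subMatching Z σ w) := by
  refine ⟨fun r hr c hc => ?_, fun r hr => ?_, fun c hc => ?_⟩
  · unfold MNW.subMatching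
    split_ifs with h
    · subst h; exact sub_nonneg.mpr (hw c hc)
    · simpa using hs.nonneg r hr c hc
  · simp only [MNW.subMatching]
    rw [Finset.sum_sub_distrib, hs.row r hr]
    obtain ⟨c, hc, e⟩ := hσ.surj hr
    rw [Finset.sum_eq_single c, if_pos e]
    · intro d hd hne
      rw [if_neg]
      intro e'
      exact hne (hσ.inj d (Finset.mem_range.mp hd) c hc (e'.trans e.symm))
    · intro h; exact absurd (Finset.mem_range.mpr hc) h
  · simp only [MNW.subMatching]
    rw [Finset.sum_sub_distrib, hs.col c hc, Finset.sum_ite_eq,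
      if_pos (Finset.mem_range.mpr (hσ.lt c hc))]

/-- The number of positive entries. -/
def posCount (K : ℕ) (Z : ℕ → ℕ → ℤ) : ℕ :=
  ((Finset.range K ×ˢ Finset.range K).filter fun x => 0 < Z x.1 x.2).card

theorem posCount_le (K : ℕ) (Z : ℕ → ℕ → ℤ) : posCount K Z ≤ K * K := by
  refine (Finset.card_filter_le _ _).trans ?_
  simp

theorem subMatching_le {σ : ℕ → ℕ} {w : ℤ} (hw : 0 ≤ w) (r c : ℕ) :
    subMatching Z σ w r c ≤ Z r c := by
  unfold subMatching
  split_ifs <;> linarith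

theorem posCount_subMatching_le {σ : ℕ → ℕ} {w : ℤ} (hw : 0 ≤ w) :
    posCount K (subMatching Z σ w) ≤ posCount K Z :=
  Finset.card_le_card fun x hx => by
    obtain ⟨h1, h2⟩ := Finset.mem_filter.mp hx
    exact Finset.mem_filter.mpr ⟨h1, h2.trans_le (subMatching_le hw _ _)⟩

theorem posCount_subMatching_lt {σ : ℕ → ℕ} (hσ : IsMatching K Z σ) {c : ℕ} (hc : c < K) :
    posCount K (subMatching Z σ (Z (σ c) c)) < posCount K Z := by
  refine Finset.card_lt_card ((Finset.ssubset_iff_of_subset fun x hx => ?_).mpr ⟨(σ c, c), ?_, ?_⟩)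
  · obtain ⟨h1, h2⟩ := Finset.mem_filter.mp hx
    exact Finset.mem_filter.mpr ⟨h1, h2.trans_le (subMatching_le (hσ.pos c hc).le _ _)⟩
  · simp [hσ.lt c hc, hc, hσ.pos c hc]
  · simp [subMatching]

/-! ### Reasoning about programs -/

infixr:60 ";;" => Cmd.seq

/-- The registers that a program may write. -/
def Cmd.regs : Cmd → List ℕ
  | .const x _ => [x]
  | .add x _ _ => [x]
  | .sub x _ _ => [x]
  | .half x _ => [x]
  | .load x _ _ _ => [x]
  | .store _ _ _ _ => []
  | .seq c d => c.regs ++ d.regs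
  | .ifPos _ c d => c.regs ++ d.regs
  | .whilePos _ c => c.regs

/-- The arrays that a program may write. -/
def Cmd.arrs : Cmd → List ℕ
  | .store a _ _ _ => [a]
  | .seq c d => c.arrs ++ d.arrs
  | .ifPos _ c d => c.arrs ++ d.arrs
  | .whilePos _ c => c.arrs
  | _ => []

/-- The two memories agree outside the registers `R` and the arrays `A`. -/
structure Agree (R A : List ℕ) (s s' : State) : Prop where
  reg : ∀ x, x ∉ R → s'.reg x = s.reg x
  arr : ∀ a, a ∉ A → s'.arr a = s.arr a

theorem Agree.refl (R A : List ℕ) (s : State) : Agree R A s s := ⟨fun _ _ => rfl, fun _ _ => rfl⟩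

theorem Agree.trans {R A : List ℕ} {s s' s'' : State} (h : Agree R A s s') (h' : Agree R A s' s'') :
    Agree R A s s'' :=
  ⟨fun x hx => (h'.reg x hx).trans (h.reg x hx), fun a ha => (h'.arr a ha).trans (h.arr a ha)⟩

theorem Agree.mono {R A R' A' : List ℕ} {s s' : State} (h : Agree R A s s') (hR : R ⊆ R')
    (hA : A ⊆ A') : Agree R' A' s s' :=
  ⟨fun x hx => h.reg x fun h' => hx (hR h'), fun a ha => h.arr a fun h' => ha (hA h')⟩

@[simp] theorem State.setReg_reg (s : State) (x : ℕ) (z : ℤ) (y : ℕ) :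
    (s.setReg x z).reg y = if y = x then z else s.reg y := by
  simp [State.setReg, Function.update_apply]

@[simp] theorem State.setReg_arr (s : State) (x : ℕ) (z : ℤ) : (s.setReg x z).arr = s.arr := rfl

@[simp] theorem State.setArr_reg (s : State) (a i j : ℕ) (z : ℤ) :
    (s.setArr a i j z).reg = s.reg := rfl

theorem State.setArr_arr (s : State) (a i j : ℕ) (z : ℤ) (b k l : ℕ) :
    (s.setArr a i j z).arr b k l = if b = a ∧ k = i ∧ l = j then z else s.arr b k l := by
  simp only [State.setArr, Function.update_apply]
  by_cases h : b = a
  · subst h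
    by_cases h' : k = i
    · subst h'
      simp [Function.update_apply]
    · simp [h']
  · simp [h]

@[simp] theorem State.setArr_arr_self (s : State) (a i j : ℕ) (z : ℤ) (k l : ℕ) :
    (s.setArr a i j z).arr a k l = if k = i ∧ l = j then z else s.arr a k l := by
  simp [State.setArr_arr]

@[simp] theorem State.setArr_arr_of_ne (s : State) {a b : ℕ} (h : b ≠ a) (i j : ℕ) (z : ℤ) :
    (s.setArr a i j z).arr b = s.arr b := by
  funext k l
  simp [State.setArr_arr, h]

theorem Run.agree {c : Cmd} {s s' : State} {t : ℕ} (h : Run c s s' t) :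
    Agree c.regs c.arrs s s' := by
  induction h with
  | const x c s => exact ⟨fun y hy => by simp_all [Cmd.regs], fun _ _ => rfl⟩
  | add x y z s => exact ⟨fun y hy => by simp_all [Cmd.regs], fun _ _ => rfl⟩
  | sub x y z s => exact ⟨fun y hy => by simp_all [Cmd.regs], fun _ _ => rfl⟩
  | half x y s => exact ⟨fun y hy => by simp_all [Cmd.regs], fun _ _ => rfl⟩
  | load x a i j s => exact ⟨fun y hy => by simp_all [Cmd.regs], fun _ _ => rfl⟩
  | store a i j x s => exact ⟨fun _ _ => rfl, fun b hb => by simp_all [Cmd.arrs]⟩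
  | seq _ _ ih ih' =>
    exact (ih.mono (List.subset_append_left _ _) (List.subset_append_left _ _)).trans
      (ih'.mono (List.subset_append_right _ _) (List.subset_append_right _ _))
  | ifTrue _ _ ih => exact ih.mono (List.subset_append_left _ _) (List.subset_append_left _ _)
  | ifFalse _ _ ih => exact ih.mono (List.subset_append_right _ _) (List.subset_append_right _ _)
  | whileTrue _ _ _ ih ih' => exact ih.trans ih'
  | whileFalse _ => exact Agree.refl _ _ _

/-- The program `c`, started in memory `s`, halts in a memory `s'` after `t` steps with `Q s' t`. -/
def Wp (c : Cmd) (s : State) (Q : State → ℕ → Prop) : Prop := ∃ s' t, Run c s s' t ∧ Q s' t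

section Wp

variable {c d : Cmd} {s : State} {P Q : State → ℕ → Prop}

/-- The frame `Agree` can be read off the syntax of the program, so specifications need not mention
memory that the program never writes. -/
theorem Wp.mono (h : Wp c s P) (hPQ : ∀ s' t, Agree c.regs c.arrs s s' → P s' t → Q s' t) :
    Wp c s Q := by
  obtain ⟨s', t, hr, hP⟩ := h
  exact ⟨s', t, hr, hPQ s' t hr.agree hP⟩

@[simp] theorem wp_const (x : ℕ) (z : ℤ) : Wp (.const x z) s Q ↔ Q (s.setReg x z) 1 :=
  ⟨by rintro ⟨_, _, ⟨⟩, h⟩; exact h, fun h => ⟨_, _, .const _ _ _, h⟩⟩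

@[simp] theorem wp_add (x y z : ℕ) :
    Wp (.add x y z) s Q ↔ Q (s.setReg x (s.reg y + s.reg z)) 1 :=
  ⟨by rintro ⟨_, _, ⟨⟩, h⟩; exact h, fun h => ⟨_, _, .add _ _ _ _, h⟩⟩

@[simp] theorem wp_sub (x y z : ℕ) :
    Wp (.sub x y z) s Q ↔ Q (s.setReg x (s.reg y - s.reg z)) 1 :=
  ⟨by rintro ⟨_, _, ⟨⟩, h⟩; exact h, fun h => ⟨_, _, .sub _ _ _ _, h⟩⟩

@[simp] theorem wp_half (x y : ℕ) : Wp (.half x y) s Q ↔ Q (s.setReg x (s.reg y / 2)) 1 :=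
  ⟨by rintro ⟨_, _, ⟨⟩, h⟩; exact h, fun h => ⟨_, _, .half _ _ _, h⟩⟩

@[simp] theorem wp_load (x a i j : ℕ) : Wp (.load x a i j) s Q ↔
    Q (s.setReg x (s.arr a (s.reg i).toNat (s.reg j).toNat)) 1 :=
  ⟨by rintro ⟨_, _, ⟨⟩, h⟩; exact h, fun h => ⟨_, _, .load _ _ _ _ _, h⟩⟩

@[simp] theorem wp_store (a i j x : ℕ) : Wp (.store a i j x) s Q ↔
    Q (s.setArr a (s.reg i).toNat (s.reg j).toNat (s.reg x)) 1 :=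
  ⟨by rintro ⟨_, _, ⟨⟩, h⟩; exact h, fun h => ⟨_, _, .store _ _ _ _ _, h⟩⟩

@[simp] theorem wp_seq :
    Wp (c ;; d) s Q ↔ Wp c s fun s' t => Wp d s' fun s'' t' => Q s'' (t + t') := by
  constructor
  · rintro ⟨_, _, hr, h⟩
    cases hr with
    | seq h1 h2 => exact ⟨_, _, h1, _, _, h2, h⟩
  · rintro ⟨_, _, h1, _, _, h2, h⟩
    exact ⟨_, _, .seq h1 h2, h⟩

@[simp] theorem wp_ifPos (x : ℕ) : Wp (.ifPos x c d) s Q ↔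
    (0 < s.reg x → Wp c s fun s' t => Q s' (t + 1)) ∧
    (¬ 0 < s.reg x → Wp d s fun s' t => Q s' (t + 1)) := by
  constructor
  · rintro ⟨_, _, hr, h⟩
    cases hr with
    | ifTrue h1 h2 => exact ⟨fun _ => ⟨_, _, h2, h⟩, fun h' => absurd h1 h'⟩
    | ifFalse h1 h2 => exact ⟨fun h' => absurd h' h1, fun _ => ⟨_, _, h2, h⟩⟩
  · rintro ⟨h1, h2⟩
    by_cases hx : 0 < s.reg x
    · obtain ⟨s', t, hr, h⟩ := h1 hx
      exact ⟨s', _, .ifTrue hx hr, h⟩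
    · obtain ⟨s', t, hr, h⟩ := h2 hx
      exact ⟨s', _, .ifFalse hx hr, h⟩

/-- Loop rule: `I b s'` is an invariant that allows at most `b` further rounds. -/
theorem Wp.whilePos {x T : ℕ} (I : ℕ → State → Prop) {b : ℕ} (h0 : I b s)
    (hstep : ∀ b' s', Agree c.regs c.arrs s s' → 0 < s'.reg x → I b' s' →
      Wp c s' fun s'' t => t ≤ T ∧ ∃ b'' < b', I b'' s'') :
    Wp (.whilePos x c) s fun s' t => t ≤ b * (T + 1) + 1 ∧ (∃ b', I b' s') ∧ ¬ 0 < s'.reg x := by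
  have key : ∀ b' s', Agree c.regs c.arrs s s' → I b' s' → Wp (.whilePos x c) s'
      fun s' t => t ≤ b' * (T + 1) + 1 ∧ (∃ b', I b' s') ∧ ¬ 0 < s'.reg x := by
    intro b'
    induction b' using Nat.strong_induction_on with
    | _ b' ih =>
      intro s' hs' hI
      by_cases hx : 0 < s'.reg x
      · obtain ⟨s'', t, hr, ht, b'', hb, hI'⟩ := hstep b' s' hs' hx hI
        obtain ⟨s₃, t', hr', ht', h⟩ := ih b'' hb s'' (hs'.trans hr.agree) hI'
        refine ⟨s₃, _, .whileTrue hx hr hr', ?_, h⟩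
        have : (b'' + 1) * (T + 1) ≤ b' * (T + 1) := Nat.mul_le_mul_right _ hb
        rw [Nat.add_mul, one_mul] at this
        omega
      · exact ⟨s', _, .whileFalse hx, by omega, ⟨b', hI⟩, hx⟩
  exact key b s (Agree.refl _ _ _) h0

/-- `for i := 0, …, (content of register b) - 1 do c`, with the scratch register `d`. -/
def forCmd (i b d : ℕ) (c : Cmd) : Cmd :=
  .const i 0 ;; .sub d b i ;; .whilePos d (c ;; .const d 1 ;; .add i i d ;; .sub d b i)

/-- A round costs the body, three assignments and a test. The condition `hI` says that the invariant
ignores the counter and the scratch register; for concrete registers the disjointness conditions are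
decidable. -/
theorem Wp.forCmd {i b d N T : ℕ} (I : ℕ → State → Prop) (hN : s.reg b = N) (h0 : I 0 s)
    (hstep : ∀ k < N, ∀ s', Agree (i :: d :: c.regs) c.arrs s s' → s'.reg i = k →
      s'.reg b = N → I k s' → Wp c s' fun s'' t => t ≤ T ∧ I (k + 1) s'')
    (hI : ∀ k s' s'', Agree [i, d] [] s' s'' → I k s' → I k s'' := by
      intro k s' s'' ag h; simpa [ag.reg, ag.arr] using h)
    (hid : i ≠ d := by decide) (hib : i ≠ b := by decide) (hdb : d ≠ b := by decide)
    (hi : i ∉ c.regs := by decide) (hb : b ∉ c.regs := by decide) :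
    Wp (forCmd i b d c) s fun s' t => t ≤ N * (T + 4) + 3 ∧ I N s' := by
  have hag : ∀ (s : State) z w, Agree [i, d] [] s ((s.setReg i z).setReg d w) := fun s z w =>
    ⟨fun x hx => by simp_all, fun _ _ => rfl⟩
  simp only [MNW.forCmd, wp_seq, wp_const, wp_sub]
  -- The index `r` counts the remaining rounds, which is also the content of `d`; the counter is
  -- therefore at `N - r`.
  refine (Wp.whilePos (T := T + 3) (b := N) (fun r s' => r ≤ N ∧ s'.reg i = (N - r : ℕ) ∧
    s'.reg b = N ∧ s'.reg d = r ∧ I (N - r) s') ?_ ?_).mono ?_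
  · refine ⟨le_rfl, ?_, ?_, ?_, ?_⟩
    · simp [hid]
    · simp [hib.symm, hdb.symm, hN]
    · simp [hib.symm, hN]
    · rw [Nat.sub_self]; exact hI _ _ _ (hag _ _ _) h0
  · rintro r s' ag hpos ⟨hr, h1, h2, h3, h4⟩
    rw [h3] at hpos
    have hr0 : 0 < r := by exact_mod_cast hpos
    have ag' : Agree (i :: d :: c.regs) c.arrs s s' := by
      refine ((hag s 0 (s.reg b - 0)).mono (by simp) (by simp)).trans ?_
      have e : ((s.setReg i 0).setReg d (s.reg b - 0)) =
          (s.setReg i 0).setReg d ((s.setReg i 0).reg b - (s.setReg i 0).reg i) := by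
        simp [hib.symm]
      rw [e]
      exact ag.mono (by simp [Cmd.regs]) (by simp [Cmd.arrs])
    rw [wp_seq]
    refine (hstep (N - r) (by omega) s' ag' h1 h2 h4).mono ?_
    rintro s'' t ag'' ⟨ht, hI'⟩
    simp only [wp_seq, wp_const, wp_sub, wp_add]
    have e1 : s''.reg i = (N - r : ℕ) := by rw [ag''.reg i hi, h1]
    have e2 : s''.reg b = N := by rw [ag''.reg b hb, h2]
    refine ⟨by omega, r - 1, by omega, by omega, ?_, ?_, ?_, ?_⟩
    · simp [hid, e1]; omega
    · simp [hib.symm, hdb.symm, e2]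
    · simp [hid, hib.symm, hdb.symm, e1, e2]; omega
    · have : N - (r - 1) = N - r + 1 := by omega
      rw [this]
      refine hI _ s'' _ ⟨fun x hx => ?_, fun _ _ => rfl⟩ hI'
      simp_all
  · rintro s' t ag ⟨ht, ⟨r, hr, -, -, h3, h4⟩, hx⟩
    rw [h3] at hx
    have : r = 0 := by omega
    subst this
    exact ⟨by have e : N * (T + 3 + 1) = N * (T + 4) := rfl; omega, by simpa using h4⟩

end Wp

/-! ### Multiplication -/

/-- Multiplies registers `10` and `11` into register `12`. -/
def mulCmd : Cmd :=
  .const 12 0 ;; .whilePos 11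
    -- Register `14` first holds the parity of register `11`, later a zero used for copying; the
    -- `const` in the second branch stands for no action.
    (.half 13 11 ;; .sub 14 11 13 ;; .sub 14 14 13 ;; .ifPos 14 (.add 12 12 10) (.const 14 0) ;;
      .add 10 10 10 ;; .const 14 0 ;; .add 11 13 14)

theorem size_half_lt {b : ℕ} (hb : 0 < b) : (b / 2).size < b.size := by
  obtain ⟨k, hk⟩ := Nat.exists_eq_succ_of_ne_zero (Nat.size_pos.mpr hb).ne'
  have h := Nat.lt_size_self b
  rw [hk] at h ⊢
  refine Nat.lt_succ_of_le (Nat.size_le.mpr ?_)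
  rw [Nat.succ_eq_add_one, pow_succ] at h
  omega

/-- Multiplication by doubling and halving: register `12` plus the product of registers `10` and
`11` is invariant. The number of steps depends only on the length of the multiplier in register
`11`, not on that of register `10`. -/
theorem wp_mulCmd {s : State} {b S : ℕ} (hb : s.reg 11 = b) (hS : b.size ≤ S) :
    Wp mulCmd s fun s' t => t ≤ 9 * S + 2 ∧ s'.reg 12 = s.reg 10 * b := by
  simp only [mulCmd, wp_seq, wp_const]
  refine (Wp.whilePos (T := 8) (b := b.size) (fun r s' => ∃ b' : ℕ, r = b'.size ∧ s'.reg 11 = b' ∧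
    s'.reg 12 + s'.reg 10 * b' = s.reg 10 * b) ⟨b, rfl, by simp [hb], by simp⟩ ?_).mono ?_
  · rintro r s' - hpos ⟨b', rfl, h1, h2⟩
    rw [h1] at hpos
    have hpos' : 0 < b' := by exact_mod_cast hpos
    have hdiv : ((b' : ℤ) / 2) = ((b' / 2 : ℕ) : ℤ) := by simp
    simp [h1]
    constructor
    · intro h
      refine ⟨b' / 2, size_half_lt hpos', by simp, ?_⟩
      rw [← h2]
      have : (b' : ℤ) = 2 * ((b' / 2 : ℕ) : ℤ) + 1 := by omega
      push_cast at this ⊢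
      conv_rhs => rw [this]
      ring
    · intro h
      refine ⟨b' / 2, size_half_lt hpos', by simp, ?_⟩
      rw [← h2]
      have : (b' : ℤ) = 2 * ((b' / 2 : ℕ) : ℤ) := by omega
      push_cast at this ⊢
      conv_rhs => rw [this]
      ring
  · rintro s' t - ⟨ht, ⟨r, b', -, h1, h2⟩, hx⟩
    have : b' = 0 := by rw [h1] at hx; omega
    subst this
    exact ⟨by omega, by simpa using h2⟩

/-! ### Common denominators -/

/-- Multiplies all entries of array `3` by register `16`. -/
def scaleArrCmd : Cmd :=
  forCmd 7 0 8 (forCmd 9 1 15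
    (.load 10 3 7 9 ;; .add 11 16 17 ;; mulCmd ;; .store 3 7 9 12))

theorem wp_scaleArrCmd {s : State} {n m d S : ℕ} (hn : s.reg 0 = n) (hm : s.reg 1 = m)
    (hd : s.reg 16 = d) (h17 : s.reg 17 = 0) (hS : d.size ≤ S) :
    Wp scaleArrCmd s fun s' t => t ≤ n * (m * (9 * S + 9) + 7) + 3 ∧
      ∀ i < n, ∀ g < m, s'.arr 3 i g = s.arr 3 i g * d := by
  refine (Wp.forCmd (N := n) (T := m * (9 * S + 9) + 3) (fun k s' => ∀ i < n, ∀ g < m,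
    s'.arr 3 i g = if i < k then s.arr 3 i g * d else s.arr 3 i g) hn (by simp) ?_).mono ?_
  · intro k hk s₁ ag₁ hi₁ _ hI₁
    refine (Wp.forCmd (N := m) (T := 9 * S + 5) (fun l s' => ∀ i < n, ∀ g < m,
      s'.arr 3 i g = if i < k ∨ (i = k ∧ g < l) then s.arr 3 i g * d else s.arr 3 i g) ?_ ?_
      ?_).mono ?_
    · rw [ag₁.reg 1 (by decide), hm]
    · simpa using hI₁
    · intro l hl s₂ ag₂ hl₂ _ hI₂
      have e16 : s₂.reg 16 = d := by rw [ag₂.reg 16 (by decide), ag₁.reg 16 (by decide), hd]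
      have e17 : s₂.reg 17 = 0 := by rw [ag₂.reg 17 (by decide), ag₁.reg 17 (by decide), h17]
      have e7 : s₂.reg 7 = k := by rw [ag₂.reg 7 (by decide), hi₁]
      simp only [wp_seq, wp_load, wp_add]
      refine (wp_mulCmd (b := d) (S := S) (by simp [e16, e17]) hS).mono ?_
      rintro s₃ t ag₃ ⟨ht, h12⟩
      have e7' : s₃.reg 7 = k := by rw [ag₃.reg 7 (by decide)]; simp [e7]
      have e9' : s₃.reg 9 = l := by rw [ag₃.reg 9 (by decide)]; simp [hl₂]
      rw [wp_store]
      refine ⟨by omega, fun i hi g hg => ?_⟩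
      simp only [State.setArr_arr_self, e7', e9', Int.toNat_natCast]
      rw [ag₃.arr 3 (by decide)]
      simp only [State.setReg_arr]
      by_cases h : i = k ∧ g = l
      · obtain ⟨rfl, rfl⟩ := h
        rw [if_pos ⟨rfl, rfl⟩, h12, if_pos (by omega)]
        simp [e7, hl₂, hI₂ i hi g hg]
      · rw [if_neg h, hI₂ i hi g hg]
        exact if_congr (by omega) rfl rfl
    · rintro s₂ t - ⟨ht, hI₂⟩
      refine ⟨ht, fun i hi g hg => ?_⟩
      rw [hI₂ i hi g hg]
      exact if_congr (by omega) rfl rfl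
  · rintro s' t - ⟨ht, hI⟩
    refine ⟨by omega, fun i hi g hg => ?_⟩
    rw [hI i hi g hg, if_pos hi]

/-- Given fractions in arrays `1` and `2`, writes a common denominator to register `2` and the
numerators to array `3`. -/
def scaleCmd : Cmd :=
  .const 17 0 ;; .const 2 1 ;; forCmd 3 0 4 (forCmd 5 1 6
    (.load 16 2 3 5 ;; scaleArrCmd ;;
      .add 10 2 17 ;; .load 11 1 3 5 ;; mulCmd ;; .store 3 3 5 12 ;;
      .add 10 2 17 ;; .add 11 16 17 ;; mulCmd ;; .add 2 12 17))

/-- The common denominator is the product of all denominators. Each new fraction multiplies the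
earlier numerators by its denominator and gets its own numerator times the old common denominator.
The multiplier is always a number from the input, so `S` bounds the cost although the products grow.
-/
theorem wp_scaleCmd {s : State} {n m S : ℕ} {num den : ℕ → ℕ → ℕ} (hn : s.reg 0 = n)
    (hm : s.reg 1 = m) (hnum : ∀ i < n, ∀ g < m, s.arr 1 i g = num i g)
    (hden : ∀ i < n, ∀ g < m, s.arr 2 i g = den i g) (hpos : ∀ i < n, ∀ g < m, 0 < den i g)
    (hSnum : ∀ i < n, ∀ g < m, (num i g).size ≤ S) (hSden : ∀ i < n, ∀ g < m, (den i g).size ≤ S)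
    (h3 : s.arr 3 = fun _ _ => 0) :
    Wp scaleCmd s fun s' t =>
      t ≤ n * (m * (n * (m * (9 * S + 9) + 7) + 18 * S + 18) + 7) + 5 ∧
      0 < s'.reg 2 ∧ ∀ i < n, ∀ g < m, s'.arr 3 i g * den i g = num i g * s'.reg 2 := by
  simp only [scaleCmd, wp_seq, wp_const]
  refine (Wp.forCmd (N := n) (T := m * (n * (m * (9 * S + 9) + 7) + 18 * S + 18) + 3)
    (fun k s' => 0 < s'.reg 2 ∧ ∀ i < n, ∀ g < m,
      if i < k then s'.arr 3 i g * den i g = num i g * s'.reg 2 else s'.arr 3 i g = 0)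
    (by simp [hn]) (by simp [h3]) ?_).mono ?_
  · rintro k hk s₁ ag₁ hi₁ - ⟨hN₁, hI₁⟩
    refine (Wp.forCmd (N := m) (T := n * (m * (9 * S + 9) + 7) + 18 * S + 14)
      (fun l s' => 0 < s'.reg 2 ∧ ∀ i < n, ∀ g < m,
        if i < k ∨ (i = k ∧ g < l) then s'.arr 3 i g * den i g = num i g * s'.reg 2
        else s'.arr 3 i g = 0) ?_ ?_ ?_).mono ?_
    · rw [ag₁.reg 1 (by decide)]; simp [hm]
    · simpa using ⟨hN₁, hI₁⟩
    · rintro l hl s₂ ag₂ hl₂ hm₂ ⟨hN₂, hI₂⟩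
      have e0 : s₂.reg 0 = n := by rw [ag₂.reg 0 (by decide), ag₁.reg 0 (by decide)]; simp [hn]
      have e17 : s₂.reg 17 = 0 := by rw [ag₂.reg 17 (by decide), ag₁.reg 17 (by decide)]; simp
      have e3 : s₂.reg 3 = k := by rw [ag₂.reg 3 (by decide), hi₁]
      have a1 : s₂.arr 1 = s.arr 1 := by rw [ag₂.arr 1 (by decide), ag₁.arr 1 (by decide)]; simp
      have a2 : s₂.arr 2 = s.arr 2 := by rw [ag₂.arr 2 (by decide), ag₁.arr 2 (by decide)]; simp
      simp only [wp_seq, wp_load, wp_add]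
      refine (wp_scaleArrCmd (n := n) (m := m) (d := den k l) (S := S) (by simp [e0])
        (by simp [hm₂]) (by simp [e3, hl₂, a2, hden k hk l hl]) (by simp [e17])
        (hSden k hk l hl)).mono ?_
      rintro s₃ t₃ ag₃ ⟨ht₃, hI₃⟩
      have r3 : s₃.reg 3 = k := by rw [ag₃.reg 3 (by decide)]; simp [e3]
      have r5 : s₃.reg 5 = l := by rw [ag₃.reg 5 (by decide)]; simp [hl₂]
      have r2 : s₃.reg 2 = s₂.reg 2 := by rw [ag₃.reg 2 (by decide)]; simp
      have r16 : s₃.reg 16 = den k l := by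
        rw [ag₃.reg 16 (by decide)]; simp [e3, hl₂, a2, hden k hk l hl]
      have r17 : s₃.reg 17 = 0 := by rw [ag₃.reg 17 (by decide)]; simp [e17]
      have b1 : s₃.arr 1 = s.arr 1 := by rw [ag₃.arr 1 (by decide)]; simp [a1]
      refine (wp_mulCmd (b := num k l) (S := S) (by simp [r3, r5, b1, hnum k hk l hl])
        (hSnum k hk l hl)).mono ?_
      rintro s₄ t₄ ag₄ ⟨ht₄, h12⟩
      have q3 : s₄.reg 3 = k := by rw [ag₄.reg 3 (by decide)]; simp [r3]
      have q5 : s₄.reg 5 = l := by rw [ag₄.reg 5 (by decide)]; simp [r5]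
      have q2 : s₄.reg 2 = s₂.reg 2 := by rw [ag₄.reg 2 (by decide)]; simp [r2]
      have q16 : s₄.reg 16 = den k l := by rw [ag₄.reg 16 (by decide)]; simp [r16]
      have q17 : s₄.reg 17 = 0 := by rw [ag₄.reg 17 (by decide)]; simp [r17]
      have c3 : s₄.arr 3 = s₃.arr 3 := by rw [ag₄.arr 3 (by decide)]; simp
      simp only [wp_store]
      refine (wp_mulCmd (b := den k l) (S := S) (by simp [q16, q17]) (hSden k hk l hl)).mono ?_
      rintro s₅ t₅ ag₅ ⟨ht₅, h12'⟩
      have p17 : s₅.reg 17 = 0 := by rw [ag₅.reg 17 (by decide)]; simp [q17]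
      have d3 : ∀ i g, s₅.arr 3 i g = if i = k ∧ g = l then s₂.reg 2 * num k l else
          s₃.arr 3 i g := by
        intro i g
        rw [ag₅.arr 3 (by decide)]
        simp [q3, q5, c3, h12, r17, r2]
      have hN₅ : s₅.reg 12 = s₂.reg 2 * den k l := by rw [h12']; simp [q17, q2]
      refine ⟨by omega, ?_, fun i hi g hg => ?_⟩
      · simp only [State.setReg_reg, if_true, p17, hN₅, add_zero]
        exact mul_pos hN₂ (by exact_mod_cast hpos k hk l hl)
      · simp only [State.setReg_reg, State.setReg_arr, if_true, p17, hN₅, add_zero, d3]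
        by_cases h : i = k ∧ g = l
        · obtain ⟨rfl, rfl⟩ := h
          rw [if_pos (by omega), if_pos ⟨rfl, rfl⟩]
          ring
        · rw [if_neg h, hI₃ i hi g hg]
          have := hI₂ i hi g hg
          by_cases h' : i < k ∨ i = k ∧ g < l
          · rw [if_pos h'] at this
            rw [if_pos (by omega)]
            simp only [State.setReg_arr]
            linear_combination (den k l : ℤ) * this
          · rw [if_neg h'] at this
            rw [if_neg (by omega)]
            simp [this]
    · rintro s₂ t - ⟨ht, hN₂, hI₂⟩
      refine ⟨ht, hN₂, fun i hi g hg => ?_⟩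
      have := hI₂ i hi g hg
      by_cases h : i < k + 1
      · rw [if_pos (by omega)] at this
        rwa [if_pos h]
      · rw [if_neg (by omega)] at this
        rwa [if_neg h]
  · rintro s' t - ⟨ht, hN, hI⟩
    refine ⟨?_, hN, fun i hi g hg => ?_⟩
    · have e : n * (m * (n * (m * (9 * S + 9) + 7) + 18 * S + 18) + 3 + 4) =
        n * (m * (n * (m * (9 * S + 9) + 7) + 18 * S + 18) + 7) := by ring
      omega
    · simpa [hi] using hI i hi g hg

/-! ### Building the padded matrix -/

/-- The matrix `Y` with entry `(r, g)` replaced by `y`. -/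
def setEntry (Y : ℕ → ℕ → ℤ) (r g : ℕ) (y : ℤ) (r' g' : ℕ) : ℤ :=
  if r' = r ∧ g' = g then y else Y r' g'

theorem sum_setEntry_row {Y : ℕ → ℕ → ℤ} {m r g : ℕ} (hg : g < m) (h0 : Y r g = 0) (y : ℤ) :
    ∑ h ∈ Finset.range m, setEntry Y r g y r h = ∑ h ∈ Finset.range m, Y r h + y := by
  have : ∀ h ∈ Finset.range m, setEntry Y r g y r h = Y r h + if h = g then y else 0 := by
    intro h _
    by_cases hh : h = g
    · subst hh; simp [setEntry, h0]
    · simp [setEntry, hh]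
  rw [Finset.sum_congr rfl this, Finset.sum_add_distrib, Finset.sum_ite_eq',
    if_pos (Finset.mem_range.mpr hg)]

theorem sum_setEntry_col {Y : ℕ → ℕ → ℤ} {R r g : ℕ} (hr : r < R) (h0 : Y r g = 0) (y : ℤ) :
    ∑ q ∈ Finset.range R, setEntry Y r g y q g = ∑ q ∈ Finset.range R, Y q g + y := by
  have : ∀ q ∈ Finset.range R, setEntry Y r g y q g = Y q g + if q = r then y else 0 := by
    intro q _
    by_cases hh : q = r
    · subst hh; simp [setEntry, h0]
    · simp [setEntry, hh]
  rw [Finset.sum_congr rfl this, Finset.sum_add_distrib, Finset.sum_ite_eq',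
    if_pos (Finset.mem_range.mpr hr)]

/-- An entry of `Y` enters the padded matrix in four places: itself, its mirror image, and the two
completions of its row and column. Hence the matrix can be built entry by entry at constant cost. -/
theorem pad_setEntry {R m r g : ℕ} {N : ℤ} {Y : ℕ → ℕ → ℤ} (hr : r < R) (hg : g < m)
    (h0 : Y r g = 0) (y : ℤ) (a b : ℕ) :
    pad R m N (setEntry Y r g y) a b =
      if a = R + g ∧ b = g then pad R m N Y a b - y
      else if a = r ∧ b = m + r then pad R m N Y a b - y
      else if a = R + g ∧ b = m + r then y
      else if a = r ∧ b = g then y else pad R m N Y a b := by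
  unfold pad
  by_cases ha : a < R
  · simp only [ha, if_true]
    by_cases hb : b < m
    · simp only [hb, if_true]
      rw [if_neg (by omega), if_neg (by omega), if_neg (by omega)]
      rfl
    · simp only [hb, if_false]
      by_cases hab : b - m = a
      · simp only [hab, if_true]
        by_cases har : a = r
        · subst har
          rw [if_neg (by omega), if_pos (by omega), sum_setEntry_row hg h0]
          ring
        · rw [if_neg (by omega), if_neg (by omega), if_neg (by omega), if_neg (by omega)]
          simp [setEntry, har]
      · simp only [hab, if_false]
        rw [if_neg (by omega), if_neg (by omega), if_neg (by omega), if_neg (by omega)]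
  · simp only [ha, if_false]
    by_cases hb : b < m
    · simp only [hb, if_true]
      by_cases hab : a - R = b
      · simp only [hab, if_true]
        by_cases hbg : b = g
        · subst hbg
          rw [if_pos (by omega), sum_setEntry_col hr h0]
          ring
        · rw [if_neg (by omega), if_neg (by omega), if_neg (by omega), if_neg (by omega)]
          simp [setEntry, hbg]
      · simp only [hab, if_false]
        rw [if_neg (by omega), if_neg (by omega), if_neg (by omega), if_neg (by omega)]
    · simp only [hb, if_false]
      rw [if_neg (by omega), if_neg (by omega)]
      by_cases h : a = R + g ∧ b = m + r
      · rw [if_pos h, setEntry, if_pos (by omega)]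
      · rw [if_neg h, if_neg (by omega), setEntry, if_neg (by omega)]

theorem pad_congr {R m : ℕ} {N : ℤ} {Y Y' : ℕ → ℕ → ℤ} (h : ∀ r < R, ∀ g < m, Y r g = Y' r g)
    {a b : ℕ} (ha : a < R + m) (hb : b < R + m) : pad R m N Y a b = pad R m N Y' a b := by
  unfold pad
  split_ifs with h1 h2 h3 h4 h5
  · exact h a h1 b h2
  · rw [Finset.sum_congr rfl fun g hg => h a h1 g (Finset.mem_range.mp hg)]
  · rfl
  · rw [Finset.sum_congr rfl fun q hq => h q (Finset.mem_range.mp hq) b h4]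
  · rfl
  · exact h _ (by omega) _ (by omega)

/-- With `r` in register `10`, `g` in register `x`, the number of slots in register `21` and the
number of goods in register `1`: changes entry `(r, g)` of the unpadded matrix from zero to the
content of register `18`, and updates the padded matrix in array `4`. -/
def putCmd (x : ℕ) : Cmd :=
  .add 23 21 x ;; .add 24 1 10 ;; .store 4 10 x 18 ;; .store 4 23 24 18 ;;
  .load 25 4 10 24 ;; .sub 25 25 18 ;; .store 4 10 24 25 ;;
  .load 25 4 23 x ;; .sub 25 25 18 ;; .store 4 23 x 25

theorem wp_putCmd {s : State} {x R m r g : ℕ} {N : ℤ} {Y : ℕ → ℕ → ℤ} (hr : r < R) (hg : g < m)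
    (h0 : Y r g = 0) (h1 : s.reg 1 = m) (h10 : s.reg 10 = r) (hx : s.reg x = g)
    (h21 : s.reg 21 = R) (hZ : ∀ a < R + m, ∀ b < R + m, s.arr 4 a b = pad R m N Y a b)
    (hx' : x ∉ [23, 24, 25]) :
    Wp (putCmd x) s fun s' t => t ≤ 10 ∧
      ∀ a < R + m, ∀ b < R + m, s'.arr 4 a b = pad R m N (setEntry Y r g (s.reg 18)) a b := by
  simp only [List.mem_cons, List.not_mem_nil, or_false, not_or] at hx'
  obtain ⟨h23, h24, h25⟩ := hx'
  have e1 : ((R : ℤ) + g).toNat = R + g := by omega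
  have e2 : ((m : ℤ) + r).toNat = m + r := by omega
  simp only [putCmd, wp_seq, wp_add, wp_store, wp_load, wp_sub]
  refine ⟨by norm_num, fun a ha b hb => ?_⟩
  rw [pad_setEntry hr hg h0, ← hZ a ha b hb]
  simp [h1, h10, hx, h21, h23, h24, h25, e1, e2]
  by_cases c1 : a = R + g ∧ b = g
  · rw [if_pos c1, if_pos c1, c1.1, c1.2]
    simp [show ¬ (R + g = r) by omega, show ¬ (g = m + r) by omega]
  · rw [if_neg c1, if_neg c1]
    by_cases c2 : a = r ∧ b = m + r
    · rw [if_pos c2, if_pos c2, c2.1, c2.2]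
      simp [show ¬ (r = R + g) by omega, show ¬ (m + r = g) by omega]
    · rw [if_neg c2, if_neg c2]

/-- The part of the slot matrix that precedes entry `(r₀, g₀)` in lexicographic order. -/
def partSlots (m : ℕ) (N : ℤ) (X : ℕ → ℕ → ℤ) (v : ℕ → ℕ → ℕ) (r₀ g₀ r g : ℕ) : ℤ :=
  if r < r₀ ∨ (r = r₀ ∧ g < g₀) then slots m N X v r g else 0

theorem partSlots_self (m : ℕ) (N : ℤ) (X : ℕ → ℕ → ℤ) (v : ℕ → ℕ → ℕ) (r g g' : ℕ) (h : g ≤ g') :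
    partSlots m N X v r g r g' = 0 := by
  rw [partSlots, if_neg (by omega)]

theorem setEntry_partSlots (m : ℕ) (N : ℤ) (X : ℕ → ℕ → ℤ) (v : ℕ → ℕ → ℕ) (r g : ℕ) :
    setEntry (partSlots m N X v r g) r g (slots m N X v r g) = partSlots m N X v r (g + 1) := by
  funext a b
  unfold setEntry partSlots
  by_cases h : a = r ∧ b = g
  · rw [if_pos h, if_pos (by omega), h.1, h.2]
  · rw [if_neg h]
    exact if_congr (by omega) rfl rfl

theorem partSlots_succ (m : ℕ) (N : ℤ) (X : ℕ → ℕ → ℤ) (v : ℕ → ℕ → ℕ) {r r' g : ℕ} (hg : g < m) :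
    partSlots m N X v r m r' g = partSlots m N X v (r + 1) 0 r' g := by
  unfold partSlots
  exact if_congr (by omega) rfl rfl

/-- The memory holds `n`, `m`, `N`, `X`, `v` and the number of slots. -/
structure Holds (n m : ℕ) (N : ℤ) (X : ℕ → ℕ → ℤ) (v : ℕ → ℕ → ℕ) (s : State) : Prop where
  reg0 : s.reg 0 = n
  reg1 : s.reg 1 = m
  reg2 : s.reg 2 = N
  reg21 : s.reg 21 = (n * (2 * m) : ℕ)
  reg22 : s.reg 22 = 0
  arr0 : ∀ i < n, ∀ g < m, s.arr 0 i g = v i g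
  arr3 : ∀ i < n, ∀ g < m, s.arr 3 i g = X i g

theorem Holds.of_agree {n m : ℕ} {N : ℤ} {X : ℕ → ℕ → ℤ} {v : ℕ → ℕ → ℕ} {s s' : State}
    {R A : List ℕ} (h : Holds n m N X v s) (ag : Agree R A s s')
    (hR : 0 ∉ R ∧ 1 ∉ R ∧ 2 ∉ R ∧ 21 ∉ R ∧ 22 ∉ R := by decide)
    (hA : 0 ∉ A ∧ 3 ∉ A := by decide) : Holds n m N X v s' := by
  obtain ⟨r0, r1, r2, r21, r22⟩ := hR
  refine ⟨?_, ?_, ?_, ?_, ?_, ?_, ?_⟩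
  · rw [ag.reg _ r0, h.reg0]
  · rw [ag.reg _ r1, h.reg1]
  · rw [ag.reg _ r2, h.reg2]
  · rw [ag.reg _ r21, h.reg21]
  · rw [ag.reg _ r22, h.reg22]
  · rw [ag.arr _ hA.1]; exact h.arr0
  · rw [ag.arr _ hA.2]; exact h.arr3

/-- The rows of the slot matrix below `r` have been entered into the padded matrix in array `4`, and
their agents into array `5`. -/
structure RowsDone (n m : ℕ) (N : ℤ) (X : ℕ → ℕ → ℤ) (v : ℕ → ℕ → ℕ) (r : ℕ) (s : State) :
    Prop where
  reg10 : s.reg 10 = r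
  arr4 : ∀ a < n * (2 * m) + m, ∀ b < n * (2 * m) + m,
    s.arr 4 a b = pad (n * (2 * m)) m N (partSlots m N X v r 0) a b
  arr5 : ∀ q, s.arr 5 0 q = if q < r then ((q / (2 * m) + 1 : ℕ) : ℤ) else 0

theorem RowsDone.of_agree {n m r : ℕ} {N : ℤ} {X : ℕ → ℕ → ℤ} {v : ℕ → ℕ → ℕ} {s s' : State}
    {R A : List ℕ} (h : RowsDone n m N X v r s) (ag : Agree R A s s') (hR : 10 ∉ R := by decide)
    (hA : 4 ∉ A ∧ 5 ∉ A := by decide) : RowsDone n m N X v r s' := by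
  refine ⟨?_, ?_, ?_⟩
  · rw [ag.reg _ hR, h.reg10]
  · rw [ag.arr _ hA.1]; exact h.arr4
  · rw [ag.arr _ hA.2]; exact h.arr5

/-- Writes to register `16` the part of the value in register `12` that exceeds register `11`, but
at most the content of register `2`. -/
def levelCmd : Cmd :=
  .sub 16 12 11 ;; .ifPos 16 (.sub 17 16 2 ;; .ifPos 17 (.add 16 2 22) (.const 17 0)) (.const 16 0)

theorem wp_levelCmd {s : State} {N t : ℤ} {k : ℕ} (hN : 0 ≤ N) (h2 : s.reg 2 = N)
    (h11 : s.reg 11 = k * N) (h12 : s.reg 12 = t) (h22 : s.reg 22 = 0) :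
    Wp levelCmd s fun s' u => u ≤ 6 ∧ s'.reg 16 = level N k t := by
  simp [levelCmd, h2, h11, h12, h22, level]
  refine ⟨fun h => ⟨fun h' => ?_, fun h' => ?_⟩, fun h => ?_⟩
  · rw [min_eq_left (by linarith), max_eq_right hN]
  · rw [min_eq_right (by linarith), max_eq_right (by linarith)]
  · exact Or.inr h

/-- Adds the value of one good to register `12`. -/
def gainCmd : Cmd :=
  .load 14 0 3 7 ;; .load 15 3 3 7 ;; .ifPos 14 (.add 12 12 15) (.const 14 0)

/-- Enters one value slot of one agent for one good. -/
def cellCmd : Cmd :=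
  gainCmd ;; levelCmd ;; .sub 18 16 13 ;; .add 13 16 22 ;; putCmd 7

/-- Completes a row and passes to the next one. -/
def nextRowCmd : Cmd :=
  .const 19 1 ;; .add 23 3 19 ;; .store 5 22 10 23 ;; .add 10 10 19

/-- Enters one value slot of one agent. -/
def rowCmd : Cmd :=
  .const 12 0 ;; .const 13 0 ;; forCmd 7 1 8 cellCmd ;; nextRowCmd ;; .add 11 11 2

/-- Writes the share of an agent in one good to register `18`, or `0` if she values the good. -/
def shareCmd : Cmd :=
  .load 14 0 3 5 ;; .ifPos 14 (.const 18 0) (.load 18 3 3 5)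

/-- Enters the slot of an agent for one good that she does not value. -/
def restCmd : Cmd :=
  shareCmd ;; putCmd 5 ;; nextRowCmd

section

variable {n m : ℕ} {N : ℤ} {X : ℕ → ℕ → ℤ} {v : ℕ → ℕ → ℕ} {s : State} {i k : ℕ}

theorem slot_lt (hi : i < n) (hk : k < 2 * m) : i * (2 * m) + k < n * (2 * m) := by
  have := Nat.mul_le_mul_right (2 * m) (Nat.succ_le_of_lt hi)
  rw [Nat.succ_mul] at this
  omega

theorem slot_div (hk : k < 2 * m) : (i * (2 * m) + k) / (2 * m) = i := by
  rw [mul_comm, Nat.mul_add_div (by omega), Nat.div_eq_of_lt hk, add_zero]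

theorem slot_mod (hk : k < 2 * m) : (i * (2 * m) + k) % (2 * m) = k := by
  rw [mul_comm, Nat.mul_add_mod, Nat.mod_eq_of_lt hk]

/-- Register `12` carries the cumulative value and register `13` the previous level, so that the
slot entry is a difference of two numbers at hand. -/
theorem wp_cellCmd {g : ℕ} (hd : IsDivision n m N X v) (hi : i < n) (hk : k < m) (hg : g < m)
    (hs : Holds n m N X v s) (h3 : s.reg 3 = i) (h7 : s.reg 7 = g)
    (h10 : s.reg 10 = (i * (2 * m) + k : ℕ)) (h11 : s.reg 11 = k * N)
    (h12 : s.reg 12 = cum X v i g) (h13 : s.reg 13 = level N k (cum X v i g))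
    (h4 : ∀ a < n * (2 * m) + m, ∀ b < n * (2 * m) + m,
      s.arr 4 a b = pad (n * (2 * m)) m N (partSlots m N X v (i * (2 * m) + k) g) a b) :
    Wp cellCmd s fun s' t => t ≤ 22 ∧ s'.reg 12 = cum X v i (g + 1) ∧
      s'.reg 13 = level N k (cum X v i (g + 1)) ∧
      ∀ a < n * (2 * m) + m, ∀ b < n * (2 * m) + m, s'.arr 4 a b =
        pad (n * (2 * m)) m N (partSlots m N X v (i * (2 * m) + k) (g + 1)) a b := by
  have hfirst : Wp gainCmd s fun s' t => t ≤ 4 ∧ s'.reg 12 = cum X v i (g + 1) := by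
    simp [gainCmd, h3, h7, h12, hs.arr0 i hi g hg, hs.arr3 i hi g hg, cum_succ]
    rcases hd.binary i g with hv | hv <;> simp [hv]
  simp only [cellCmd, wp_seq]
  refine hfirst.mono ?_
  rintro s₁ t₁ ag₁ ⟨ht₁, e₁⟩
  have hs₁ : Holds n m N X v s₁ := hs.of_agree ag₁
  refine (wp_levelCmd hd.pos.le hs₁.reg2 (by rw [ag₁.reg 11 (by decide), h11]) e₁ hs₁.reg22).mono ?_
  rintro s₂ t₂ ag₂ ⟨ht₂, e₂⟩
  have hs₂ : Holds n m N X v s₂ := hs₁.of_agree ag₂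
  have e7 : s₂.reg 7 = g := by rw [ag₂.reg 7 (by decide), ag₁.reg 7 (by decide), h7]
  have e10 : s₂.reg 10 = (i * (2 * m) + k : ℕ) := by
    rw [ag₂.reg 10 (by decide), ag₁.reg 10 (by decide), h10]
  have e13 : s₂.reg 13 = level N k (cum X v i g) := by
    rw [ag₂.reg 13 (by decide), ag₁.reg 13 (by decide), h13]
  have e12 : s₂.reg 12 = cum X v i (g + 1) := by rw [ag₂.reg 12 (by decide), e₁]
  have a4 : s₂.arr 4 = s.arr 4 := by rw [ag₂.arr 4 (by decide), ag₁.arr 4 (by decide)]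
  simp only [wp_sub, wp_add]
  refine (wp_putCmd (x := 7) (N := N) (slot_lt hi (show k < 2 * m by omega)) hg
    (partSlots_self m N X v (i * (2 * m) + k) g g le_rfl) (by simp [hs₂.reg1]) (by simp [e10])
    (by simp [e7]) (by simp [hs₂.reg21]) (by simpa [a4] using h4) (by decide)).mono ?_
  rintro s₃ t₃ ag₃ ⟨ht₃, hZ⟩
  refine ⟨by omega, ?_, ?_, fun a ha b hb => ?_⟩
  · rw [ag₃.reg 12 (by decide)]; simp [e12]
  · rw [ag₃.reg 13 (by decide)]; simp [e₂, hs₂.reg22]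
  · rw [hZ a ha b hb, ← setEntry_partSlots]
    congr 2
    rw [slots, slot_div (by omega), slot_mod (by omega), if_pos hk]
    simp [e₂, e13]

theorem wp_nextRowCmd (hk : k < 2 * m) (hs : Holds n m N X v s) (h3 : s.reg 3 = i)
    (h10 : s.reg 10 = (i * (2 * m) + k : ℕ))
    (h4 : ∀ a < n * (2 * m) + m, ∀ b < n * (2 * m) + m,
      s.arr 4 a b = pad (n * (2 * m)) m N (partSlots m N X v (i * (2 * m) + k + 1) 0) a b)
    (h5 : ∀ q, s.arr 5 0 q = if q < i * (2 * m) + k then ((q / (2 * m) + 1 : ℕ) : ℤ) else 0) :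
    Wp nextRowCmd s fun s' t => t ≤ 4 ∧ RowsDone n m N X v (i * (2 * m) + k + 1) s' := by
  simp only [nextRowCmd, wp_seq, wp_const, wp_add, wp_store]
  refine ⟨by norm_num, ?_, ?_, ?_⟩
  · simp [h10]
  · simpa using h4
  · intro q
    have e : ((i : ℤ) * (2 * m) + k).toNat = i * (2 * m) + k := by
      have : ((i : ℤ) * (2 * m) + k) = ((i * (2 * m) + k : ℕ) : ℤ) := by push_cast; rfl
      rw [this, Int.toNat_natCast]
    simp [h3, h10, hs.reg22, e]
    by_cases hq : q = i * (2 * m) + k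
    · subst hq
      rw [if_pos rfl, if_pos (by omega)]
      have := slot_div (i := i) hk
      have e' : (((i * (2 * m) + k : ℕ) : ℤ) / (2 * m)) = i := by
        exact_mod_cast congrArg (Nat.cast : ℕ → ℤ) this
      rw [e']
    · rw [if_neg hq, h5]
      push_cast
      exact if_congr (by omega) rfl rfl

/-- The lower end `k * N` of the slot is kept in register `11` and moved on by adding `N`, so no
multiplication is needed. -/
theorem wp_rowCmd (hd : IsDivision n m N X v) (hi : i < n) (hk : k < m) (hs : Holds n m N X v s)
    (h3 : s.reg 3 = i) (h11 : s.reg 11 = k * N) (hR : RowsDone n m N X v (i * (2 * m) + k) s) :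
    Wp rowCmd s fun s' t => t ≤ m * 26 + 10 ∧ s'.reg 11 = (k + 1 : ℕ) * N ∧
      RowsDone n m N X v (i * (2 * m) + (k + 1)) s' := by
  have hs' : Holds n m N X v ((s.setReg 12 0).setReg 13 0) :=
    hs.of_agree (R := [12, 13]) (A := []) ⟨fun x hx => by simp_all, fun _ _ => rfl⟩
  simp only [rowCmd, wp_seq, wp_const]
  refine (Wp.forCmd (N := m) (T := 22) (fun g s' => s'.reg 12 = cum X v i g ∧
    s'.reg 13 = level N k (cum X v i g) ∧
    ∀ a < n * (2 * m) + m, ∀ b < n * (2 * m) + m,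
      s'.arr 4 a b = pad (n * (2 * m)) m N (partSlots m N X v (i * (2 * m) + k) g) a b)
    (by simp [hs.reg1]) ?_ ?_).mono ?_
  · simp only [State.setReg_reg, State.setReg_arr]
    simp [cum, level_zero hd.pos.le]
    exact hR.arr4
  · rintro g hg s₁ ag₁ h7 - ⟨h12, h13, h4⟩
    refine (wp_cellCmd hd hi hk hg ?_ ?_ h7 ?_ ?_ h12 h13 h4).mono ?_
    · exact hs'.of_agree ag₁
    · rw [ag₁.reg 3 (by decide)]; simp [h3]
    · rw [ag₁.reg 10 (by decide)]; simp [hR.reg10]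
    · rw [ag₁.reg 11 (by decide)]; simp [h11]
    · rintro s₂ t - ⟨ht, h⟩
      exact ⟨ht, h⟩
  · rintro s₁ t₁ ag₁ ⟨ht₁, -, -, h4⟩
    have hs₁ : Holds n m N X v s₁ := hs'.of_agree ag₁
    refine (wp_nextRowCmd (i := i) (show k < 2 * m by omega) hs₁ ?_ ?_ ?_ ?_).mono ?_
    · rw [ag₁.reg 3 (by decide)]; simp [h3]
    · rw [ag₁.reg 10 (by decide)]; simp [hR.reg10]
    · intro a ha b hb
      rw [h4 a ha b hb]
      exact pad_congr (fun r _ g hg => partSlots_succ m N X v hg) ha hb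
    · rw [ag₁.arr 5 (by decide)]; exact hR.arr5
    · rintro s₂ t₂ ag₂ ⟨ht₂, hR₂⟩
      rw [wp_add]
      refine ⟨by omega, ?_, ?_⟩
      · simp [ag₂.reg 11, ag₂.reg 2, Cmd.regs, nextRowCmd, hs₁.reg2]
        rw [ag₁.reg 11 (by decide)]
        simp [h11]
        ring
      · exact hR₂.of_agree (R := [11]) (A := []) ⟨fun x hx => by simp_all, fun _ _ => rfl⟩

theorem wp_restCmd (hd : IsDivision n m N X v) (hi : i < n) (hk : k < m) (hs : Holds n m N X v s)
    (h3 : s.reg 3 = i) (h5 : s.reg 5 = k) (hR : RowsDone n m N X v (i * (2 * m) + (m + k)) s) :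
    Wp restCmd s fun s' t => t ≤ 17 ∧ RowsDone n m N X v (i * (2 * m) + (m + (k + 1))) s' := by
  have hslot : ∀ g, slots m N X v (i * (2 * m) + (m + k)) g =
      if g = k then X i k * (1 - v i k) else 0 := by
    intro g
    rw [slots, slot_div (by omega), slot_mod (by omega), if_neg (by omega)]
    by_cases h : g = k
    · subst h; simp
    · rw [if_neg (by omega), if_neg h]
  have hfirst : Wp shareCmd s fun s' t => t ≤ 3 ∧ s'.reg 18 =
      slots m N X v (i * (2 * m) + (m + k)) k := by
    simp [shareCmd, h3, h5, hs.arr0 i hi k hk, hs.arr3 i hi k hk, hslot]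
    rcases hd.binary i k with hv | hv <;> simp [hv]
  simp only [restCmd, wp_seq]
  refine hfirst.mono ?_
  rintro s₁ t₁ ag₁ ⟨ht₁, h18⟩
  have hs₁ : Holds n m N X v s₁ := hs.of_agree ag₁
  refine (wp_putCmd (x := 5) (N := N) (slot_lt hi (show m + k < 2 * m by omega)) hk
    (partSlots_self m N X v (i * (2 * m) + (m + k)) 0 k (Nat.zero_le _)) hs₁.reg1
    ((ag₁.reg 10 (by decide)).trans hR.reg10) ((ag₁.reg 5 (by decide)).trans h5) hs₁.reg21
    (by rw [ag₁.arr 4 (by decide)]; exact hR.arr4) (by decide)).mono ?_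
  rintro s₂ t₂ ag₂ ⟨ht₂, hZ⟩
  have hs₂ : Holds n m N X v s₂ := hs₁.of_agree ag₂
  refine (wp_nextRowCmd (i := i) (show m + k < 2 * m by omega) hs₂ ?_ ?_ ?_ ?_).mono ?_
  · rw [ag₂.reg 3 (by decide), ag₁.reg 3 (by decide), h3]
  · rw [ag₂.reg 10 (by decide), ag₁.reg 10 (by decide), hR.reg10]
  · intro a ha b hb
    rw [hZ a ha b hb]
    refine pad_congr (fun r _ g hg => ?_) ha hb
    rw [h18]
    unfold setEntry partSlots
    by_cases h : r = i * (2 * m) + (m + k) ∧ g = k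
    · rw [if_pos h, if_pos (by omega), h.1, h.2]
    · rw [if_neg h]
      by_cases h' : r = i * (2 * m) + (m + k)
      · rw [if_neg (by omega), if_pos (by omega), h', hslot, if_neg (by omega)]
      · exact if_congr (by omega) rfl rfl
  · rw [ag₂.arr 5 (by decide), ag₁.arr 5 (by decide)]; exact hR.arr5
  · rintro s₃ t₃ - ⟨ht₃, hR₃⟩
    exact ⟨by omega, hR₃⟩

end

/-- Writes the padded slot matrix to array `4`, its order to register `20`, and the agents of the
slots to array `5`. -/
def buildCmd : Cmd :=
  .const 22 0 ;; .const 21 0 ;; forCmd 3 0 4 (.add 21 21 1 ;; .add 21 21 1) ;; .add 20 21 1 ;;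
  forCmd 7 21 8 (.add 9 1 7 ;; .store 4 7 9 2) ;; forCmd 7 1 8 (.add 9 21 7 ;; .store 4 9 7 2) ;;
  .const 10 0 ;;
  forCmd 3 0 4 (.const 11 0 ;; forCmd 5 1 6 rowCmd ;; forCmd 5 1 6 restCmd)

section Build

variable {n m : ℕ} {N : ℤ} {X : ℕ → ℕ → ℤ} {v : ℕ → ℕ → ℕ} {s : State}

theorem wp_buildCmd (hd : IsDivision n m N X v) (h0 : s.reg 0 = n) (h1 : s.reg 1 = m)
    (h2 : s.reg 2 = N) (ha0 : ∀ i < n, ∀ g < m, s.arr 0 i g = v i g)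
    (ha3 : ∀ i < n, ∀ g < m, s.arr 3 i g = X i g) (ha4 : s.arr 4 = fun _ _ => 0)
    (ha5 : s.arr 5 = fun _ _ => 0) :
    Wp buildCmd s fun s' t =>
      t ≤ n * 6 + n * (2 * m) * 6 + m * 6 + n * (m * (m * 26 + 14) + m * 21 + 11) + 16 ∧
      s'.reg 20 = (n * (2 * m) + m : ℕ) ∧ s'.reg 22 = 0 ∧
      (∀ a < n * (2 * m) + m, ∀ b < n * (2 * m) + m, s'.arr 4 a b = slotMatrix n m N X v a b) ∧
      ∀ q, s'.arr 5 0 q = if q < n * (2 * m) then ((q / (2 * m) + 1 : ℕ) : ℤ) else 0 := by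
  simp only [buildCmd, wp_seq, wp_const]
  refine (Wp.forCmd (N := n) (T := 2) (fun k s' => s'.reg 21 = (k * (2 * m) : ℕ)) (by simp [h0])
    (by simp) ?_).mono ?_
  · intro k _ s₁ ag₁ _ _ h
    have : s₁.reg 1 = m := by rw [ag₁.reg 1 (by decide)]; simp [h1]
    simp only [wp_seq, wp_add]
    refine ⟨le_rfl, ?_⟩
    simp [h, this]
    ring
  rintro s₁ t₁ ag₁ ⟨ht₁, h21⟩
  have r0 : s₁.reg 0 = n := by rw [ag₁.reg 0 (by decide)]; simp [h0]
  have r1 : s₁.reg 1 = m := by rw [ag₁.reg 1 (by decide)]; simp [h1]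
  have r2 : s₁.reg 2 = N := by rw [ag₁.reg 2 (by decide)]; simp [h2]
  have r22 : s₁.reg 22 = 0 := by rw [ag₁.reg 22 (by decide)]; simp
  have ag₁' : Agree [21, 22, 3, 4] [] s s₁ := by
    refine Agree.trans (s' := (s.setReg 22 0).setReg 21 0)
      ⟨fun x hx => by simp_all, fun _ _ => rfl⟩ (ag₁.mono (by decide) (by decide))
  rw [wp_add]
  have hs₂ : Holds n m N X v (s₁.setReg 20 (s₁.reg 21 + s₁.reg 1)) := by
    refine ⟨by simp [r0], by simp [r1], by simp [r2], by simp [h21], by simp [r22], ?_, ?_⟩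
    · simpa [ag₁'.arr] using ha0
    · simpa [ag₁'.arr] using ha3
  have e20 : (s₁.setReg 20 (s₁.reg 21 + s₁.reg 1)).reg 20 = (n * (2 * m) + m : ℕ) := by
    simp [h21, r1]
  have e4 : (s₁.setReg 20 (s₁.reg 21 + s₁.reg 1)).arr 4 = fun _ _ => 0 := by
    simp [ag₁'.arr, ha4]
  have e5 : (s₁.setReg 20 (s₁.reg 21 + s₁.reg 1)).arr 5 = fun _ _ => 0 := by
    simp [ag₁'.arr, ha5]
  generalize s₁.setReg 20 (s₁.reg 21 + s₁.reg 1) = s₂ at hs₂ e20 e4 e5 ⊢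
  -- The padding of the zero matrix has `N` on the two completing diagonals and `0` elsewhere. This
  -- loop and the next one write it as the starting point for the insertion of entries.
  refine (Wp.forCmd (N := n * (2 * m)) (T := 2) (fun k s' => ∀ a b,
    s'.arr 4 a b = if a < k ∧ b = m + a then N else 0) hs₂.reg21 (by simp [e4]) ?_).mono ?_
  · intro k _ s₃ ag₃ h7 _ h
    have hs₃ : Holds n m N X v s₃ := hs₂.of_agree ag₃
    have e : ((m : ℤ) + k).toNat = m + k := by omega
    simp only [wp_seq, wp_add, wp_store]
    refine ⟨le_rfl, fun a b => ?_⟩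
    simp only [State.setArr_arr_self, State.setReg_reg, State.setReg_arr, h7, hs₃.reg1, hs₃.reg2]
    norm_num [e]
    by_cases hab : a = k ∧ b = m + k
    · rw [if_pos hab, if_pos (by omega)]
    · rw [if_neg hab, h]
      exact if_congr (by omega) rfl rfl
  rintro s₃ t₃ ag₃ ⟨ht₃, h4⟩
  have hs₃ : Holds n m N X v s₃ := hs₂.of_agree ag₃
  refine (Wp.forCmd (N := m) (T := 2) (fun k s' => ∀ a b,
    s'.arr 4 a b = if (a < n * (2 * m) ∧ b = m + a) ∨ (b < k ∧ a = n * (2 * m) + b) then N else 0)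
    hs₃.reg1 (by simpa using h4) ?_).mono ?_
  · intro k _ s₄ ag₄ h7 _ h
    have hs₄ : Holds n m N X v s₄ := hs₃.of_agree ag₄
    have e : (((n * (2 * m) : ℕ) : ℤ) + k).toNat = n * (2 * m) + k := by omega
    simp only [wp_seq, wp_add, wp_store]
    refine ⟨le_rfl, fun a b => ?_⟩
    simp only [State.setArr_arr_self, State.setReg_reg, State.setReg_arr, h7, hs₄.reg21, hs₄.reg2]
    simp only [if_true, Nat.reduceEqDiff, if_false, e, Int.toNat_natCast]
    by_cases hab : a = n * (2 * m) + k ∧ b = k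
    · rw [if_pos hab, if_pos (by omega)]
    · rw [if_neg hab, h]
      exact if_congr (by omega) rfl rfl
  rintro s₄ t₄ ag₄ ⟨ht₄, h4'⟩
  have hs₄ : Holds n m N X v (s₄.setReg 10 0) := (hs₃.of_agree ag₄).of_agree (R := [10]) (A := [])
    ⟨fun x hx => by simp_all, fun _ _ => rfl⟩
  have hR : RowsDone n m N X v (0 * (2 * m)) (s₄.setReg 10 0) := by
    refine ⟨by simp, fun a ha b hb => ?_, fun q => ?_⟩
    · rw [State.setReg_arr, h4']
      simp only [pad, partSlots, Nat.zero_mul, Nat.not_lt_zero, and_false, or_false, if_false,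
        Finset.sum_const_zero, sub_zero]
      split_ifs <;> first | rfl | omega
    · rw [State.setReg_arr, ag₄.arr 5 (by decide), ag₃.arr 5 (by decide), e5]
      simp
  refine (Wp.forCmd (N := n) (T := m * (m * 26 + 14) + m * 21 + 7)
    (fun i s' => RowsDone n m N X v (i * (2 * m)) s') hs₄.reg0 hR ?_
    (fun _ _ _ ag h => h.of_agree ag)).mono ?_
  · intro i hi s₅ ag₅ h3 _ hR₅
    have hs₅ : Holds n m N X v (s₅.setReg 11 0) := (hs₄.of_agree ag₅).of_agree (R := [11])
      (A := []) ⟨fun x hx => by simp_all, fun _ _ => rfl⟩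
    simp only [wp_seq, wp_const]
    refine (Wp.forCmd (N := m) (T := m * 26 + 10) (fun k s' => s'.reg 11 = k * N ∧
      RowsDone n m N X v (i * (2 * m) + k) s') hs₅.reg1 ?_ ?_ ?_).mono ?_
    · exact ⟨by simp, hR₅.of_agree (R := [11]) (A := [])
        ⟨fun x hx => by simp_all, fun _ _ => rfl⟩⟩
    · rintro k hk s₆ ag₆ - - ⟨h11, hR₆⟩
      have e3 : s₆.reg 3 = i := by rw [ag₆.reg 3 (by decide)]; simp [h3]
      exact wp_rowCmd hd hi hk (hs₅.of_agree ag₆) e3 h11 hR₆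
    · rintro k s' s'' ag ⟨h, h'⟩
      exact ⟨by rw [ag.reg 11 (by decide), h], h'.of_agree ag⟩
    · rintro s₆ t₆ ag₆ ⟨ht₆, -, hR₆⟩
      have hs₆ : Holds n m N X v s₆ := hs₅.of_agree ag₆
      refine (Wp.forCmd (N := m) (T := 17) (fun k s' => RowsDone n m N X v (i * (2 * m) + (m + k))
        s') hs₆.reg1 hR₆ ?_ (fun _ _ _ ag h => h.of_agree ag)).mono ?_
      · intro k hk s₇ ag₇ h5 _ hR₇
        refine wp_restCmd hd hi hk (hs₆.of_agree ag₇) ?_ h5 hR₇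
        rw [ag₇.reg 3 (by decide), ag₆.reg 3 (by decide)]
        simp [h3]
      · rintro s₇ t₇ - ⟨ht₇, hR₇⟩
        have e : (i + 1) * (2 * m) = i * (2 * m) + (m + m) := by ring
        rw [e]
        refine ⟨?_, hR₇⟩
        have e' : m * (m * 26 + 10 + 4) = m * (m * 26 + 14) := rfl
        omega
  rintro s₅ t₅ ag₅ ⟨ht₅, hR₅⟩
  have hs₅ : Holds n m N X v s₅ := hs₄.of_agree ag₅
  refine ⟨?_, ?_, hs₅.reg22, fun a ha b hb => ?_, hR₅.arr5⟩
  · have e' : n * (m * (m * 26 + 14) + m * 21 + 7 + 4) =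
      n * (m * (m * 26 + 14) + m * 21 + 11) := rfl
    omega
  · rw [ag₅.reg 20 (by decide)]
    simp only [State.setReg_reg]
    rw [if_neg (by decide), ag₄.reg 20 (by decide), ag₃.reg 20 (by decide), e20]
  · rw [hR₅.arr4 a ha b hb]
    exact pad_congr (fun r hr g _ => by rw [partSlots, if_pos (Or.inl hr)]) ha hb

end Build

/-! ### Finding a perfect matching -/

/-- Finds the cheapest column in the support of the row in register `30` of array `4`: writes the
column to register `31` and its price to register `32`. -/
def scanCmd : Cmd :=
  .const 31 0 ;; .add 32 20 22 ;;
  forCmd 33 20 34 (.load 35 4 30 33 ;; .ifPos 35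
    (.load 36 7 22 33 ;; .sub 37 32 36 ;;
      .ifPos 37 (.add 31 33 22 ;; .add 32 36 22) (.const 37 0))
    (.const 37 0))

/-- One bid of the row in register `28`; the previous holder of the column is the next bidder. -/
def bidCmd : Cmd :=
  .const 38 1 ;; .sub 30 28 38 ;; scanCmd ;; .add 32 32 38 ;; .load 35 6 22 31 ;;
  .store 6 22 31 28 ;; .store 7 22 31 32 ;; .add 28 35 22

/-- Writes a perfect matching in the support of array `4` to array `6`. -/
def matchCmd : Cmd :=
  forCmd 33 20 34 (.store 6 22 33 22 ;; .store 7 22 33 22) ;;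
  forCmd 39 20 40 (.const 38 1 ;; .add 28 39 38 ;; .whilePos 28 bidCmd)

section Matching

variable {K : ℕ} {Z : ℕ → ℕ → ℤ} {s : State}

theorem wp_scanCmd {q : ℕ} {price : ℕ → ℕ} (hq : q < K) (h20 : s.reg 20 = K) (h22 : s.reg 22 = 0)
    (h30 : s.reg 30 = q) (h4 : ∀ a < K, ∀ b < K, s.arr 4 a b = Z a b)
    (h7 : ∀ c < K, s.arr 7 0 c = price c) (hex : ∃ c < K, 0 < Z q c ∧ price c < K) :
    Wp scanCmd s fun s' t => t ≤ K * 11 + 5 ∧ ∃ b < K, s'.reg 31 = b ∧ s'.reg 32 = price b ∧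
      0 < Z q b ∧ price b < K ∧ ∀ c < K, 0 < Z q c → price b ≤ price c := by
  simp only [scanCmd, wp_seq, wp_const, wp_add]
  -- The initial price `K` plays the role of infinity: until register `32` falls below it, no column
  -- of the support below `K` has been seen.
  refine (Wp.forCmd (N := K) (T := 7) (fun j s' =>
    (s'.reg 32 = K ∧ ∀ c < j, 0 < Z q c → K ≤ price c) ∨
    ∃ b < K, s'.reg 31 = b ∧ s'.reg 32 = price b ∧ 0 < Z q b ∧ price b < K ∧
      ∀ c < j, 0 < Z q c → price b ≤ price c) (by simp [h20]) ?_ ?_).mono ?_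
  · left; simp [h20, h22]
  · intro j hj s₁ ag₁ h33 _ hI
    have e22 : s₁.reg 22 = 0 := by rw [ag₁.reg 22 (by decide)]; simp [h22]
    have e30 : s₁.reg 30 = q := by rw [ag₁.reg 30 (by decide)]; simp [h30]
    have e4 : s₁.arr 4 q j = Z q j := by rw [ag₁.arr 4 (by decide)]; simp [h4 q hq j hj]
    have e7 : s₁.arr 7 0 j = price j := by rw [ag₁.arr 7 (by decide)]; simp [h7 j hj]
    simp only [wp_seq, wp_load, wp_ifPos, wp_sub, wp_add, wp_const, State.setReg_reg,
      State.setReg_arr, Nat.reduceEqDiff, if_true, if_false, h33, e22, e30, e4, e7,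
        Int.toNat_natCast,
      Int.toNat_zero, add_zero]
    refine ⟨fun hz => ⟨fun hp => ⟨by norm_num, ?_⟩, fun hp => ⟨by norm_num, ?_⟩⟩,
      fun hz => ⟨by norm_num, ?_⟩⟩
    · right
      rcases hI with ⟨h32, hI⟩ | ⟨b, hb, h31, h32, hzb, hpb, hI⟩
      · refine ⟨j, hj, by simp, by simp, hz, by omega, fun c hc hzc => ?_⟩
        rcases Nat.lt_succ_iff_lt_or_eq.mp hc with h | rfl
        · have := hI c h hzc; omega
        · exact le_rfl
      · refine ⟨j, hj, by simp, by simp, hz, by omega, fun c hc hzc => ?_⟩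
        rcases Nat.lt_succ_iff_lt_or_eq.mp hc with h | rfl
        · have := hI c h hzc; omega
        · exact le_rfl
    · rcases hI with ⟨h32, hI⟩ | ⟨b, hb, h31, h32, hzb, hpb, hI⟩
      · refine Or.inl ⟨by simpa using h32, fun c hc hzc => ?_⟩
        rcases Nat.lt_succ_iff_lt_or_eq.mp hc with h | rfl
        · exact hI c h hzc
        · omega
      · refine Or.inr ⟨b, hb, by simpa using h31, by simpa using h32, hzb, hpb, fun c hc hzc => ?_⟩
        rcases Nat.lt_succ_iff_lt_or_eq.mp hc with h | rfl
        · exact hI c h hzc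
        · omega
    · rcases hI with ⟨h32, hI⟩ | ⟨b, hb, h31, h32, hzb, hpb, hI⟩
      · refine Or.inl ⟨by simpa using h32, fun c hc hzc => ?_⟩
        rcases Nat.lt_succ_iff_lt_or_eq.mp hc with h | rfl
        · exact hI c h hzc
        · exact absurd hzc hz
      · refine Or.inr ⟨b, hb, by simpa using h31, by simpa using h32, hzb, hpb, fun c hc hzc => ?_⟩
        rcases Nat.lt_succ_iff_lt_or_eq.mp hc with h | rfl
        · exact hI c h hzc
        · exact absurd hzc hz
  · rintro s' t - ⟨ht, hI⟩
    refine ⟨by omega, ?_⟩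
    rcases hI with ⟨-, hI⟩ | h
    · obtain ⟨c, hc, hz, hp⟩ := hex
      have := hI c hc hz
      omega
    · exact h

/-- The memory holds a state of the auction in arrays `6` and `7`, with at most `b` bids left. -/
def HoldsAuction (K : ℕ) (Z : ℕ → ℕ → ℤ) (cur done b : ℕ) (s : State) : Prop :=
  ∃ own price : ℕ → ℕ, (∀ c < K, s.arr 6 0 c = own c) ∧ (∀ c < K, s.arr 7 0 c = price c) ∧
    b = slackSum K price ∧ AuctionInv K Z own price cur done

theorem wp_bidCmd {N : ℤ} {cur done b : ℕ} (hs : HasSums K N Z) (hN : 0 < N) (h20 : s.reg 20 = K)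
    (h22 : s.reg 22 = 0) (h28 : s.reg 28 = cur) (hcur : 0 < cur) (hd : done ≤ K)
    (h4 : ∀ a < K, ∀ b < K, s.arr 4 a b = Z a b) (h : HoldsAuction K Z cur done b s) :
    Wp bidCmd s fun s' t => t ≤ K * 11 + 12 ∧ ∃ cur' : ℕ, s'.reg 28 = cur' ∧
      ∃ b' < b, HoldsAuction K Z cur' done b' s' := by
  obtain ⟨own, price, h6, h7, rfl, hinv⟩ := h
  obtain ⟨q, rfl⟩ := Nat.exists_eq_succ_of_ne_zero hcur.ne'
  have hq : q < K := by have := hinv.cur_le; omega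
  simp only [bidCmd, wp_seq, wp_const, wp_sub]
  refine (wp_scanCmd (q := q) (price := price) (Z := Z) (K := K) hq (by simp [h20]) (by simp [h22])
    (by simp [h28]) (by simpa using h4) (by simpa using h7)
    (hinv.exists_price_lt hs hN hd rfl)).mono ?_
  rintro s₁ t₁ ag₁ ⟨ht₁, c, hc, h31, h32, hz, hp, hmin⟩
  have e22 : s₁.reg 22 = 0 := by rw [ag₁.reg 22 (by decide)]; simp [h22]
  have e28 : s₁.reg 28 = (q + 1 : ℕ) := by rw [ag₁.reg 28 (by decide)]; simp [h28]
  have e38 : s₁.reg 38 = 1 := by rw [ag₁.reg 38 (by decide)]; simp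
  have e6 : s₁.arr 6 = s.arr 6 := by rw [ag₁.arr 6 (by decide)]; simp
  have e7 : s₁.arr 7 = s.arr 7 := by rw [ag₁.arr 7 (by decide)]; simp
  simp only [wp_add, wp_load, wp_store]
  refine ⟨by omega, own c, by simp [e22, h31, e6, h6 c hc], _,
    slackSum_update_lt hc hp, Function.update own c (q + 1),
    Function.update price c (price c + 1), fun d hd => ?_, fun d hd => ?_, rfl,
    hinv.step rfl hc hz hmin hp⟩
  · by_cases hdc : d = c
    · subst hdc; simp [e22, h31, e28]
    · simp [e22, h31, hdc, e6, h6 d hd]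
  · by_cases hdc : d = c
    · subst hdc; simp [e22, h31, h32, e38]
    · simp [e22, h31, hdc, e7, h7 d hd]

/-- Rows enter the auction one at a time, with prices kept. A chain of bids ends because each bid
lowers `slackSum`, which is at most `K * K`; using this bound afresh for each row is enough. -/
theorem wp_matchCmd {N : ℤ} (hs : HasSums K N Z) (hN : 0 < N) (h20 : s.reg 20 = K)
    (h22 : s.reg 22 = 0) (h4 : ∀ a < K, ∀ b < K, s.arr 4 a b = Z a b) :
    Wp matchCmd s fun s' t => t ≤ K * 6 + K * (K * K * (K * 11 + 13) + 7) + 6 ∧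
      ∃ σ : ℕ → ℕ, (∀ c < K, s'.arr 6 0 c = (σ c : ℤ) + 1) ∧ IsMatching K Z σ := by
  simp only [matchCmd, wp_seq]
  refine (Wp.forCmd (N := K) (T := 2) (fun k s' => (∀ c < k, s'.arr 6 0 c = 0) ∧
    ∀ c < k, s'.arr 7 0 c = 0) h20 (by simp) ?_).mono ?_
  · rintro k _ s₁ ag₁ h33 - ⟨h6, h7⟩
    have e22 : s₁.reg 22 = 0 := by rw [ag₁.reg 22 (by decide), h22]
    simp only [wp_seq, wp_store]
    refine ⟨le_rfl, fun c hc => ?_, fun c hc => ?_⟩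
    · by_cases hck : c = k
      · simp [e22, h33, hck]
      · simp [e22, h33, hck, h6 c (by omega)]
    · by_cases hck : c = k
      · simp [e22, h33, hck]
      · simp [e22, h33, hck, h7 c (by omega)]
  rintro s₁ t₁ ag₁ ⟨ht₁, h6, h7⟩
  have e20 : s₁.reg 20 = K := by rw [ag₁.reg 20 (by decide), h20]
  refine (Wp.forCmd (N := K) (T := K * K * (K * 11 + 13) + 3) (fun r s' => ∃ b,
    HoldsAuction K Z 0 r b s') e20 ?_ ?_ ?_).mono ?_
  · exact ⟨_, fun _ => 0, fun _ => 0, by simpa using h6, by simpa using h7, rfl,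
      AuctionInv.of_eq_zero (fun _ _ => rfl) fun _ _ => rfl⟩
  · rintro r hr s₂ ag₂ h39 - ⟨b, own, price, h6, h7, hb, hinv⟩
    have hag : Agree (39 :: 40 :: matchCmd.regs) matchCmd.arrs s s₂ :=
      (ag₁.mono (by decide) (by decide)).trans (ag₂.mono (by decide) (by decide))
    have hbK : b ≤ K * K := hb ▸ slackSum_le K price
    simp only [wp_seq, wp_const, wp_add]
    refine (Wp.whilePos (T := K * 11 + 12) (b := b) (fun b s' => ∃ cur : ℕ, s'.reg 28 = cur ∧
      HoldsAuction K Z cur (r + 1) b s') ?_ ?_).mono ?_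
    · exact ⟨r + 1, by simp [h39], own, price, by simpa using h6, by simpa using h7, hb, hinv.start⟩
    · rintro b' s₃ ag₃ hpos ⟨cur, h28, hA⟩
      refine (wp_bidCmd hs hN ?_ ?_ h28 (by rw [h28] at hpos; exact_mod_cast hpos) hr ?_ hA).mono ?_
      · rw [ag₃.reg 20 (by decide)]; simp [hag.reg 20, show 20 ∉ matchCmd.regs by decide, h20]
      · rw [ag₃.reg 22 (by decide)]; simp [hag.reg 22, show 22 ∉ matchCmd.regs by decide, h22]
      · rw [ag₃.arr 4 (by decide)]; simpa [hag.arr 4, show 4 ∉ matchCmd.arrs by decide] using h4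
      · rintro s₄ t₄ - ⟨ht₄, cur', h28', b'', hb'', hA'⟩
        exact ⟨ht₄, b'', hb'', cur', h28', hA'⟩
    · rintro s₃ t₃ - ⟨ht₃, ⟨b', cur, h28, hA⟩, hx⟩
      obtain rfl : cur = 0 := by rw [h28] at hx; omega
      refine ⟨?_, b', hA⟩
      have := Nat.mul_le_mul_right (K * 11 + 12 + 1) hbK
      have e : K * K * (K * 11 + 12 + 1) = K * K * (K * 11 + 13) := rfl
      omega
  · rintro k s' s'' ag ⟨b, own, price, h6, h7, h⟩
    exact ⟨b, own, price, by rwa [ag.arr 6 (by decide)], by rwa [ag.arr 7 (by decide)], h⟩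
  · rintro s₂ t₂ - ⟨ht₂, b, own, price, h6, -, -, hinv⟩
    refine ⟨?_, fun c => own c - 1, fun c hc => ?_, hinv.isMatching⟩
    · have e : K * (K * K * (K * 11 + 13) + 3 + 4) = K * (K * K * (K * 11 + 13) + 7) := rfl
      omega
    · rw [h6 c hc]
      have := hinv.own_ne_zero hc
      change (own c : ℤ) = ((own c - 1 : ℕ) : ℤ) + 1
      omega

end Matching

/-! ### Decomposing the padded matrix -/

/-- Writes to register `41` the largest weight that can be subtracted along the matching in
array `6`. -/
def weightCmd : Cmd :=
  .const 38 1 ;; .add 41 26 22 ;;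
  forCmd 33 20 34 (.load 30 6 22 33 ;; .sub 30 30 38 ;; .load 35 4 30 33 ;; .sub 37 41 35 ;;
    .ifPos 37 (.add 41 35 22) (.const 37 0))

/-- Subtracts the weight in register `41` along the matching in array `6`. -/
def subtractCmd : Cmd :=
  forCmd 33 20 34 (.load 30 6 22 33 ;; .sub 30 30 38 ;; .load 35 4 30 33 ;; .sub 35 35 41 ;;
    .store 4 30 33 35)

/-- Appends the allocation of the matching in array `6`, with the weight in register `41`, to the
output. -/
def outputCmd : Cmd :=
  .store 0 27 22 41 ;; .store 1 27 22 2 ;;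
  forCmd 33 1 34 (.load 30 6 22 33 ;; .sub 30 30 38 ;; .load 35 5 22 30 ;; .store 2 27 33 35) ;;
  .add 27 27 38 ;; .sub 26 26 41

/-- One round of the decomposition. -/
def roundCmd : Cmd := matchCmd ;; weightCmd ;; subtractCmd ;; outputCmd

/-- Decomposes the matrix in array `4`. -/
def decomposeCmd : Cmd := .const 27 0 ;; .add 26 2 22 ;; .whilePos 26 roundCmd ;; .add 0 27 22

section

variable {K m : ℕ} {Z : ℕ → ℕ → ℤ} {σ : ℕ → ℕ} {s : State}

/-- The weight is the minimum of `rem` and the matched entries. Starting from `rem` also covers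
order `0`, where there are no entries and a single round removes everything. -/
theorem wp_weightCmd {rem : ℤ} (hσ : IsMatching K Z σ) (hrem : 0 < rem) (h20 : s.reg 20 = K)
    (h22 : s.reg 22 = 0) (h26 : s.reg 26 = rem) (h4 : ∀ a < K, ∀ b < K, s.arr 4 a b = Z a b)
    (h6 : ∀ c < K, s.arr 6 0 c = (σ c : ℤ) + 1) :
    Wp weightCmd s fun s' t => t ≤ K * 10 + 5 ∧ s'.reg 38 = 1 ∧ 0 < s'.reg 41 ∧
      s'.reg 41 ≤ rem ∧ (∀ c < K, s'.reg 41 ≤ Z (σ c) c) ∧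
      (s'.reg 41 = rem ∨ ∃ c < K, s'.reg 41 = Z (σ c) c) := by
  simp only [weightCmd, wp_seq, wp_const, wp_add]
  refine (Wp.forCmd (N := K) (T := 6) (fun j s' => s'.reg 38 = 1 ∧ 0 < s'.reg 41 ∧
      s'.reg 41 ≤ rem ∧ (∀ c < j, s'.reg 41 ≤ Z (σ c) c) ∧
      (s'.reg 41 = rem ∨ ∃ c < K, s'.reg 41 = Z (σ c) c)) (by simp [h20])
      (by simp [h22, h26, hrem]) ?_).mono ?_
  · rintro j hj s₁ ag₁ h33 - ⟨h38, hpos, hle, hall, hor⟩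
    have e22 : s₁.reg 22 = 0 := by rw [ag₁.reg 22 (by decide)]; simp [h22]
    have e6 : s₁.arr 6 0 j = (σ j : ℤ) + 1 := by rw [ag₁.arr 6 (by decide)]; simp [h6 j hj]
    have e4 : s₁.arr 4 (σ j) j = Z (σ j) j := by
      rw [ag₁.arr 4 (by decide)]; simp [h4 _ (hσ.lt j hj) j hj]
    simp [e22, h33, e6, h38, e4]
    refine ⟨fun hlt => ⟨hσ.pos j hj, by linarith, fun c hc => ?_, Or.inr ⟨j, hj, rfl⟩⟩,
      fun hlt => ⟨hpos, hle, fun c hc => ?_, hor⟩⟩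
    · rcases Nat.lt_or_eq_of_le hc with h | rfl
      · linarith [hall c h]
      · exact le_rfl
    · rcases Nat.lt_or_eq_of_le hc with h | rfl
      · exact hall c h
      · exact hlt
  · rintro s' t - ⟨ht, h⟩
    exact ⟨by omega, h⟩

theorem wp_subtractCmd (h20 : s.reg 20 = K) (h22 : s.reg 22 = 0)
    (h38 : s.reg 38 = 1) (h4 : ∀ a < K, ∀ b < K, s.arr 4 a b = Z a b)
    (h6 : ∀ c < K, s.arr 6 0 c = (σ c : ℤ) + 1) :
    Wp subtractCmd s fun s' t => t ≤ K * 9 + 3 ∧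
      ∀ a < K, ∀ b < K, s'.arr 4 a b = subMatching Z σ (s.reg 41) a b := by
  simp only [subtractCmd]
  refine (Wp.forCmd (N := K) (T := 5) (fun j s' => ∀ a < K, ∀ b < K,
    s'.arr 4 a b = if b < j then subMatching Z σ (s.reg 41) a b else Z a b) h20
    (by simpa using h4) ?_).mono ?_
  · intro j hj s₁ ag₁ h33 _ hI
    have e22 : s₁.reg 22 = 0 := by rw [ag₁.reg 22 (by decide), h22]
    have e38 : s₁.reg 38 = 1 := by rw [ag₁.reg 38 (by decide), h38]
    have e41 : s₁.reg 41 = s.reg 41 := by rw [ag₁.reg 41 (by decide)]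
    have e6 : s₁.arr 6 0 j = (σ j : ℤ) + 1 := by rw [ag₁.arr 6 (by decide), h6 j hj]
    simp only [wp_seq, wp_load, wp_sub, wp_store]
    refine ⟨by norm_num, fun a ha b hb => ?_⟩
    simp [e22, e38, e41, e6, h33]
    by_cases hab : a = σ j ∧ b = j
    · obtain ⟨rfl, rfl⟩ := hab
      rw [if_pos ⟨rfl, rfl⟩, hI _ ha _ hb, if_neg (lt_irrefl _), if_pos (by omega), subMatching,
        if_pos rfl]
    · rw [if_neg hab, hI a ha b hb]
      by_cases hbj : b = j
      · subst hbj
        have : σ b ≠ a := fun e => hab ⟨e.symm, rfl⟩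
        simp [subMatching, this]
      · exact if_congr (by omega) rfl rfl
  · rintro s' t - ⟨ht, hI⟩
    refine ⟨by omega, fun a ha b hb => ?_⟩
    rw [hI a ha b hb, if_pos hb]

/-- The output may overwrite arrays `0`, `1` and `2`, because valuations and fractions are not read
after the padded matrix has been built. The common denominator in register `2` serves all weights.
-/
theorem wp_outputCmd {N : ℤ} {code : ℕ → ℤ} {k : ℕ} (h1 : s.reg 1 = m) (h2 : s.reg 2 = N)
    (h22 : s.reg 22 = 0) (h27 : s.reg 27 = k) (h38 : s.reg 38 = 1)
    (h5 : ∀ q, s.arr 5 0 q = code q) (h6 : ∀ g < m, s.arr 6 0 g = (σ g : ℤ) + 1) :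
    Wp outputCmd s fun s' t => t ≤ m * 8 + 7 ∧ s'.reg 27 = (k + 1 : ℕ) ∧
      s'.reg 26 = s.reg 26 - s.reg 41 ∧
      (∀ l, s'.arr 0 l 0 = if l = k then s.reg 41 else s.arr 0 l 0) ∧
      (∀ l, s'.arr 1 l 0 = if l = k then N else s.arr 1 l 0) ∧
      ∀ l, ∀ g < m, s'.arr 2 l g = if l = k then code (σ g) else s.arr 2 l g := by
  simp only [outputCmd, wp_seq, wp_store]
  refine (Wp.forCmd (N := m) (T := 4) (fun j s' => ∀ l, ∀ g < m,
    s'.arr 2 l g = if l = k ∧ g < j then code (σ g) else s.arr 2 l g) (by simp [h1]) (by simp)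
    ?_).mono ?_
  · intro j hj s₁ ag₁ h33 _ hI
    have e22 : s₁.reg 22 = 0 := by rw [ag₁.reg 22 (by decide)]; simp [h22]
    have e27 : s₁.reg 27 = k := by rw [ag₁.reg 27 (by decide)]; simp [h27]
    have e38 : s₁.reg 38 = 1 := by rw [ag₁.reg 38 (by decide)]; simp [h38]
    have e5 : s₁.arr 5 0 (σ j) = code (σ j) := by rw [ag₁.arr 5 (by decide)]; simp [h5]
    have e6 : s₁.arr 6 0 j = (σ j : ℤ) + 1 := by rw [ag₁.arr 6 (by decide)]; simp [h6 j hj]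
    simp only [wp_load, wp_sub, wp_store, wp_seq]
    refine ⟨by norm_num, fun l g hg => ?_⟩
    simp [e22, e27, e38, e6, e5, h33]
    by_cases hlg : l = k ∧ g = j
    · obtain ⟨rfl, rfl⟩ := hlg
      simp
    · rw [if_neg hlg, hI l g hg]
      exact if_congr (by omega) rfl rfl
  · rintro s₁ t₁ ag₁ ⟨ht₁, hI⟩
    have e26 : s₁.reg 26 = s.reg 26 := by rw [ag₁.reg 26 (by decide)]; simp
    have e27 : s₁.reg 27 = k := by rw [ag₁.reg 27 (by decide)]; simp [h27]
    have e38 : s₁.reg 38 = 1 := by rw [ag₁.reg 38 (by decide)]; simp [h38]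
    have e41 : s₁.reg 41 = s.reg 41 := by rw [ag₁.reg 41 (by decide)]; simp
    simp only [wp_add, wp_sub]
    refine ⟨by omega, by simp [e27, e38], by simp [e26, e41], fun l => ?_, fun l => ?_,
      fun l g hg => ?_⟩
    · rw [State.setReg_arr, State.setReg_arr, ag₁.arr 0 (by decide)]
      simp [h22, h27]
    · rw [State.setReg_arr, State.setReg_arr, ag₁.arr 1 (by decide)]
      simp [h22, h27, h2]
    · rw [State.setReg_arr, State.setReg_arr, hI l g hg]
      exact if_congr (by omega) rfl rfl

end

/-- The weighted matchings in `L` and the remaining matrix `Z` with sums `rem` make up `Z₀`. -/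
structure IsDecomposition (K : ℕ) (N : ℤ) (Z₀ Z : ℕ → ℕ → ℤ) (rem : ℤ)
    (L : List (ℤ × (ℕ → ℕ))) : Prop where
  sums : HasSums K rem Z
  rem_nonneg : 0 ≤ rem
  eq_add : ∀ a < K, ∀ b < K, Z₀ a b = Z a b + (L.map fun x => if x.2 b = a then x.1 else 0).sum
  sum_eq : N = rem + (L.map Prod.fst).sum
  pos : ∀ x ∈ L, 0 < x.1
  isMatching : ∀ x ∈ L, IsMatching K Z₀ x.2

theorem IsDecomposition.append {K : ℕ} {N : ℤ} {Z₀ Z : ℕ → ℕ → ℤ} {rem w : ℤ}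
    {L : List (ℤ × (ℕ → ℕ))} {σ : ℕ → ℕ} (h : IsDecomposition K N Z₀ Z rem L)
    (hσ : IsMatching K Z σ) (hw : 0 < w) (hwr : w ≤ rem) (hwZ : ∀ c < K, w ≤ Z (σ c) c) :
    IsDecomposition K N Z₀ (subMatching Z σ w) (rem - w) (L ++ [(w, σ)]) := by
  refine ⟨h.sums.subMatching hσ hwZ, by linarith, fun a ha b hb => ?_, ?_, fun x hx => ?_,
    fun x hx => ?_⟩
  · rw [h.eq_add a ha b hb, List.map_append, List.sum_append]
    simp [subMatching]
  · rw [h.sum_eq, List.map_append, List.sum_append]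
    simp
  · rcases List.mem_append.mp hx with hx | hx
    · exact h.pos x hx
    · rw [List.mem_singleton.mp hx]; exact hw
  · rcases List.mem_append.mp hx with hx | hx
    · exact h.isMatching x hx
    · rw [List.mem_singleton.mp hx]
      refine ⟨hσ.lt, hσ.inj, fun c hc => ?_⟩
      change 0 < Z₀ (σ c) c
      rw [h.eq_add _ (hσ.lt c hc) c hc]
      refine add_pos_of_pos_of_nonneg (hσ.pos c hc) (List.sum_nonneg fun y hy => ?_)
      obtain ⟨x, hx, rfl⟩ := List.mem_map.mp hy
      split_ifs
      · exact (h.pos x hx).le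
      · exact le_rfl

/-- The memory holds the list of weighted matchings as output. -/
def HoldsList (m : ℕ) (N : ℤ) (code : ℕ → ℤ) (L : List (ℤ × (ℕ → ℕ))) (s : State) : Prop :=
  ∀ (k : ℕ) (hk : k < L.length), s.arr 0 k 0 = L[k].1 ∧ s.arr 1 k 0 = N ∧
    ∀ g < m, s.arr 2 k g = code (L[k].2 g)

section

variable {K m : ℕ} {Z₀ Z : ℕ → ℕ → ℤ} {s : State} {N rem : ℤ} {code : ℕ → ℤ}
  {L : List (ℤ × (ℕ → ℕ))}

/-- The measure is the number of positive entries, plus one while `rem` is positive. Either the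
weight equals `rem` and the extra unit disappears, or a matched entry becomes zero. -/
theorem wp_roundCmd (hmK : m ≤ K) (h1 : s.reg 1 = m) (h2 : s.reg 2 = N) (h20 : s.reg 20 = K)
    (h22 : s.reg 22 = 0) (h5 : ∀ q, s.arr 5 0 q = code q) (hrem : 0 < rem)
    (hdec : IsDecomposition K N Z₀ Z rem L) (h26 : s.reg 26 = rem) (h27 : s.reg 27 = L.length)
    (h4 : ∀ a < K, ∀ b < K, s.arr 4 a b = Z a b) (hL : HoldsList m N code L s) :
    Wp roundCmd s fun s' t =>
      t ≤ K * 6 + K * (K * K * (K * 11 + 13) + 7) + K * 19 + m * 8 + 21 ∧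
      ∃ Z' rem' L', posCount K Z' + (if 0 < rem' then 1 else 0) < posCount K Z + 1 ∧
        IsDecomposition K N Z₀ Z' rem' L' ∧ s'.reg 26 = rem' ∧ s'.reg 27 = L'.length ∧
        (∀ a < K, ∀ b < K, s'.arr 4 a b = Z' a b) ∧ HoldsList m N code L' s' := by
  simp only [roundCmd, wp_seq]
  refine (wp_matchCmd hdec.sums hrem h20 h22 h4).mono ?_
  rintro s₁ t₁ ag₁ ⟨ht₁, σ, h6, hσ⟩
  have a4 : s₁.arr 4 = s.arr 4 := ag₁.arr 4 (by decide)
  refine (wp_weightCmd (s := s₁) hσ hrem (by rw [ag₁.reg 20 (by decide), h20])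
    (by rw [ag₁.reg 22 (by decide), h22]) (by rw [ag₁.reg 26 (by decide), h26])
    (by rw [a4]; exact h4) h6).mono ?_
  rintro s₂ t₂ ag₂ ⟨ht₂, h38, hw, hwr, hwZ, hor⟩
  have b4 : s₂.arr 4 = s.arr 4 := by rw [ag₂.arr 4 (by decide), a4]
  have b6 : s₂.arr 6 = s₁.arr 6 := ag₂.arr 6 (by decide)
  refine (wp_subtractCmd (s := s₂) (by rw [ag₂.reg 20 (by decide), ag₁.reg 20 (by decide), h20])
    (by rw [ag₂.reg 22 (by decide), ag₁.reg 22 (by decide), h22]) h38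
    (by rw [b4]; exact h4) (by rw [b6]; exact h6)).mono ?_
  rintro s₃ t₃ ag₃ ⟨ht₃, h4'⟩
  have ag : Agree roundCmd.regs [4, 6, 7] s s₃ :=
    ((ag₁.mono (by decide) (by decide)).trans (ag₂.mono (by decide) (by decide))).trans
      (ag₃.mono (by decide) (by decide))
  have e41 : s₃.reg 41 = s₂.reg 41 := ag₃.reg 41 (by decide)
  have e26 : s₃.reg 26 = rem := by
    rw [ag₃.reg 26 (by decide), ag₂.reg 26 (by decide), ag₁.reg 26 (by decide), h26]
  refine (wp_outputCmd (s := s₃) (m := m) (N := N) (code := code) (k := L.length) (σ := σ)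
    (by rw [ag.reg 1 (by decide), h1]) (by rw [ag.reg 2 (by decide), h2])
    (by rw [ag.reg 22 (by decide), h22])
    (by rw [ag₃.reg 27 (by decide), ag₂.reg 27 (by decide), ag₁.reg 27 (by decide), h27])
    (by rw [ag₃.reg 38 (by decide), h38]) (by rw [ag.arr 5 (by decide)]; exact h5)
    (fun g hg => by rw [ag₃.arr 6 (by decide), b6, h6 g (by omega)])).mono ?_
  rintro s₄ t₄ ag₄ ⟨ht₄, h27', h26', o0, o1, o2⟩
  rw [e41] at h26' o0
  rw [e26] at h26'
  refine ⟨by omega, _, _, _, ?_, hdec.append hσ hw hwr hwZ, h26', ?_, ?_, fun k hk => ?_⟩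
  · have hle := posCount_subMatching_le (K := K) (Z := Z) (σ := σ) hw.le
    rcases hor with h | ⟨c, hc, h⟩
    · rw [if_neg (by rw [h]; simp)]
      omega
    · have := posCount_subMatching_lt hσ hc
      rw [h]
      split_ifs <;> omega
  · rw [h27', List.length_append, List.length_singleton]
  · rw [ag₄.arr 4 (by decide)]; exact h4'
  · rw [o0, o1]
    rw [List.length_append, List.length_singleton] at hk
    by_cases hkL : k = L.length
    · subst hkL
      refine ⟨by simp, by simp, fun g hg => ?_⟩
      rw [o2 _ g hg]
      simp
    · have hk' : k < L.length := by omega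
      obtain ⟨p0, p1, p2⟩ := hL k hk'
      rw [List.getElem_append_left hk', if_neg hkL, if_neg hkL, ag.arr 0 (by decide),
        ag.arr 1 (by decide)]
      refine ⟨p0, p1, fun g hg => ?_⟩
      rw [o2 _ g hg, if_neg hkL, ag.arr 2 (by decide), p2 g hg]

theorem wp_decomposeCmd (hmK : m ≤ K) (h1 : s.reg 1 = m) (h2 : s.reg 2 = N) (h20 : s.reg 20 = K)
    (h22 : s.reg 22 = 0) (h5 : ∀ q, s.arr 5 0 q = code q) (hN : 0 < N) (hs : HasSums K N Z₀)
    (h4 : ∀ a < K, ∀ b < K, s.arr 4 a b = Z₀ a b) :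
    Wp decomposeCmd s fun s' t =>
      t ≤ (K * K + 1) * (K * 6 + K * (K * K * (K * 11 + 13) + 7) + K * 19 + m * 8 + 22) + 4 ∧
      ∃ Z L, IsDecomposition K N Z₀ Z 0 L ∧ s'.reg 0 = L.length ∧ HoldsList m N code L s' := by
  simp only [decomposeCmd, wp_seq, wp_const, wp_add]
  refine (Wp.whilePos (T := K * 6 + K * (K * K * (K * 11 + 13) + 7) + K * 19 + m * 8 + 21)
    (b := posCount K Z₀ + 1)
    (fun b s' => ∃ Z rem L, b = posCount K Z + (if 0 < rem then 1 else 0) ∧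
      IsDecomposition K N Z₀ Z rem L ∧ s'.reg 26 = rem ∧ s'.reg 27 = L.length ∧
      (∀ a < K, ∀ b < K, s'.arr 4 a b = Z a b) ∧ HoldsList m N code L s') ?_ ?_).mono ?_
  · refine ⟨Z₀, N, [], by simp [hN], ⟨hs, hN.le, by simp, by simp, by simp, by simp⟩, by simp [h2,
    h22],
      by simp, by simpa using h4, fun k hk => absurd hk (by simp)⟩
  · rintro b s₁ ag₁ hpos ⟨Z, rem, L, rfl, hdec, h26, h27, h4, hL⟩
    rw [h26] at hpos
    refine (wp_roundCmd (s := s₁) hmK (by rw [ag₁.reg 1 (by decide)]; simp [h1])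
      (by rw [ag₁.reg 2 (by decide)]; simp [h2]) (by rw [ag₁.reg 20 (by decide)]; simp [h20])
      (by rw [ag₁.reg 22 (by decide)]; simp [h22]) (by rw [ag₁.arr 5 (by decide)]; exact h5) hpos
      hdec h26 h27 h4 hL).mono ?_
    rintro s₂ t₂ - ⟨ht₂, Z', rem', L', hlt, h⟩
    exact ⟨ht₂, _, by rwa [if_pos hpos], Z', rem', L', rfl, h⟩
  · rintro s₁ t₁ ag₁ ⟨ht₁, ⟨b, Z, rem, L, -, hdec, h26, h27, -, hL⟩, hx⟩
    obtain rfl : rem = 0 := by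
      rw [h26] at hx
      exact le_antisymm (not_lt.mp hx) hdec.rem_nonneg
    have e22 : s₁.reg 22 = 0 := by rw [ag₁.reg 22 (by decide)]; simp [h22]
    refine ⟨?_, Z, L, hdec, by simp [h27, e22], hL⟩
    have := Nat.mul_le_mul_right
      (K * 6 + K * (K * K * (K * 11 + 13) + 7) + K * 19 + m * 8 + 21 + 1)
      (Nat.add_le_add_right (posCount_le K Z₀) 1)
    have e : (K * K + 1) * (K * 6 + K * (K * K * (K * 11 + 13) + 7) + K * 19 + m * 8 + 21 + 1) =
      (K * K + 1) * (K * 6 + K * (K * K * (K * 11 + 13) + 7) + K * 19 + m * 8 + 22) := rfl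
    omega

/-- A nonnegative matrix with row sums `0` vanishes, so nothing is left over. -/
theorem IsDecomposition.eq_sum (h : IsDecomposition K N Z₀ Z 0 L) :
    ∀ a < K, ∀ b < K,
      (∑ j : Fin L.length, if (L[j.1]).2 b = a then (L[j.1]).1 else 0) = Z₀ a b := by
  intro a ha b hb
  have hz : Z a b = 0 := by
    refine le_antisymm ?_ (h.sums.nonneg a ha b hb)
    rw [← h.sums.row a ha]
    exact Finset.single_le_sum (f := fun b => Z a b)
      (fun c hc => h.sums.nonneg a ha c (Finset.mem_range.mp hc)) (Finset.mem_range.mpr hb)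
  rw [h.eq_add a ha b hb, hz, zero_add,
    Fin.sum_univ_fun_getElem L (fun x => if x.2 b = a then x.1 else 0)]

end

/-! ### The algorithm -/

/-- The list of weighted allocations that belongs to a list of weighted matchings. -/
def weightedAllocations (n m : ℕ) (N : ℤ) (L : List (ℤ × (ℕ → ℕ))) : List (ℚ × Allocation n m) :=
  L.map fun x => ((x.1 : ℚ) / N, slotAllocation n m x.2)

theorem IsDecomposition.isMNWLottery {n m : ℕ} {v : Fin n → Fin m → ℕ} {A : Fin n → Fin m → ℝ}
    (hv : IsBinary v) (hA : IsFractionalMNW v A) {N : ℤ} {X : ℕ → ℕ → ℤ}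
    (hd : IsDivision n m N X (extend v)) (hX : ∀ (i : Fin n) (g : Fin m), (X i g : ℝ) = A i g * N)
    {Z : ℕ → ℕ → ℤ} {L : List (ℤ × (ℕ → ℕ))}
    (h : IsDecomposition (n * (2 * m) + m) N (slotMatrix n m N X (extend v)) Z 0 L) :
    IsMNWLottery v A (listLottery (weightedAllocations n m N L)) := by
  have hN : (0 : ℝ) < N := by exact_mod_cast hd.pos
  have e : listLottery (weightedAllocations n m N L) = fun E => ∑ j : Fin L.length,
      if slotAllocation n m (L[j.1]).2 = E then ((L[j.1]).1 : ℝ) / N else 0 := by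
    funext E
    rw [listLottery, weightedAllocations, List.map_map, ← Fin.sum_univ_fun_getElem, Rat.cast_sum]
    refine Finset.sum_congr rfl fun j _ => ?_
    simp only [Function.comp_apply]
    split_ifs <;> simp
  rw [e]
  refine isMNWLottery_of_family (fun j => ?_) ?_ (fun j _ => ?_) fun i g => ?_
  · exact div_nonneg (by exact_mod_cast (h.pos _ (List.getElem_mem j.2)).le) hN.le
  · rw [← Finset.sum_div, div_eq_one_iff_eq hN.ne']
    have := h.sum_eq
    rw [zero_add, ← Fin.sum_univ_fun_getElem] at this
    rw [this]
    push_cast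
    rfl
  · exact (hd.isRounding (Int.castRingHom ℝ) Int.cast_strictMono hX (extend_apply v)
      (h.isMatching _ (List.getElem_mem j.2))).isMNW hv hA
  · have := hd.sum_slotAllocation (fun j : Fin L.length => (L[j.1]).1) (fun j => (L[j.1]).2)
      h.eq_sum i g
    have hc : (∑ j : Fin L.length, if slotAllocation n m (L[j.1]).2 g = some i then
        ((L[j.1]).1 : ℝ) else 0) = A i g * N := by
      rw [← hX, ← this]
      push_cast
      rfl
    rw [eq_div_of_mul_eq hN.ne' hc.symm, Finset.sum_div]
    exact Finset.sum_congr rfl fun j _ => by split_ifs <;> simp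

/-- This is the content of array `5`: cells beyond the slots were never written, and their `0` is
the code for nobody. -/
theorem ownerCode_slotAllocation (n m : ℕ) (σ : ℕ → ℕ) (g : Fin m) :
    ownerCode (slotAllocation n m σ g) =
      if σ g < n * (2 * m) then ((σ g / (2 * m) + 1 : ℕ) : ℤ) else 0 := by
  unfold slotAllocation
  split_ifs <;> simp [ownerCode]

theorem HoldsList.holdsOutput {n m : ℕ} {N : ℤ} {L : List (ℤ × (ℕ → ℕ))} {s : State} (hN : 0 < N)
    (hpos : ∀ x ∈ L, 0 < x.1) (h0 : s.reg 0 = L.length)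
    (h : HoldsList m N
      (fun q => if q < n * (2 * m) then ((q / (2 * m) + 1 : ℕ) : ℤ) else 0) L s) :
    HoldsOutput s (weightedAllocations n m N L) := by
  refine ⟨by rw [h0, weightedAllocations, List.length_map], fun k hk => ?_⟩
  have hk' : k < L.length := by rwa [weightedAllocations, List.length_map] at hk
  obtain ⟨p0, p1, p2⟩ := h k hk'
  have e : (weightedAllocations n m N L)[k] = ((L[k].1 : ℚ) / N, slotAllocation n m L[k].2) := by
    simp [weightedAllocations]
  rw [e, p0, p1]
  refine ⟨hpos _ (List.getElem_mem hk'), hN, rfl, fun g => ?_⟩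
  rw [p2 g g.2, ownerCode_slotAllocation]

/-- Computes a lottery over maximum Nash welfare allocations. -/
def lotteryCmd : Cmd := scaleCmd ;; buildCmd ;; decomposeCmd

/-- A bound for the number of steps, for `n` agents, `m` goods and numbers of binary length `S`. -/
def stepBound {R : Type*} [CommSemiring R] (n m S : R) : R :=
  (n * (m * (n * (m * (9 * S + 9) + 7) + 18 * S + 18) + 7) + 5) +
  ((n * 6 + n * (2 * m) * 6 + m * 6 + n * (m * (m * 26 + 14) + m * 21 + 11) + 16) +
  (((n * (2 * m) + m) * (n * (2 * m) + m) + 1) * ((n * (2 * m) + m) * 6 + (n * (2 * m) + m) *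
    ((n * (2 * m) + m) * (n * (2 * m) + m) * ((n * (2 * m) + m) * 11 + 13) + 7) +
    (n * (2 * m) + m) * 19 + m * 8 + 22) + 4))

theorem stepBound_mono {n m S k : ℕ} (hn : n ≤ k) (hm : m ≤ k) (hS : S ≤ k) :
    stepBound n m S ≤ stepBound k k k := by
  unfold stepBound
  gcongr

theorem extend_eq {α : Type*} [Zero α] {n m : ℕ} (f : Fin n → Fin m → α) {i g : ℕ} (hi : i < n)
    (hg : g < m) : extend f i g = f ⟨i, hi⟩ ⟨g, hg⟩ := dif_pos ⟨hi, hg⟩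

theorem matrixArr_eq {n m : ℕ} (f : Fin n → Fin m → ℤ) {i g : ℕ} (hi : i < n) (hg : g < m) :
    matrixArr f i g = f ⟨i, hi⟩ ⟨g, hg⟩ := dif_pos ⟨hi, hg⟩

theorem size_le_inputSize {n m : ℕ} (A : Fin n → Fin m → ℚ) (i : Fin n) (g : Fin m) :
    (A i g).num.natAbs.size + (A i g).den.size ≤ inputSize A := by
  have h1 := Finset.single_le_sum
    (f := fun g => 1 + (A i g).num.natAbs.size + (A i g).den.size) (fun _ _ => Nat.zero_le _)
    (Finset.mem_univ g)
  have h2 := Finset.single_le_sum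
    (f := fun i => ∑ g, (1 + (A i g).num.natAbs.size + (A i g).den.size))
    (fun _ _ => Nat.zero_le _) (Finset.mem_univ i)
  unfold inputSize
  omega

theorem computesMNWLotteryInPolyTime_lotteryCmd : ComputesMNWLotteryInPolyTime lotteryCmd := by
  -- Defined over any commutative semiring, `stepBound` is both the polynomial and its value; the
  -- input size dominates `n`, `m` and all binary lengths, so one variable suffices.
  refine ⟨stepBound Polynomial.X Polynomial.X Polynomial.X, fun n m v A hv hA => ?_⟩
  have hnn : ∀ i g, 0 ≤ A i g := fun i g => Rat.cast_nonneg.mp (hA.1.1 i g).1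
  have hrun : Wp lotteryCmd (inputState v A) fun s t => t ≤ stepBound n m (inputSize A) ∧
      ∃ L, HoldsOutput s L ∧ IsMNWLottery v (fun i g => (A i g : ℝ)) (listLottery L) := by
    simp only [lotteryCmd, wp_seq]
    refine (wp_scaleCmd (n := n) (m := m) (S := inputSize A)
      (num := extend fun i g => (A i g).num.natAbs) (den := extend fun i g => (A i g).den)
      (by simp [inputState]) (by simp [inputState]) (fun i hi g hg => ?_) (fun i hi g hg => ?_)
      (fun i hi g hg => ?_) (fun i hi g hg => ?_) (fun i hi g hg => ?_)
      (by simp [inputState])).mono ?_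
    · rw [extend_eq _ hi hg]
      simp only [inputState, one_ne_zero, if_false, if_true]
      rw [matrixArr_eq _ hi hg, Int.natAbs_of_nonneg (Rat.num_nonneg.mpr (hnn _ _))]
    · rw [extend_eq _ hi hg]
      simp only [inputState]
      norm_num
      rw [matrixArr_eq _ hi hg]
    · rw [extend_eq _ hi hg]; exact (A _ _).den_pos
    · rw [extend_eq _ hi hg]; have := size_le_inputSize A ⟨i, hi⟩ ⟨g, hg⟩; omega
    · rw [extend_eq _ hi hg]; have := size_le_inputSize A ⟨i, hi⟩ ⟨g, hg⟩; omega
    rintro s₁ t₁ ag₁ ⟨ht₁, hN, hX⟩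
    have hX' : ∀ (i : Fin n) (g : Fin m), (s₁.arr 3 i g : ℝ) = (A i g : ℝ) * (s₁.reg 2 : ℤ) := by
      intro i g
      have h := hX i i.2 g g.2
      rw [extend_apply, extend_apply, Int.natAbs_of_nonneg (Rat.num_nonneg.mpr (hnn _ _))] at h
      have hden : ((A i g).den : ℝ) ≠ 0 := by exact_mod_cast (A i g).den_nz
      have h' : (s₁.arr 3 i g : ℝ) * (A i g).den = (A i g).num * (s₁.reg 2 : ℤ) := by
        exact_mod_cast h
      rw [Rat.cast_def, div_mul_eq_mul_div, eq_div_iff hden, h']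
    have hNr : (0 : ℝ) < (s₁.reg 2 : ℤ) := by exact_mod_cast hN
    have hd : IsDivision n m (s₁.reg 2) (s₁.arr 3) (extend v) := by
      refine ⟨hN, fun i hi g hg => ?_, fun g hg => ?_, hv.extend⟩
      · have := hX' ⟨i, hi⟩ ⟨g, hg⟩
        have h0 := (hA.1.1 ⟨i, hi⟩ ⟨g, hg⟩).1
        have : (0 : ℝ) ≤ (s₁.arr 3 i g : ℝ) := by rw [this]; positivity
        exact_mod_cast this
      · have : ((∑ i ∈ Finset.range n, s₁.arr 3 i g : ℤ) : ℝ) ≤ (s₁.reg 2 : ℤ) := by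
          rw [Int.cast_sum, Finset.sum_range,
            Finset.sum_congr rfl fun i _ => hX' i ⟨g, hg⟩, ← Finset.sum_mul]
          exact mul_le_of_le_one_left hNr.le (hA.1.2 ⟨g, hg⟩)
        exact_mod_cast this
    refine (wp_buildCmd (s := s₁) hd (by rw [ag₁.reg 0 (by decide)]; simp [inputState])
      (by rw [ag₁.reg 1 (by decide)]; simp [inputState]) rfl (fun i hi g hg => ?_)
      (fun _ _ _ _ => rfl) (by rw [ag₁.arr 4 (by decide)]; simp [inputState])
      (by rw [ag₁.arr 5 (by decide)]; simp [inputState])).mono ?_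
    · rw [ag₁.arr 0 (by decide), extend_eq _ hi hg]
      simp only [inputState, if_true]
      rw [matrixArr_eq _ hi hg]
    rintro s₂ t₂ ag₂ ⟨ht₂, h20, h22, h4, h5⟩
    refine (wp_decomposeCmd (s := s₂) (m := m) (Nat.le_add_left _ _)
      (by rw [ag₂.reg 1 (by decide), ag₁.reg 1 (by decide)]; simp [inputState])
      (ag₂.reg 2 (by decide)) h20 h22 h5 hN hd.hasSums h4).mono ?_
    rintro s₃ t₃ - ⟨ht₃, Z, L, hdec, h0, hL⟩
    refine ⟨?_, _, hL.holdsOutput hN hdec.pos h0, hdec.isMNWLottery hv hA hd hX'⟩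
    simpa only [stepBound] using Nat.add_le_add ht₁ (Nat.add_le_add ht₂ ht₃)
  obtain ⟨s, t, hr, ht, L, hL, hlot⟩ := hrun
  refine ⟨s, t, L, hr, ht.trans ?_, hL, hlot⟩
  have hq : (stepBound Polynomial.X Polynomial.X Polynomial.X : Polynomial ℕ).eval (inputSize A) =
      stepBound (inputSize A) (inputSize A) (inputSize A) := by
    simp [stepBound]
  rw [hq]
  exact stepBound_mono (by unfold inputSize; omega) (by unfold inputSize; omega) le_rfl

end MNW

theorem theorem4 :
    (∀ (n m : ℕ) (v : Fin n → Fin m → ℕ) (A : Fin n → Fin m → ℝ),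
      MNW.IsBinary v → MNW.IsFractionalMNW v A →
      ∃ p : MNW.Allocation n m → ℝ, MNW.IsMNWLottery v A p) ∧
    ∃ P : MNW.Cmd, MNW.ComputesMNWLotteryInPolyTime P :=
  ⟨fun _ _ _ _ hv hA => MNW.exists_isMNWLottery hv hA,
    MNW.lotteryCmd, MNW.computesMNWLotteryInPolyTime_lotteryCmd⟩
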